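/- **Conventions.** Digraphs are finite, $G=(V(G),E(G))$ with $E(G)\subseteq V(G)\times V(G)$, and $n=|V(G)|$. $N_d^+(v)$ is the set of vertices $u$ such that there is a directed path from $v$ to $u$ of length at most $d$, and $N_d^+(D)=\bigcup_{v\in D}N_d^+(v)$. *Shallow minors.* A digraph $H$ is a depth $r$ minor of $G$ if there are pairwise disjoint subgraphs $\delta(v)\subseteq G$ ($v\in V(H)$) and edges $\delta(e)\in E(G)$ ($e\in E(H)$) such that $\delta(uv)$ starts in $\delta(u)$ and ends in $\delta(v)$, and such that, writing $\mathrm{in}(v)$ and $\mathrm{out}(v)$ for the sets of vertices of $\delta(v)$ that lie on $\delta(e)$ for some edge $e$ of $H$ into $v$, respectively out of $v$: every vertex of $\mathrm{in}(v)$ reaches every vertex of $\mathrm{out}(v)$, some vertex of $\delta(v)$ reaches all of $\mathrm{out}(v)$, and some vertex of $\delta(v)$ is reached from all of $\mathrm{in}(v)$, always by directed paths of length at most $r$ inside $\delta(v)$. *Crowns.* The crown $S_q$ ($q>0$) has vertices $v_1,\dots,v_q$ and $u_{i,j}$ ($1\le i<j\le q$) and edges $u_{i,j}v_i$, $u_{i,j}v_j$.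 A class $\mathcal C$ of digraphs is *nowhere crownful* if for every $r\in\mathbb N$ there is $q(r)>0$ such that $S_{q(r)}$ is not a depth $r$ minor of any $G\in\mathcal C$; it is *effectively* nowhere crownful if the function $r\mapsto q(r)$ can be chosen computable. *Problems.* Given a digraph $G$ and $d,k\in\mathbb N$, decide whether there is a set $D\subseteq V(G)$ with $|D|=k$ such that 1. (directed $d$-dominating set) $N_d^+(D)=V(G)$; 2. (directed independent $d$-dominating set) $N_d^+(D)=V(G)$ and $(u,v)\notin E(G)$ for all $u,v\in D$; 3. (the same with independence at distance $d$) $N_d^+(D)=V(G)$, $(u,v)\notin E(G)$ for all $u,v\in D$, and $v\notin N_d^+(u)$ for all distinct $u,v\in D$; 4. (distance-$d$ dominating out-branching) $N_d^+(D)=V(G)$ and the induced subgraph $G[D]$ is an out-branching, i.e. a directed tree with all edges oriented away from a root; 5. (the same with a not necessarily induced out-branching) $N_d^+(D)=V(G)$ and $G$ has a subgraph with vertex set $D$ that is an out-branching; 6. (distance-$d$ independent set) $(u,v)\notin E(G)$ for all $u,v\in D$, and $v\notin N_d^+(u)$ for all distinct $u,v\in D$. For $d=1$ these are directed dominating set,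 directed independent dominating set (2 and 3 coincide), dominating out-branching (4 and 5) and independent set. An algorithm is a program of a random access machine with unit-cost addition and truncated subtraction of natural numbers, conditional branching, loops and indirect addressing; its input is the adjacency matrix of $G$ together with $n$, $k$ and $d$. It decides a problem *on* $\mathcal C$ if it answers correctly on all instances with $G\in\mathcal C$. **Theorem.** Let $\mathcal C$ be a nowhere crownful class of digraphs and let $Q$ be any of the problems 1–6. (a) $Q$ is fixed-parameter tractable on $\mathcal C$ with parameter $k$ for every distance $d$, uniformly in $d$: there are a single program, a constant $c$ and a function $f:\mathbb N^2\to\mathbb N$ such that $k\mapsto f(d,k)$ is computable for every fixed $d$ and the program decides $Q$ on $\mathcal C$ in at most $f(d,k)\cdot(n+1)^{c}$ steps. (b) If $\mathcal C$ is effectively nowhere crownful, then $Q$, with $d$ and $k$ as parts of the input, is fixed-parameter tractable on $\mathcal C$ with parameter $k+d$: there are a program, a constant $c$ and a computable function $f:\mathbb N\to\mathbb N$ such that the program decides $Q$ on $\mathcal C$ in at most $f(k+d)\cdot(n+1)^{c}$ steps. -/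

import Mathlib

namespace DiFPT

/-! ### Digraphs, distances, shallow directed minors, crowns -/

/-- A finite digraph, with vertex set `{0, …, n - 1}`. -/
structure FinDigraph where
  n : ℕ
  graph : Digraph (Fin n)

/-- `Reach G d u v`: there is a directed walk, equivalently a directed path, of length at most `d`
from `u` to `v`. -/
def Reach {V : Type*} (G : Digraph V) : ℕ → V → V → Prop
  | 0, u, v => u = v
  | d + 1, u, v => u = v ∨ ∃ w, G.Adj u w ∧ Reach G d w v

/-- The `d`-outneighbourhood of a vertex. -/
def outNbhd {V : Type*} (G : Digraph V) (d : ℕ) (v : V) : Set V :=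
  {u | Reach G d v u}

/-- A directed model of `H` in `G`: the branch set of `u` is the subgraph of `G` with vertex set
`verts u` and edge relation `(sub u).Adj`, and the edge `uv` of `H` is mapped to the edge
`edge u v` of `G` (the value of `edge u v` is irrelevant if `uv` is not an edge of `H`).
The conditions on paths inside the branch sets are in `DirectedModel.HasDepth`. -/
structure DirectedModel {U V : Type*} (H : Digraph U) (G : Digraph V) where
  verts : U → Set V
  sub : U → Digraph V
  sub_spec : ∀ u a b, (sub u).Adj a b → G.Adj a b ∧ a ∈ verts u ∧ b ∈ verts u
  disjoint : ∀ u v, u ≠ v → Disjoint (verts u) (verts v)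
  edge : U → U → V × V
  edge_spec : ∀ u v, H.Adj u v →
    G.Adj (edge u v).1 (edge u v).2 ∧ (edge u v).1 ∈ verts u ∧ (edge u v).2 ∈ verts v

namespace DirectedModel

variable {U V : Type*} {H : Digraph U} {G : Digraph V}

/-- Vertices of the branch set of `v` that lie on the image of an edge of `H` into `v`. -/
def inSet (M : DirectedModel H G) (v : U) : Set V :=
  {x | x ∈ M.verts v ∧ ∃ u, H.Adj u v ∧ (x = (M.edge u v).1 ∨ x = (M.edge u v).2)}

/-- Vertices of the branch set of `v` that lie on the image of an edge of `H` out of `v`. -/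
def outSet (M : DirectedModel H G) (v : U) : Set V :=
  {x | x ∈ M.verts v ∧ ∃ w, H.Adj v w ∧ (x = (M.edge v w).1 ∨ x = (M.edge v w).2)}

/-- The paths that a directed model needs in its branch sets exist, with length at most `r`. -/
def HasDepth (M : DirectedModel H G) (r : ℕ) : Prop :=
  ∀ v, (∀ x ∈ M.inSet v, ∀ y ∈ M.outSet v, Reach (M.sub v) r x y) ∧
    (∃ s ∈ M.verts v, ∀ y ∈ M.outSet v, Reach (M.sub v) r s y) ∧
    (∃ t ∈ M.verts v, ∀ x ∈ M.inSet v, Reach (M.sub v) r x t)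

end DirectedModel

/-- `H` is a depth `r` minor of `G`. -/
def IsDepthMinor {U V : Type*} (r : ℕ) (H : Digraph U) (G : Digraph V) : Prop :=
  ∃ M : DirectedModel H G, M.HasDepth r

/-- The crown `S_q`: principal vertices `v_i`, `i < q`, and vertices `u_{i,j}`, `i < j < q`, with
the edges from `u_{i,j}` to `v_i` and to `v_j`. -/
def crown (q : ℕ) : Digraph (Fin q ⊕ {p : Fin q × Fin q // p.1 < p.2}) where
  Adj
    | .inr p, .inl i => i = p.1.1 ∨ i = p.1.2
    | _, _ => False

/-- For every depth `r` some crown is not a depth `r` minor of any member of the class. -/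
def NowhereCrownful (C : Set FinDigraph) : Prop :=
  ∀ r, ∃ q, 0 < q ∧ ∀ G ∈ C, ¬ IsDepthMinor r (crown q) G.graph

/-- Nowhere crownful, with an order of the excluded crown that is computable from the depth. -/
def EffectivelyNowhereCrownful (C : Set FinDigraph) : Prop :=
  ∃ q : ℕ → ℕ, Computable q ∧
    ∀ r, 0 < q r ∧ ∀ G ∈ C, ¬ IsDepthMinor r (crown (q r)) G.graph

/-! ### The decision problems -/

/-- `D` is a `d`-dominating set: every vertex is in the `d`-outneighbourhood of a member of `D`. -/
def IsDominating {V : Type*} (G : Digraph V) (d : ℕ) (D : Finset V) : Prop :=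
  ∀ v, ∃ u ∈ D, v ∈ outNbhd G d u

/-- `D` is independent: no edge has both ends in `D`. -/
def IsIndependent {V : Type*} (G : Digraph V) (D : Finset V) : Prop :=
  ∀ u ∈ D, ∀ v ∈ D, ¬ G.Adj u v

/-- `D` is distance-`d` independent: it is independent, and no member reaches another member by a
directed path of length at most `d`. For `d ≤ 1` this is independence. -/
def IsDistIndependent {V : Type*} (G : Digraph V) (d : ℕ) (D : Finset V) : Prop :=
  IsIndependent G D ∧ ∀ u ∈ D, ∀ v ∈ D, u ≠ v → v ∉ outNbhd G d u

/-- `T` is an out-branching with vertex set `D` and root `r`: a directed tree all of whose edges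
are oriented away from the root. -/
def IsOutBranching {V : Type*} (T : Digraph V) (D : Finset V) (r : V) : Prop :=
  r ∈ D ∧ (∀ u v, T.Adj u v → u ∈ D ∧ v ∈ D) ∧ (∀ u, ¬ T.Adj u r) ∧
    (∀ v ∈ D, v ≠ r → ∃! u, T.Adj u v) ∧ (∀ v ∈ D, Relation.ReflTransGen T.Adj r v)

/-- The subgraph `G[D]`, as an edge relation on the vertices of `G`. -/
def inducedOn {V : Type*} (G : Digraph V) (D : Finset V) : Digraph V where
  Adj u v := u ∈ D ∧ v ∈ D ∧ G.Adj u v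

/-- A decision problem on finite digraphs with two natural numbers `d` (the distance) and `k`
(the solution size): `Q G d k` says that the instance is a yes-instance. -/
abbrev DistanceProblem := FinDigraph → ℕ → ℕ → Prop

/-- Directed `d`-dominating set. -/
def dominatingSet : DistanceProblem := fun G d k =>
  ∃ D : Finset (Fin G.n), D.card = k ∧ IsDominating G.graph d D

/-- Directed independent `d`-dominating set: a `d`-dominating set without edges inside. -/
def independentDominatingSet : DistanceProblem := fun G d k =>
  ∃ D : Finset (Fin G.n), D.card = k ∧ IsDominating G.graph d D ∧ IsIndependent G.graph D

/-- The variant of the previous problem where also the independence is at distance `d`. -/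
def distIndependentDominatingSet : DistanceProblem := fun G d k =>
  ∃ D : Finset (Fin G.n), D.card = k ∧ IsDominating G.graph d D ∧ IsDistIndependent G.graph d D

/-- Distance-`d` dominating out-branching: a `d`-dominating set `D` such that `G[D]` is an
out-branching. -/
def dominatingOutBranching : DistanceProblem := fun G d k =>
  ∃ D : Finset (Fin G.n), D.card = k ∧ IsDominating G.graph d D ∧
    ∃ r, IsOutBranching (inducedOn G.graph D) D r

/-- The variant of the previous problem where the out-branching with vertex set `D` is a subgraph
of `G`, not necessarily an induced one. -/
def dominatingSpanningOutBranching : DistanceProblem := fun G d k =>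
  ∃ D : Finset (Fin G.n), D.card = k ∧ IsDominating G.graph d D ∧
    ∃ T ≤ G.graph, ∃ r, IsOutBranching T D r

/-- Distance-`d` independent set. -/
def independentSet : DistanceProblem := fun G d k =>
  ∃ D : Finset (Fin G.n), D.card = k ∧ IsDistIndependent G.graph d D

/-! ### The machine model: a random access machine that adds and subtracts at unit cost -/

/-- Structured programs of a random access machine. All operands are numbers of registers, except
the constant `a` in `const x a`. -/
inductive Program where
  | const (x a : ℕ)
  | add (x y z : ℕ)
  | sub (x y z : ℕ)
  | load (x y : ℕ)
  | store (x y : ℕ)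
  | seq (P Q : Program)
  | ifPos (x : ℕ) (P Q : Program)
  | whilePos (x : ℕ) (P : Program)

/-- The state of the machine: registers and memory cells, each holding a natural number. -/
structure MachineState where
  reg : ℕ → ℕ
  mem : ℕ → ℕ

/-- Write the value `a` into register `x`. -/
def MachineState.setReg (s : MachineState) (x a : ℕ) : MachineState :=
  { s with reg := Function.update s.reg x a }

/-- Write the value `a` into memory cell `x`. -/
def MachineState.setMem (s : MachineState) (x a : ℕ) : MachineState :=
  { s with mem := Function.update s.mem x a }

/-- `Exec P s s' t`: started in the state `s`, the program `P` halts in the state `s'` after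
exactly `t` steps. Every elementary instruction and every evaluation of the condition of a branch
or a loop is one step. -/
inductive Exec : Program → MachineState → MachineState → ℕ → Prop
  | const (x a s) : Exec (.const x a) s (s.setReg x a) 1
  | add (x y z s) : Exec (.add x y z) s (s.setReg x (s.reg y + s.reg z)) 1
  | sub (x y z s) : Exec (.sub x y z) s (s.setReg x (s.reg y - s.reg z)) 1
  | load (x y s) : Exec (.load x y) s (s.setReg x (s.mem (s.reg y))) 1
  | store (x y s) : Exec (.store x y) s (s.setMem (s.reg x) (s.reg y)) 1
  | seq {P Q s s₁ s₂ t₁ t₂} : Exec P s s₁ t₁ → Exec Q s₁ s₂ t₂ →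
      Exec (.seq P Q) s s₂ (t₁ + t₂)
  | ifPos_true {x P Q s s₁ t} : 0 < s.reg x → Exec P s s₁ t →
      Exec (.ifPos x P Q) s s₁ (t + 1)
  | ifPos_false {x P Q s s₁ t} : s.reg x = 0 → Exec Q s s₁ t →
      Exec (.ifPos x P Q) s s₁ (t + 1)
  | whilePos_stop {x P s} : s.reg x = 0 → Exec (.whilePos x P) s s 1
  | whilePos_step {x P s s₁ s₂ t₁ t₂} : 0 < s.reg x → Exec P s s₁ t₁ →
      Exec (.whilePos x P) s₁ s₂ t₂ → Exec (.whilePos x P) s s₂ (t₁ + t₂ + 1)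

open Classical in
/-- The initial state for the instance `(G, d, k)`: the registers `0`, `1`, `2` hold the number `n`
of vertices, `k` and `d`, the memory cell `i * n + j` holds the entry `(i, j)` of the adjacency
matrix, and everything else is `0`. -/
noncomputable def initState (G : FinDigraph) (d k : ℕ) : MachineState where
  reg := fun x => if x = 0 then G.n else if x = 1 then k else if x = 2 then d else 0
  mem := fun a => if ∃ i j : Fin G.n, a = i.1 * G.n + j.1 ∧ G.graph.Adj i j then 1 else 0

/-- On all instances with a digraph from `C`, the program `P` halts after at most `T n d k` steps,
where `n` is the number of vertices, and answers correctly whether `Q G d k` holds: register `0` is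
nonzero at the end if and only if the answer is yes. -/
def DecidesWithin (C : Set FinDigraph) (Q : DistanceProblem) (P : Program)
    (T : ℕ → ℕ → ℕ → ℕ) : Prop :=
  ∀ G ∈ C, ∀ d k, ∃ s t, Exec P (initState G d k) s t ∧ t ≤ T G.n d k ∧ (0 < s.reg 0 ↔ Q G d k)

/-- On the class `C` the problem `Q`, with `d` and `k` as parts of the input, is fixed-parameter
tractable with parameter `k + d`: solvable in time `f (k + d) * n ^ O(1)`, `f` computable. -/
def FPTOn (C : Set FinDigraph) (Q : DistanceProblem) : Prop :=
  ∃ (P : Program) (f : ℕ → ℕ) (c : ℕ), Computable f ∧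
    DecidesWithin C Q P (fun n d k => f (k + d) * (n + 1) ^ c)

/-- On the class `C` the problem `Q` is fixed-parameter tractable with parameter `k` for every
fixed distance `d`, with a computable function `f d` for each `d`, and this by a single program
(which receives `d` as part of its input) and with a single exponent for all distances. -/
def FPTOnAtEachDistance (C : Set FinDigraph) (Q : DistanceProblem) : Prop :=
  ∃ (P : Program) (f : ℕ → ℕ → ℕ) (c : ℕ), (∀ d, Computable (f d)) ∧
    DecidesWithin C Q P (fun n d k => f d k * (n + 1) ^ c)

end DiFPT

/-!
# Distance problems on nowhere crownful classes of digraphs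

All six problems ask for the same kind of object. For `k ≥ 1` a solution is a tree, built by hanging
one tree below the root of another, whose vertices satisfy local constraints: which vertices may
occur, which may be the child of which, and which may not both occur (`graphConstraints`,
`HasTreeSolution`). If no tree is asked for, then any two members of the solution must not be in
conflict, and every list of them is a tree (`dominatingSet_iff`, …, `independentSet_iff`).

*Excluding a crown.* Let the crown of order `t` not be a minor of depth `r`. After deleting a
bounded number of vertices, a large part of any family of sources has sparse balls, that is, no
vertex is reached within the given distance by many of them (`exists_sparse_sources`). Otherwise `t`
vertices could be found one after the other that are all reached by many sources whose smaller balls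
are sparse; for every pair of the `t` vertices, one of these sources and two walks can then be
chosen, disjoint from those for the other pairs, and this is a crown (`crown_isDepthMinor`). It
follows that ladders are short (`ladder_bound`, `ladder_card_le`): there is no long sequence of sets
`Y i` of size at most `k`, together with sets `X i` of size at most `k` that do not reach `Y i` but
reach all the earlier `Y j`. The bound depends only on `t`, `r` and `k`.

*Two greedy procedures, both short because ladders are.*
* A domination core `B`: a vertex is added as long as there are at most `k` vertices that dominate
  `B` but not this vertex. In the end, `k` vertices which dominate `B` dominate everything
  (`IsCore.length_le`).
* A collection `F` of trees: it starts with the trees that have one vertex; the join of two members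
  of `F` is added as long as there are at most `k` vertices that are compatible with it, but are in
  conflict with all members of `F` that have the same root, the same size, and dominate the same
  part of `B`. For fixed root, size and dominated part this happens only a bounded number of times
  (`IsCollection.length_le`). In the end, any part of a solution can be exchanged for a member of
  `F` without disturbing the rest, so that there is a solution if and only if there is one in `F`
  (`IsTree.exists_representative`, `exists_solution_iff`).

Whether at most `k` vertices have such a property is decided by trying all assignments of `k` labels
to the boundedly many objects to be hit, and looking for one vertex per label (`coverable_iff`).

*The machine.* `Ev Γ f` states that some program evaluates `f`, in polynomial time, from states that
represent the data described by `Γ`. This notion is closed under arithmetic, case distinction,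
reading from the memory and bounded recursion (`Ev.fold`), and hence under the logical operations
with bounded quantifiers which the conditions above are made of. The only other ingredient is a loop
that appends values to the memory (`Phase.loop`). It fills in the tables of distances, then the
core, then the collection (`phase_tables`, `phase_core`, `phase_collection`). The time is polynomial
in `n + 1` and in a primitive recursive function `parameterBound` of `d`, `k` and `t`.

The program neither knows the class nor the order `t` of the excluded crown, which enters the time
bound only. So one program serves all distances. The function `k ↦ f d k` is computable for each
fixed `d`, because `t = q (d + 1)` is a constant then; and if `q` is computable, the bound is
computable in both arguments, and is dominated by a computable function of `k + d`
(`exists_computable_bound`).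
-/


namespace DiFPT

/-! ### Walks that avoid a set of vertices -/

section Walks

variable {V : Type*} {G : Digraph V}

/-- `AvoidReach G S e u v`: there is a walk from `u` to `v` with at most `e` vertices, none of which
lies in `S`. Counting vertices instead of edges makes the relation empty for `e = 0`. -/
def AvoidReach (G : Digraph V) (S : Finset V) : ℕ → V → V → Prop
  | 0, _, _ => False
  | e + 1, u, v => u ∉ S ∧ (u = v ∨ ∃ w, G.Adj u w ∧ AvoidReach G S e w v)

theorem AvoidReach.mono_set {S T : Finset V} (h : S ⊆ T) {e : ℕ} {u v : V} :
    AvoidReach G T e u v → AvoidReach G S e u v := by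
  induction e generalizing u with
  | zero => exact id
  | succ e ih =>
    rintro ⟨hu, rfl | ⟨w, hw, h'⟩⟩
    · exact ⟨fun hs => hu (h hs), Or.inl rfl⟩
    · exact ⟨fun hs => hu (h hs), Or.inr ⟨w, hw, ih h'⟩⟩

theorem AvoidReach.succ {S : Finset V} {e : ℕ} {u v : V} :
    AvoidReach G S e u v → AvoidReach G S (e + 1) u v := by
  induction e generalizing u with
  | zero => exact False.elim
  | succ e ih =>
    rintro ⟨hu, rfl | ⟨w, hw, h'⟩⟩
    · exact ⟨hu, Or.inl rfl⟩
    · exact ⟨hu, Or.inr ⟨w, hw, ih h'⟩⟩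

theorem AvoidReach.mono {S : Finset V} {e e' : ℕ} (h : e ≤ e') {u v : V} :
    AvoidReach G S e u v → AvoidReach G S e' u v := by
  induction h with
  | refl => exact id
  | step _ ih => exact fun hr => (ih hr).succ

theorem AvoidReach.end_notMem {S : Finset V} {e : ℕ} {u v : V} :
    AvoidReach G S e u v → v ∉ S := by
  induction e generalizing u with
  | zero => exact False.elim
  | succ e ih =>
    rintro ⟨hu, rfl | ⟨w, hw, h'⟩⟩
    · exact hu
    · exact ih h'

theorem Reach.refl (d : ℕ) (u : V) : Reach G d u u := by
  cases d with
  | zero => rfl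
  | succ d => exact Or.inl rfl

theorem Reach.mono_graph {H : Digraph V} (h : ∀ a b, G.Adj a b → H.Adj a b) {d : ℕ} {u v : V} :
    Reach G d u v → Reach H d u v := by
  induction d generalizing u with
  | zero => exact id
  | succ d ih =>
    rintro (rfl | ⟨w, hw, h'⟩)
    · exact Or.inl rfl
    · exact Or.inr ⟨w, h _ _ hw, ih h'⟩

theorem Reach.succ {d : ℕ} {u v : V} : Reach G d u v → Reach G (d + 1) u v := by
  induction d generalizing u with
  | zero => exact Or.inl
  | succ d ih =>
    rintro (rfl | ⟨w, hw, h'⟩)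
    · exact Or.inl rfl
    · exact Or.inr ⟨w, hw, ih h'⟩

theorem Reach.mono {d d' : ℕ} (h : d ≤ d') {u v : V} : Reach G d u v → Reach G d' u v := by
  induction h with
  | refl => exact id
  | step _ ih => exact fun hr => (ih hr).succ

theorem Reach.trans {c d : ℕ} {u v w : V} (h : Reach G c u v) (h' : Reach G d v w) :
    Reach G (c + d) u w := by
  induction c generalizing u with
  | zero => cases h; simpa using h'
  | succ c ih =>
    rw [Nat.add_right_comm]
    rcases h with rfl | ⟨x, hx, h⟩
    · exact h'.mono (by omega)
    · exact Or.inr ⟨x, hx, ih h⟩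

/-- A walk either avoids `S` or splits at a vertex of `S`. -/
theorem Reach.avoid_or (S : Finset V) {d : ℕ} {u v : V} (h : Reach G d u v) :
    AvoidReach G S (d + 1) u v ∨ ∃ z ∈ S, ∃ c ≤ d, Reach G c u z ∧ Reach G (d - c) z v := by
  induction d generalizing u with
  | zero =>
    obtain rfl : u = v := h
    by_cases hu : u ∈ S
    · exact Or.inr ⟨u, hu, 0, le_rfl, rfl, rfl⟩
    · exact Or.inl ⟨hu, Or.inl rfl⟩
  | succ d ih =>
    by_cases hu : u ∈ S
    · exact Or.inr ⟨u, hu, 0, Nat.zero_le _, rfl, h⟩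
    rcases h with rfl | ⟨w, hw, h⟩
    · exact Or.inl ⟨hu, Or.inl rfl⟩
    · rcases ih h with h | ⟨z, hz, c, hc, h1, h2⟩
      · exact Or.inl ⟨hu, Or.inr ⟨w, hw, h⟩⟩
      · exact Or.inr ⟨z, hz, c + 1, by omega, Or.inr ⟨w, hw, h1⟩, by
          rwa [Nat.add_sub_add_right]⟩

/-- The digraph `G` restricted to the edges with both ends in `W`. -/
def restrictTo (G : Digraph V) (W : Set V) : Digraph V where
  Adj a b := G.Adj a b ∧ a ∈ W ∧ b ∈ W

/-- A vertex `x` reached with exactly `e + 1` vertices is entered from the last vertex `y` of a walk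
whose few vertices are all reached with at most `e` vertices. -/
theorem AvoidReach.last_step [DecidableEq V] {S : Finset V} {e : ℕ} {u x : V}
    (h : AvoidReach G S (e + 1) u x) (h' : ¬ AvoidReach G S e u x) :
    (e = 0 ∧ u = x) ∨ ∃ W : Finset V, W.card ≤ e ∧ u ∈ W ∧ (∀ w ∈ W, AvoidReach G S e u w) ∧
      ∃ y ∈ W, G.Adj y x ∧ Reach (restrictTo G W) e u y := by
  induction e generalizing u with
  | zero =>
    rcases h with ⟨_, rfl | ⟨w, _, hw⟩⟩
    · exact Or.inl ⟨rfl, rfl⟩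
    · exact hw.elim
  | succ e ih =>
    right
    obtain ⟨hu, rfl | ⟨w, hw, hwx⟩⟩ := h
    · exact (h' ⟨hu, Or.inl rfl⟩).elim
    have hwx' : ¬ AvoidReach G S e w x := fun hh => h' ⟨hu, Or.inr ⟨w, hw, hh⟩⟩
    rcases ih hwx hwx' with ⟨rfl, rfl⟩ | ⟨W, hWc, hwW, hW, y, hy, hyx, hr⟩
    · exact ⟨{u}, by simp, by simp, by simpa using ⟨hu, Or.inl rfl⟩, u, by simp, hw,
        Reach.refl _ _⟩
    · refine ⟨insert u W, (Finset.card_insert_le _ _).trans (by omega), by simp, ?_, y,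
        by simp [hy], hyx, Or.inr ⟨w, ⟨hw, by simp, by simp [hwW]⟩, hr.mono_graph ?_⟩⟩
      · intro z hz
        rcases Finset.mem_insert.1 hz with rfl | hz
        · exact ⟨hu, Or.inl rfl⟩
        · exact ⟨hu, Or.inr ⟨w, hw, hW z hz⟩⟩
      · rintro a b ⟨hab, ha, hb⟩
        exact ⟨hab, by simp_all, by simp_all⟩

end Walks

/-! ### Crowns from sources with sparse balls -/

section Crown

open Classical in
/-- Greedy choice of the vertices `u_{i,j}` of a crown: if every source reaches all of `x`, while no
vertex is in the balls of more than a `1 / K` fraction of the sources, then every pair in `Q` can be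
given a finite out-tree to its two members of `x`, and these trees are disjoint from each other and
from `x`. -/
theorem exists_disjoint_trees {V ι : Type*} {G : Digraph V} {S : Finset V} {e t K : ℕ}
    (x : Fin t → V) (hx : Function.Injective x) (J : Finset ι) (hJ : J.Nonempty) (p : ι → V)
    (hreach : ∀ i ∈ J, ∀ a, AvoidReach G S (e + 1) (p i) (x a))
    (hsparse : ∀ y, K * (J.filter fun i => AvoidReach G S e (p i) y).card ≤ J.card)
    (Q : Finset {q : Fin t × Fin t // q.1 < q.2}) (hK : t + Q.card * (2 * e) < K) :
    ∃ W : {q : Fin t × Fin t // q.1 < q.2} → Finset V, (∀ q, (W q).card ≤ 2 * e) ∧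
      (∀ q ∈ Q, ∀ a, x a ∉ W q) ∧
      (∀ q ∈ Q, ∃ s ∈ W q, ∀ a, (a = q.1.1 ∨ a = q.1.2) →
        ∃ y ∈ W q, G.Adj y (x a) ∧ Reach (restrictTo G (W q)) e s y) ∧
      ∀ q ∈ Q, ∀ q' ∈ Q, q ≠ q' → Disjoint (W q) (W q') := by
  induction Q using Finset.induction_on with
  | empty => exact ⟨fun _ => ∅, by simp, by simp, by simp, by simp⟩
  | insert q Q hq ih =>
    rw [Finset.card_insert_of_notMem hq] at hK
    obtain ⟨W, hWc, hWx, hWr, hWd⟩ := ih (lt_of_le_of_lt (by gcongr; omega) hK)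
    set U : Finset V := Finset.univ.image x ∪ Q.biUnion W with hU
    have hUc : U.card ≤ t + Q.card * (2 * e) := by
      refine (Finset.card_union_le _ _).trans (Nat.add_le_add ?_ ?_)
      · exact Finset.card_image_le.trans (by simp)
      · exact Finset.card_biUnion_le_card_mul _ _ _ (fun q _ => hWc q)
    -- fewer than `J.card` sources have a ball that meets `U`
    obtain ⟨i, hiJ, hi⟩ : ∃ i ∈ J, ∀ y ∈ U, ¬ AvoidReach G S e (p i) y := by
      by_contra! hcon
      have h1 : J ⊆ U.biUnion fun y => J.filter fun i => AvoidReach G S e (p i) y := by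
        intro i hi
        obtain ⟨y, hy, h⟩ := hcon i hi
        exact Finset.mem_biUnion.2 ⟨y, hy, Finset.mem_filter.2 ⟨hi, h⟩⟩
      have h2 := (Finset.card_le_card h1).trans Finset.card_biUnion_le
      have h3 : K * J.card ≤ U.card * J.card := by
        calc K * J.card ≤ K * ∑ y ∈ U, (J.filter fun i => AvoidReach G S e (p i) y).card := by
              gcongr
          _ = ∑ y ∈ U, K * (J.filter fun i => AvoidReach G S e (p i) y).card := Finset.mul_sum ..
          _ ≤ ∑ _y ∈ U, J.card := Finset.sum_le_sum fun y _ => hsparse y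
          _ = U.card * J.card := by simp
      have h4 := Nat.le_of_mul_le_mul_right h3 hJ.card_pos
      have h5 : Q.card * (2 * e) ≤ (Q.card + 1) * (2 * e) := by gcongr; omega
      omega
    have hxU : ∀ a, x a ∈ U := fun a => Finset.mem_union_left _ (by simp)
    have hne : x q.1.1 ≠ x q.1.2 := fun h => (ne_of_lt q.2) (hx h)
    rcases (hreach i hiJ q.1.1).last_step (hi _ (hxU _)) with ⟨h0, h1⟩ |
      ⟨A, hAc, hpA, hA, y, hyA, hy, hry⟩
    · rcases (hreach i hiJ q.1.2).last_step (hi _ (hxU _)) with ⟨_, h2⟩ |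
        ⟨B, hBc, hpB, hB, _⟩
      · exact (hne (h1.symm.trans h2)).elim
      · exact absurd hpB (by rw [Finset.card_eq_zero.1 (by omega : B.card = 0)]; simp)
    rcases (hreach i hiJ q.1.2).last_step (hi _ (hxU _)) with ⟨h0, h1⟩ |
      ⟨B, hBc, hpB, hB, z, hzB, hz, hrz⟩
    · exact absurd hpA (by rw [Finset.card_eq_zero.1 (by omega : A.card = 0)]; simp)
    have hAB : ∀ w ∈ A ∪ B, w ∉ U := fun w hw hwU =>
      hi w hwU ((Finset.mem_union.1 hw).elim (hA w) (hB w))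
    have hdis : ∀ q' ∈ Q, Disjoint (A ∪ B) (W q') := fun q' hq' =>
      Finset.disjoint_left.2 fun w hw hw' =>
        hAB w hw (Finset.mem_union_right _ (Finset.mem_biUnion.2 ⟨q', hq', hw'⟩))
    have hupd : ∀ q' ∈ Q, Function.update W q (A ∪ B) q' = W q' := fun q' hq' =>
      Function.update_of_ne (by rintro rfl; exact hq hq') _ _
    refine ⟨Function.update W q (A ∪ B), fun q' => ?_, fun q' hq' a => ?_, fun q' hq' => ?_, ?_⟩
    · by_cases h : q' = q
      · subst h
        rw [Function.update_self]
        exact (Finset.card_union_le _ _).trans (by omega)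
      · rw [Function.update_of_ne h]; exact hWc q'
    · rcases Finset.mem_insert.1 hq' with rfl | hq'
      · rw [Function.update_self]; exact fun h => hAB _ h (hxU a)
      · rw [hupd q' hq']; exact hWx q' hq' a
    · rcases Finset.mem_insert.1 hq' with rfl | hq'
      · rw [Function.update_self]
        refine ⟨p i, by simp [hpA], ?_⟩
        rintro a (rfl | rfl)
        · refine ⟨y, by simp [hyA], hy, hry.mono_graph ?_⟩
          exact fun a b h => ⟨h.1, Finset.mem_union_left _ h.2.1, Finset.mem_union_left _ h.2.2⟩
        · refine ⟨z, by simp [hzB], hz, hrz.mono_graph ?_⟩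
          exact fun a b h => ⟨h.1, Finset.mem_union_right _ h.2.1, Finset.mem_union_right _ h.2.2⟩
      · rw [hupd q' hq']; exact hWr q' hq'
    · intro q1 h1 q2 h2 h12
      rw [Finset.mem_insert] at h1 h2
      rcases h1 with h1 | h1 <;> rcases h2 with h2 | h2
      · exact (h12 (h1.trans h2.symm)).elim
      · rw [h1, Function.update_self, hupd _ h2]; exact hdis _ h2
      · rw [h2, Function.update_self, hupd _ h1]; exact (hdis _ h1).symm
      · rw [hupd _ h1, hupd _ h2]; exact hWd _ h1 _ h2 h12

open Classical in
/-- If every source reaches all of `x`, while no vertex is in many of the slightly smaller balls,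
then there is a crown: its vertices `v_i` are the single vertices `x i`, and its vertices `u_{i,j}`
are the disjoint trees from `exists_disjoint_trees`. -/
theorem crown_isDepthMinor {V ι : Type*} {G : Digraph V} {S : Finset V} {e r t K : ℕ} (her : e ≤ r)
    (x : Fin t → V) (hx : Function.Injective x) (J : Finset ι) (hJ : J.Nonempty) (p : ι → V)
    (hreach : ∀ i ∈ J, ∀ a, AvoidReach G S (e + 1) (p i) (x a))
    (hsparse : ∀ y, K * (J.filter fun i => AvoidReach G S e (p i) y).card ≤ J.card)
    (hK : t + t ^ 2 * (2 * e) < K) : IsDepthMinor r (crown t) G := by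
  have hcard : (Finset.univ : Finset {q : Fin t × Fin t // q.1 < q.2}).card ≤ t ^ 2 := by
    rw [Finset.card_univ]
    exact (Fintype.card_subtype_le _).trans (by simp [sq])
  obtain ⟨W, -, hWx, hWr, hWd⟩ := exists_disjoint_trees x hx J hJ p hreach hsparse Finset.univ
    (lt_of_le_of_lt (by gcongr) hK)
  choose s hs hy using fun q => hWr q (Finset.mem_univ q)
  have : Nonempty V := ⟨p hJ.choose⟩
  choose! y hyW hyx hyr using hy
  let verts : Fin t ⊕ {q : Fin t × Fin t // q.1 < q.2} → Set V :=
    Sum.elim (fun a => {x a}) (fun q => ↑(W q))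
  let edge : Fin t ⊕ {q : Fin t × Fin t // q.1 < q.2} →
      Fin t ⊕ {q : Fin t × Fin t // q.1 < q.2} → V × V := fun u v =>
    match u, v with
    | .inr q, .inl a => (y q a, x a)
    | .inr q, .inr _ => (s q, s q)
    | .inl a, _ => (x a, x a)
  have hdisj : ∀ u v, u ≠ v → Disjoint (verts u) (verts v) := by
    rintro (a | q) (b | q') h
    · simp only [verts, Sum.elim_inl, Set.disjoint_singleton]
      exact fun h' => h (by rw [hx h'])
    · simp [verts, hWx]
    · simp [verts, hWx]
    · simp only [verts, Sum.elim_inr, Finset.disjoint_coe]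
      exact hWd _ (Finset.mem_univ _) _ (Finset.mem_univ _) fun h' => h (by rw [h'])
  have hedge : ∀ u v, (crown t).Adj u v →
      G.Adj (edge u v).1 (edge u v).2 ∧ (edge u v).1 ∈ verts u ∧ (edge u v).2 ∈ verts v := by
    rintro (a | q) (b | q') h
    · exact h.elim
    · exact h.elim
    · exact ⟨hyx q b h, hyW q b h, rfl⟩
    · exact h.elim
  let M : DirectedModel (crown t) G :=
    ⟨verts, fun u => restrictTo G (verts u), fun u a b h => h, hdisj, edge, hedge⟩
  refine ⟨M, ?_⟩
  rintro (a | q)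
  · refine ⟨?_, ⟨x a, rfl, ?_⟩, ⟨x a, rfl, ?_⟩⟩
    · rintro z - z' ⟨-, (_ | _), h, _⟩ <;> exact h.elim
    · rintro z' ⟨-, (_ | _), h, _⟩ <;> exact h.elim
    · rintro z ⟨hz, -⟩
      obtain rfl : z = x a := hz
      exact Reach.refl _ _
  · have hin : ∀ z, z ∉ M.inSet (.inr q) := by
      rintro z ⟨-, (_ | _), h, _⟩ <;> exact h.elim
    refine ⟨fun z hz => (hin z hz).elim, ⟨s q, hs q, ?_⟩, ⟨s q, hs q, fun z hz => (hin z hz).elim⟩⟩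
    rintro z ⟨hz, (b | q'), h, hzb⟩
    · rcases hzb with rfl | rfl
      · exact (hyr q b h).mono her
      · exact (hWx q (Finset.mem_univ _) b hz).elim
    · exact h.elim

end Crown

end DiFPT

namespace DiFPT

/-! ### Sparse balls after deleting few vertices -/

section Sparse

variable {V ι : Type*} {G : Digraph V}

open Classical in
/-- Collecting vertices `x` that are reached by a `1 / m` fraction of the sources which remain: it
stops with sources whose balls are sparse, or yields `j` vertices that are all reached by a
`1 / m ^ j` fraction of the sources. -/
theorem exists_sparse_or_common (S₀ : Finset V) (e : ℕ) {m : ℕ} (hm : 1 ≤ m)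
    (I : Finset ι) (p : ι → V) (j : ℕ) :
    (∃ S : Finset V, S.card ≤ S₀.card + j ∧ ∃ J ⊆ I, I.card ≤ m ^ j * J.card ∧
      ∀ x, m * (J.filter fun i => AvoidReach G S e (p i) x).card ≤ J.card) ∨
    (∃ X : Finset V, X.card = j ∧ ∃ J ⊆ I, I.card ≤ m ^ j * J.card ∧
      ∀ i ∈ J, ∀ x ∈ X, AvoidReach G S₀ e (p i) x) := by
  induction j with
  | zero => exact Or.inr ⟨∅, rfl, I, subset_rfl, by simp, by simp⟩
  | succ j ih =>
    have hmj : m ^ j ≤ m ^ (j + 1) := Nat.pow_le_pow_right hm (by omega)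
    rcases ih with ⟨S, hS, J, hJ, hIJ, h⟩ | ⟨X, hX, J, hJ, hIJ, h⟩
    · exact Or.inl ⟨S, by omega, J, hJ, hIJ.trans (by gcongr), h⟩
    by_cases hgood : ∀ x,
        m * (J.filter fun i => AvoidReach G (S₀ ∪ X) e (p i) x).card ≤ J.card
    · exact Or.inl ⟨S₀ ∪ X, (Finset.card_union_le _ _).trans (by omega), J, hJ,
        hIJ.trans (by gcongr), hgood⟩
    push Not at hgood
    obtain ⟨x, hx⟩ := hgood
    have hne : (J.filter fun i => AvoidReach G (S₀ ∪ X) e (p i) x).Nonempty := by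
      rw [← Finset.card_pos]
      exact Nat.pos_of_ne_zero fun h0 => by simp [h0] at hx
    obtain ⟨i₀, hi₀⟩ := hne
    have hxX : x ∉ X := fun hh =>
      (Finset.mem_filter.1 hi₀).2.end_notMem (Finset.mem_union_right _ hh)
    refine Or.inr ⟨insert x X, by rw [Finset.card_insert_of_notMem hxX, hX],
      J.filter fun i => AvoidReach G (S₀ ∪ X) e (p i) x, (Finset.filter_subset _ _).trans hJ,
      ?_, ?_⟩
    · rw [pow_succ, mul_assoc]
      exact hIJ.trans (by gcongr)
    · intro i hi y hy
      obtain ⟨hiJ, hi⟩ := Finset.mem_filter.1 hi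
      rcases Finset.mem_insert.1 hy with rfl | hy
      · exact hi.mono_set Finset.subset_union_left
      · exact h i hiJ y hy

/-- One more than the number of vertices that a crown of order `t` at depth `r` has to avoid. -/
def crownRoom (t r : ℕ) : ℕ := t + t ^ 2 * (2 * r) + 1

open Classical in
/-- If a crown is excluded, then after deleting few vertices a large part of any family of sources
has sparse balls: no vertex is reached by more than a `1 / m` fraction of these sources. -/
theorem exists_sparse_sources {r t : ℕ} (hG : ¬ IsDepthMinor r (crown t) G) {e : ℕ}
    (he : e ≤ r + 1) (I : Finset ι) (p : ι → V) {m : ℕ} (hm : 1 ≤ m) :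
    ∃ S : Finset V, S.card ≤ e * t ∧ ∃ J ⊆ I,
      I.card ≤ (m * crownRoom t r) ^ ((2 * t + 3) ^ e) * J.card ∧
      ∀ x, m * (J.filter fun i => AvoidReach G S e (p i) x).card ≤ J.card := by
  have hK : 1 ≤ crownRoom t r := by simp [crownRoom]
  induction e generalizing m I with
  | zero =>
    refine ⟨∅, by simp, I, subset_rfl, ?_, fun x => ?_⟩
    · exact Nat.le_mul_of_pos_left _ (pow_pos (by positivity) _)
    · rw [Finset.filter_eq_empty_iff.2 fun i _ (h : AvoidReach G ∅ 0 (p i) x) => h]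
      simp
  | succ e ih =>
    have hm' : 1 ≤ m ^ t := Nat.one_le_pow _ _ hm
    obtain ⟨S₀, hS₀, I₀, hI₀, hII₀, h₀⟩ := ih (by omega) I (m := m ^ t * crownRoom t r)
      (Nat.mul_pos hm' hK)
    set K := crownRoom t r with hKdef
    set X := (2 * t + 3) ^ e with hX
    have hX1 : 1 ≤ X := Nat.one_le_pow _ _ (by omega)
    have hpow : (m ^ t * K * K) ^ X * m ^ t ≤ (m * K) ^ ((2 * t + 3) ^ (e + 1)) := by
      have hmK : 1 ≤ m * K := Nat.mul_pos hm hK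
      have h1 : m ^ t * K * K ≤ (m * K) ^ (t + 2) := by
        calc m ^ t * K * K = m ^ t * (K * K) := mul_assoc ..
          _ ≤ (m * K) ^ t * ((m * K) * (m * K)) := by
            gcongr
            · exact Nat.le_mul_of_pos_right _ hK
            · exact Nat.le_mul_of_pos_left _ hm
            · exact Nat.le_mul_of_pos_left _ hm
          _ = (m * K) ^ (t + 2) := by ring
      have h2 : m ^ t ≤ (m * K) ^ t := Nat.pow_le_pow_left (Nat.le_mul_of_pos_right _ hK) _
      calc (m ^ t * K * K) ^ X * m ^ t ≤ ((m * K) ^ (t + 2)) ^ X * (m * K) ^ t := by gcongr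
        _ = (m * K) ^ ((t + 2) * X + t) := by rw [← pow_mul, ← pow_add]
        _ ≤ (m * K) ^ ((2 * t + 3) ^ (e + 1)) := by
          apply Nat.pow_le_pow_right hmK
          rw [pow_succ, ← hX]
          nlinarith
    have key : ∀ J : Finset ι, I₀.card ≤ m ^ t * J.card →
        I.card ≤ (m * K) ^ ((2 * t + 3) ^ (e + 1)) * J.card := by
      intro J hJ
      calc I.card ≤ (m ^ t * K * K) ^ X * I₀.card := hII₀
        _ ≤ (m ^ t * K * K) ^ X * (m ^ t * J.card) := by gcongr
        _ = (m ^ t * K * K) ^ X * m ^ t * J.card := (mul_assoc ..).symm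
        _ ≤ _ := by gcongr
    rcases exists_sparse_or_common (G := G) S₀ (e + 1) hm I₀ p t with
      ⟨S, hS, J, hJ, hIJ, h⟩ | ⟨Y, hY, J, hJ, hIJ, h⟩
    · exact ⟨S, by rw [Nat.succ_mul]; omega, J, hJ.trans hI₀, key J hIJ, h⟩
    rcases J.eq_empty_or_nonempty with rfl | hJne
    · exact ⟨∅, by simp, ∅, by simp, key ∅ hIJ, by simp⟩
    refine (hG ?_).elim
    let x : Fin t → V := fun a => (Y.equivFin.symm (Fin.cast hY.symm a)).1
    refine crown_isDepthMinor (e := e) (K := K) (S := S₀) (by omega) x ?_ J hJne p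
      (fun i hi a => h i hi _ (Subtype.prop _)) (fun y => ?_) ?_
    · intro a b hab
      simpa using Y.equivFin.symm.injective (Subtype.ext hab)
    · have h1 := h₀ y
      have h2 : (J.filter fun i => AvoidReach G S₀ e (p i) y).card ≤
          (I₀.filter fun i => AvoidReach G S₀ e (p i) y).card :=
        Finset.card_le_card (Finset.filter_subset_filter _ hJ)
      refine Nat.le_of_mul_le_mul_left (c := m ^ t) ?_ hm'
      calc m ^ t * (K * (J.filter fun i => AvoidReach G S₀ e (p i) y).card)
          ≤ m ^ t * (K * (I₀.filter fun i => AvoidReach G S₀ e (p i) y).card) := by gcongr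
        _ ≤ I₀.card := by rw [← mul_assoc]; exact h1
        _ ≤ _ := hIJ
    · rw [hKdef, crownRoom, Nat.lt_succ_iff]
      have : e ≤ r := by omega
      gcongr

/-- Exponent for one family of sources in `exists_sparse_families`. -/
def sparseExp (t r : ℕ) : ℕ := (2 * t + 3) ^ (r + 1)

open Classical in
/-- The same for several families of sources with a common index set. -/
theorem exists_sparse_families {r t : ℕ} (hG : ¬ IsDepthMinor r (crown t) G) {Λ : Type*}
    (L : Finset Λ) (P : Λ → ι → V) (I : Finset ι) {m : ℕ} (hm : 1 ≤ m) :
    ∃ S : Finset V, S.card ≤ L.card * ((r + 1) * t) ∧ ∃ J ⊆ I,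
      I.card ≤ (m * crownRoom t r) ^ ((2 * sparseExp t r + 2) ^ L.card) * J.card ∧
      ∀ l ∈ L, ∀ x, m * (J.filter fun i => AvoidReach G S (r + 1) (P l i) x).card ≤ J.card := by
  have hK : 1 ≤ crownRoom t r := by simp [crownRoom]
  induction L using Finset.induction_on generalizing I with
  | empty =>
    refine ⟨∅, by simp, I, subset_rfl, ?_, by simp⟩
    exact Nat.le_mul_of_pos_left _ (pow_pos (by positivity) _)
  | insert l L hl ih =>
    rw [Finset.card_insert_of_notMem hl]
    set K := crownRoom t r with hKdef
    set a := sparseExp t r with ha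
    set X := (2 * a + 2) ^ L.card with hX
    have hX1 : 1 ≤ X := Nat.one_le_pow _ _ (by omega)
    have hmK : 1 ≤ m * K := Nat.mul_pos hm hK
    have hC : 1 ≤ (m * K) ^ X := Nat.one_le_pow _ _ hmK
    obtain ⟨S₁, hS₁, I₁, hI₁, hII₁, h₁⟩ := exists_sparse_sources hG le_rfl I (P l)
      (m := m * (m * K) ^ X) (Nat.mul_pos hm hC)
    obtain ⟨S₂, hS₂, I₂, hI₂, hII₂, h₂⟩ := ih I₁
    refine ⟨S₁ ∪ S₂, (Finset.card_union_le _ _).trans (by rw [Nat.succ_mul]; omega), I₂,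
      hI₂.trans hI₁, ?_, ?_⟩
    · calc I.card ≤ (m * (m * K) ^ X * K) ^ a * I₁.card := hII₁
        _ ≤ (m * (m * K) ^ X * K) ^ a * ((m * K) ^ X * I₂.card) := by gcongr
        _ = (m * K) ^ ((X + 1) * a + X) * I₂.card := by
          rw [show m * (m * K) ^ X * K = (m * K) ^ (X + 1) by ring, ← pow_mul, ← mul_assoc,
            ← pow_add]
        _ ≤ _ := by
          gcongr 1
          apply Nat.pow_le_pow_right hmK
          rw [pow_succ, ← hX]
          nlinarith
    · intro l' hl' x
      rcases Finset.mem_insert.1 hl' with rfl | hl'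
      · have h3 : (I₂.filter fun i => AvoidReach G (S₁ ∪ S₂) (r + 1) (P l' i) x).card ≤
            (I₁.filter fun i => AvoidReach G S₁ (r + 1) (P l' i) x).card := by
          apply Finset.card_le_card
          intro i hi
          obtain ⟨hi1, hi2⟩ := Finset.mem_filter.1 hi
          exact Finset.mem_filter.2 ⟨hI₂ hi1, hi2.mono_set Finset.subset_union_left⟩
        refine Nat.le_of_mul_le_mul_left (c := (m * K) ^ X) ?_ hC
        calc (m * K) ^ X * (m *
              (I₂.filter fun i => AvoidReach G (S₁ ∪ S₂) (r + 1) (P l' i) x).card)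
            ≤ (m * K) ^ X * (m * (I₁.filter fun i => AvoidReach G S₁ (r + 1) (P l' i) x).card) := by
              gcongr
          _ = m * (m * K) ^ X * (I₁.filter fun i => AvoidReach G S₁ (r + 1) (P l' i) x).card := by
              ring
          _ ≤ I₁.card := h₁ x
          _ ≤ _ := hII₂
      · refine le_trans (Nat.mul_le_mul_left _ (Finset.card_le_card ?_)) (h₂ l' hl' x)
        intro i hi
        obtain ⟨hi1, hi2⟩ := Finset.mem_filter.1 hi
        exact Finset.mem_filter.2 ⟨hi1, hi2.mono_set Finset.subset_union_right⟩

open Classical in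
/-- Given disjoint pairs of index sets, half of the indices can be kept for each pair so that one of
its two sets is missed. -/
theorem exists_subset_missing {κ : Type*} (H : Finset κ) (A B : κ → Set ι)
    (hAB : ∀ h ∈ H, Disjoint (A h) (B h)) (I : Finset ι) :
    ∃ J ⊆ I, I.card ≤ 2 ^ H.card * J.card ∧
      ∀ h ∈ H, (∀ i ∈ J, i ∉ A h) ∨ (∀ i ∈ J, i ∉ B h) := by
  induction H using Finset.induction_on with
  | empty => exact ⟨I, subset_rfl, by simp, by simp⟩
  | insert h H hh ih =>
    obtain ⟨J, hJ, hIJ, hm⟩ := ih fun h' hh' => hAB h' (Finset.mem_insert_of_mem hh')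
    have hcov : J.card ≤ (J.filter (· ∉ A h)).card + (J.filter (· ∉ B h)).card := by
      rw [← Finset.card_union_add_card_inter]
      refine le_trans (Finset.card_le_card ?_) (Nat.le_add_right _ _)
      intro i hi
      by_cases hiA : i ∈ A h
      · exact Finset.mem_union_right _ (Finset.mem_filter.2 ⟨hi,
          Set.disjoint_left.1 (hAB h (Finset.mem_insert_self _ _)) hiA⟩)
      · exact Finset.mem_union_left _ (Finset.mem_filter.2 ⟨hi, hiA⟩)
    have hstep : ∀ C : κ → Set ι, (C h = A h ∨ C h = B h) →
        J.card ≤ 2 * (J.filter (· ∉ C h)).card → ∃ J ⊆ I, I.card ≤ 2 ^ (insert h H).card * J.card ∧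
        ∀ h' ∈ insert h H, (∀ i ∈ J, i ∉ A h') ∨ (∀ i ∈ J, i ∉ B h') := by
      intro C hC hcard
      refine ⟨J.filter (· ∉ C h), (Finset.filter_subset _ _).trans hJ, ?_, ?_⟩
      · rw [Finset.card_insert_of_notMem hh, pow_succ, mul_assoc]
        exact hIJ.trans (by gcongr)
      · intro h' hh'
        rcases Finset.mem_insert.1 hh' with rfl | hh'
        · rcases hC with hC | hC <;> rw [hC]
          · exact Or.inl fun i hi => (Finset.mem_filter.1 hi).2
          · exact Or.inr fun i hi => (Finset.mem_filter.1 hi).2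
        · exact (hm h' hh').imp (fun H i hi => H i (Finset.mem_filter.1 hi).1)
            (fun H i hi => H i (Finset.mem_filter.1 hi).1)
    by_cases hA : (J.filter (· ∉ B h)).card ≤ (J.filter (· ∉ A h)).card
    · exact hstep A (Or.inl rfl) (by omega)
    · exact hstep B (Or.inr rfl) (by omega)

/-- Bound on the number of hub constraints in `ladder_bound`. -/
def hubBound (t r w : ℕ) : ℕ := w * ((r + 1) * t) * (w * w * (r + 1))

/-- Bound on the length of the ladders in `ladder_bound`. -/
def ladderLength (t r w : ℕ) : ℕ :=
  ((4 * (w * w) * 2 ^ hubBound t r w + 1) * crownRoom t r) ^ ((2 * sparseExp t r + 2) ^ w) *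
    2 ^ hubBound t r w

open Classical in
/-- Suppose that `P l i` never reaches `P l' i` for `(l, l') ∈ E`, while for any two different
indices `i` and `j` some `P l i` reaches `P l' j`, or some `P l j` reaches `P l' i`, with
`(l, l') ∈ E`. Then the number of indices is bounded if a crown is excluded: the few vertices `S`
whose deletion makes balls sparse cannot lie on these walks for a large part of the indices, since
the first part of a walk for `i` and the last part of a walk for the same `i` would meet there; and
sparse balls contain too few vertices for all the walks that avoid `S`. -/
theorem ladder_bound {r t : ℕ} (hG : ¬ IsDepthMinor r (crown t) G) {D : ℕ} (hD : D ≤ r)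
    {Λ : Type*} [Fintype Λ] (P : Λ → ι → V) (E : Set (Λ × Λ)) (I : Finset ι)
    (hE : ∀ l ∈ E, ∀ i ∈ I, ¬ Reach G D (P l.1 i) (P l.2 i))
    (h : ∀ i ∈ I, ∀ j ∈ I, i ≠ j →
      ∃ l ∈ E, Reach G D (P l.1 i) (P l.2 j) ∨ Reach G D (P l.1 j) (P l.2 i)) :
    I.card ≤ ladderLength t r (Fintype.card Λ) := by
  set w := Fintype.card Λ with hw
  set η := 2 ^ hubBound t r w with hη
  set M := 4 * (w * w) * η + 1 with hM
  obtain ⟨S, hS, J, hJ, hIJ, hs⟩ := exists_sparse_families hG Finset.univ P I (m := M) (by omega)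
  rw [Finset.card_univ, ← hw] at hS hIJ
  -- the constraints: no walk between different indices passes through a vertex of `S`
  let H : Finset (V × (Λ × Λ) × Fin (D + 1)) := (S ×ˢ Finset.univ).filter fun c => c.2.1 ∈ E
  have hH : H.card ≤ hubBound t r w := by
    refine (Finset.card_filter_le _ _).trans ?_
    rw [Finset.card_product, Finset.card_univ, Fintype.card_prod, Fintype.card_prod,
      Fintype.card_fin, ← hw, hubBound]
    gcongr
  obtain ⟨J', hJ', hJJ', hmiss⟩ := exists_subset_missing H
    (fun c => {i | i ∈ I ∧ Reach G c.2.2 (P c.2.1.1 i) c.1})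
    (fun c => {i | i ∈ I ∧ Reach G (D - c.2.2) c.1 (P c.2.1.2 i)}) (by
      rintro ⟨z, l, c⟩ hc
      rw [Set.disjoint_left]
      rintro i ⟨hi, h1⟩ ⟨-, h2⟩
      have hc' : (c : ℕ) ≤ D := Nat.lt_succ_iff.1 c.2
      refine hE l (Finset.mem_filter.1 hc).2 i hi ?_
      have := h1.trans h2
      rwa [Nat.add_sub_cancel' hc'] at this) J
  have hJ'η : J.card ≤ η * J'.card := hJJ'.trans (by
    rw [hη]; gcongr; omega)
  have havoid : ∀ i ∈ J', ∀ j ∈ J', ∀ l ∈ E, Reach G D (P l.1 i) (P l.2 j) →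
      AvoidReach G S (r + 1) (P l.1 i) (P l.2 j) := by
    intro i hi j hj l hl hr
    rcases hr.avoid_or S with h1 | ⟨z, hz, c, hc, h1, h2⟩
    · exact h1.mono (by omega)
    have hmem : (z, l, (⟨c, Nat.lt_succ_iff.2 hc⟩ : Fin (D + 1))) ∈ H :=
      Finset.mem_filter.2 ⟨by simp [hz], hl⟩
    rcases hmiss _ hmem with h3 | h3
    · exact (h3 i hi ⟨hJ (hJ' hi), h1⟩).elim
    · exact (h3 j hj ⟨hJ (hJ' hj), h2⟩).elim
  have hJ'1 : J'.card ≤ 1 := by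
    by_contra! hcon
    -- count the ordered pairs of indices together with a walk that avoids `S`
    let T : Finset (ι × ι × (Λ × Λ)) := (J' ×ˢ J' ×ˢ Finset.univ).filter fun c =>
      AvoidReach G S (r + 1) (P c.2.2.1 c.1) (P c.2.2.2 c.2.1)
    have hT : M * T.card ≤ J'.card * (w * w) * J.card := by
      have hmaps : ∀ c ∈ T, c.2 ∈ J' ×ˢ (Finset.univ : Finset (Λ × Λ)) := fun c hc =>
        (Finset.mem_product.1 (Finset.mem_filter.1 hc).1).2
      rw [Finset.card_eq_sum_card_fiberwise hmaps, Finset.mul_sum]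
      refine (Finset.sum_le_card_nsmul _ _ J.card ?_).trans (by
        rw [Finset.card_product, Finset.card_univ, Fintype.card_prod, ← hw, smul_eq_mul])
      rintro ⟨j, l⟩ -
      refine le_trans (Nat.mul_le_mul_left _ ?_) (hs l.1 (Finset.mem_univ _) (P l.2 j))
      refine Finset.card_le_card_of_injOn Prod.fst ?_ ?_
      · rintro ⟨i, j', l'⟩ hc
        obtain ⟨hc, hjl⟩ := Finset.mem_filter.1 hc
        obtain ⟨hc1, hc2⟩ := Finset.mem_filter.1 hc
        obtain ⟨rfl, rfl⟩ := Prod.mk.inj hjl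
        exact Finset.mem_filter.2 ⟨hJ' (Finset.mem_product.1 hc1).1, hc2⟩
      · rintro ⟨i, c⟩ hc ⟨i', c'⟩ hc' hii
        obtain rfl : c = _ := (Finset.mem_filter.1 hc).2
        obtain rfl : c' = _ := (Finset.mem_filter.1 hc').2
        exact congrArg (·, _) hii
    have hT' : J'.card * J'.card ≤ J'.card + 2 * T.card := by
      have hsub : J' ×ˢ J' ⊆ J'.image (fun i => (i, i)) ∪
          (T.image (fun c => (c.1, c.2.1)) ∪ T.image (fun c => (c.2.1, c.1))) := by
        rintro ⟨i, j⟩ hij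
        obtain ⟨hi, hj⟩ := Finset.mem_product.1 hij
        by_cases hne : i = j
        · exact Finset.mem_union_left _ (Finset.mem_image.2 ⟨i, hi, by rw [hne]⟩)
        refine Finset.mem_union_right _ ?_
        obtain ⟨l, hl, h1 | h1⟩ := h i (hJ (hJ' hi)) j (hJ (hJ' hj)) hne
        · refine Finset.mem_union_left _ (Finset.mem_image.2 ⟨(i, j, l), ?_, rfl⟩)
          exact Finset.mem_filter.2 ⟨by simp [hi, hj], havoid i hi j hj l hl h1⟩
        · refine Finset.mem_union_right _ (Finset.mem_image.2 ⟨(j, i, l), ?_, rfl⟩)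
          exact Finset.mem_filter.2 ⟨by simp [hi, hj], havoid j hj i hi l hl h1⟩
      have h1 := Finset.card_le_card hsub
      rw [Finset.card_product] at h1
      have h2 := Finset.card_union_le (J'.image (fun i => (i, i)))
        (T.image (fun c => (c.1, c.2.1)) ∪ T.image (fun c => (c.2.1, c.1)))
      have h3 := Finset.card_union_le (T.image (fun c => (c.1, c.2.1)))
        (T.image (fun c => (c.2.1, c.1)))
      have h4 : (J'.image (fun i => (i, i))).card ≤ J'.card := Finset.card_image_le
      have h5 : (T.image (fun c => (c.1, c.2.1))).card ≤ T.card := Finset.card_image_le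
      have h6 : (T.image (fun c => (c.2.1, c.1))).card ≤ T.card := Finset.card_image_le
      omega
    have h1 : M * (J'.card * J'.card) ≤ M * J'.card + 2 * (J'.card * (w * w) * (η * J'.card)) := by
      calc M * (J'.card * J'.card) ≤ M * (J'.card + 2 * T.card) := by gcongr
        _ = M * J'.card + 2 * (M * T.card) := by ring
        _ ≤ M * J'.card + 2 * (J'.card * (w * w) * J.card) := by gcongr
        _ ≤ _ := by gcongr
    have h2 : M * J'.card ≤ M + 2 * (w * w * η) * J'.card := by
      refine Nat.le_of_mul_le_mul_right (c := J'.card) ?_ (by omega)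
      nlinarith
    nlinarith
  calc I.card ≤ _ := hIJ
    _ ≤ (M * crownRoom t r) ^ ((2 * sparseExp t r + 2) ^ w) * (η * 1) := by
      gcongr; exact hJ'η.trans (by gcongr)
    _ = _ := by rw [mul_one, ladderLength]

end Sparse

end DiFPT

namespace DiFPT

/-! ### Partial solutions and their representatives -/

/-- The constraints that all six problems impose on a solution, as relations on vertex numbers:
`valid v`: `v` is a vertex that may be in a solution; `att u v`: `v` may be a child of `u`;
`conf u v`: `u` and `v` cannot both be in a solution unless one is the parent of the other;
`dom u v`: `u` dominates `v`. -/
structure Constraints where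
  valid : ℕ → Prop
  att : ℕ → ℕ → Prop
  conf : ℕ → ℕ → Prop
  dom : ℕ → ℕ → Prop

namespace Constraints

variable (Γ : Constraints)

/-- No conflict between the entries of `s` and those of `t`, except perhaps between
the two roots. -/
def Cross (s t : List ℕ) : Prop :=
  ∀ i < s.length, ∀ j < t.length, (0 < i ∨ 0 < j) → ¬ Γ.conf (s.getD i 0) (t.getD j 0)

/-- `t` lists the vertices of a tree that satisfies the constraints; the root comes first. A tree is
built by hanging the root of a second tree below the root of a first one. -/
inductive IsTree : List ℕ → Prop
  | single (v : ℕ) : Γ.valid v → IsTree [v]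
  | join (s t : List ℕ) : IsTree s → IsTree t → Γ.att (s.getD 0 0) (t.getD 0 0) → Γ.Cross s t →
      IsTree (s ++ t)

/-- The vertex `x` is in conflict with a vertex of the tree `t` other than the root. -/
def Hits (x : ℕ) (t : List ℕ) : Prop :=
  ∃ c < t.length, 0 < c ∧ Γ.conf x (t.getD c 0)

/-- Some vertex of `t` dominates `b`. -/
def ListDom (t : List ℕ) (b : ℕ) : Prop :=
  ∃ c < t.length, Γ.dom (t.getD c 0) b

/-- Two trees agree in their root, in their size, and in which vertices of `B` they dominate. -/
def Alike (B r t : List ℕ) : Prop :=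
  r.length = t.length ∧ r.getD 0 0 = t.getD 0 0 ∧
    ∀ i < B.length, Γ.ListDom r (B.getD i 0) ↔ Γ.ListDom t (B.getD i 0)

/-- `s` and `t` can be joined to a tree of size at most `k`. -/
def Joinable (k : ℕ) (s t : List ℕ) : Prop :=
  0 < s.length ∧ 0 < t.length ∧ s.length + t.length ≤ k ∧ Γ.att (s.getD 0 0) (t.getD 0 0) ∧
    Γ.Cross s t

variable {Γ}

theorem IsTree.length_pos {t : List ℕ} (h : Γ.IsTree t) : 0 < t.length := by
  induction h with
  | single => simp
  | join s t _ _ _ _ ih _ => simp only [List.length_append]; omega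

theorem IsTree.valid_of_mem {t : List ℕ} (h : Γ.IsTree t) : ∀ x ∈ t, Γ.valid x := by
  induction h with
  | single v hv => simpa using hv
  | join s t _ _ _ _ ih ih' => simpa [or_imp, forall_and] using ⟨ih, ih'⟩

theorem getD_append_zero {s : List ℕ} (hs : 0 < s.length) (t : List ℕ) :
    (s ++ t).getD 0 0 = s.getD 0 0 := List.getD_append _ _ _ _ hs

theorem hits_append {x : ℕ} {s t : List ℕ} (hs : 0 < s.length) :
    Γ.Hits x (s ++ t) ↔ Γ.Hits x s ∨ ∃ c < t.length, Γ.conf x (t.getD c 0) := by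
  constructor
  · rintro ⟨c, hc, h0, h⟩
    by_cases hcs : c < s.length
    · rw [List.getD_append _ _ _ _ hcs] at h
      exact Or.inl ⟨c, hcs, h0, h⟩
    · rw [List.getD_append_right _ _ _ _ (by omega)] at h
      rw [List.length_append] at hc
      exact Or.inr ⟨c - s.length, by omega, h⟩
  · rintro (⟨c, hc, h0, h⟩ | ⟨c, hc, h⟩)
    · exact ⟨c, by rw [List.length_append]; omega, h0, by rwa [List.getD_append _ _ _ _ hc]⟩
    · refine ⟨s.length + c, by rw [List.length_append]; omega, by omega, ?_⟩
      rwa [List.getD_append_right _ _ _ _ (by omega), Nat.add_sub_cancel_left]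

theorem listDom_append {b : ℕ} {s t : List ℕ} :
    Γ.ListDom (s ++ t) b ↔ Γ.ListDom s b ∨ Γ.ListDom t b := by
  constructor
  · rintro ⟨c, hc, h⟩
    by_cases hcs : c < s.length
    · rw [List.getD_append _ _ _ _ hcs] at h
      exact Or.inl ⟨c, hcs, h⟩
    · rw [List.getD_append_right _ _ _ _ (by omega)] at h
      rw [List.length_append] at hc
      exact Or.inr ⟨c - s.length, by omega, h⟩
  · rintro (⟨c, hc, h⟩ | ⟨c, hc, h⟩)
    · exact ⟨c, by rw [List.length_append]; omega, by rwa [List.getD_append _ _ _ _ hc]⟩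
    · refine ⟨s.length + c, by rw [List.length_append]; omega, ?_⟩
      rwa [List.getD_append_right _ _ _ _ (by omega), Nat.add_sub_cancel_left]

theorem exists_getD_of_mem {x : ℕ} {t : List ℕ} (h : x ∈ t) : ∃ c < t.length, t.getD c 0 = x := by
  obtain ⟨c, hc, rfl⟩ := List.mem_iff_getElem.1 h
  exact ⟨c, hc, List.getD_eq_getElem _ _ hc⟩

theorem getD_mem {c : ℕ} {t : List ℕ} (h : c < t.length) : t.getD c 0 ∈ t := by
  rw [List.getD_eq_getElem _ _ h]
  exact List.getElem_mem h

theorem cross_iff {s t : List ℕ} (hsym : ∀ x y, Γ.conf x y → Γ.conf y x) :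
    Γ.Cross s t ↔ (∀ x ∈ s, ¬ Γ.Hits x t) ∧ ∀ y ∈ t, ¬ Γ.Hits y s := by
  constructor
  · intro h
    refine ⟨fun x hx ⟨j, hj, h0, hc⟩ => ?_, fun y hy ⟨i, hi, h0, hc⟩ => ?_⟩
    · obtain ⟨i, hi, rfl⟩ := exists_getD_of_mem hx
      exact h i hi j hj (Or.inr h0) hc
    · obtain ⟨j, hj, rfl⟩ := exists_getD_of_mem hy
      exact h i hi j hj (Or.inl h0) (hsym _ _ hc)
  · rintro ⟨h1, h2⟩ i hi j hj (h0 | h0) hc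
    · exact h2 _ (getD_mem hj) ⟨i, hi, h0, hsym _ _ hc⟩
    · exact h1 _ (getD_mem hi) ⟨j, hj, h0, hc⟩

variable (Γ)

/-- Every tree that can be made from two members of `F` is represented in `F`: whatever the rest
`X` of the solution, it can be replaced by a tree of `F` that agrees with it in root, size and
dominated vertices of `B`. -/
def Saturated (n k : ℕ) (B : List ℕ) (F : List (List ℕ)) : Prop :=
  ∀ s ∈ F, ∀ t ∈ F, Γ.Joinable k s t → ∀ X : List ℕ, X.length ≤ k →
    (∀ x ∈ X, x < n ∧ ¬ Γ.Hits x (s ++ t)) →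
    ∃ r ∈ F, Γ.Alike B r (s ++ t) ∧ ∀ x ∈ X, ¬ Γ.Hits x r

variable {Γ}

/-- A saturated collection of trees represents all trees. The tree is replaced from the bottom up:
the part below the last child first, with the rest of the tree as a part of the context. -/
theorem IsTree.exists_representative {n k : ℕ} {B : List ℕ} {F : List (List ℕ)}
    (hsym : ∀ x y, Γ.conf x y → Γ.conf y x) (hvalid : ∀ v, Γ.valid v → v < n)
    (hsingle : ∀ v, Γ.valid v → [v] ∈ F) (hF : ∀ t ∈ F, t ≠ [] → Γ.IsTree t)
    (hsat : Γ.Saturated n k B F) {t : List ℕ} (ht : Γ.IsTree t) (X : List ℕ)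
    (hk : X.length + t.length ≤ k) (hX : ∀ x ∈ X, x < n ∧ ¬ Γ.Hits x t) :
    ∃ r ∈ F, Γ.Alike B r t ∧ ∀ x ∈ X, ¬ Γ.Hits x r := by
  induction ht generalizing X with
  | single v hv =>
    exact ⟨[v], hsingle v hv, ⟨rfl, rfl, fun _ _ => Iff.rfl⟩, fun x hx => (hX x hx).2⟩
  | join s t hs ht hatt hcross ihs iht =>
    have hs0 := hs.length_pos
    have ht0 := ht.length_pos
    rw [List.length_append] at hk
    have hXs : ∀ x ∈ X, x < n ∧ ¬ Γ.Hits x s ∧ ∀ c < t.length, ¬ Γ.conf x (t.getD c 0) := by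
      intro x hx
      have := hX x hx
      rw [hits_append hs0] at this
      push Not at this
      exact ⟨this.1, this.2⟩
    obtain ⟨hst, hts⟩ := (cross_iff hsym).1 hcross
    obtain ⟨t', ht'F, ⟨hlt, hrt, hdt⟩, ht'X⟩ := iht (X ++ s)
      (by rw [List.length_append]; omega) (by
        intro x hx
        rcases List.mem_append.1 hx with hx | hx
        · exact ⟨(hXs x hx).1, fun ⟨c, hc, _, h⟩ => (hXs x hx).2.2 c hc h⟩
        · exact ⟨hvalid x (hs.valid_of_mem x hx), hst x hx⟩)
    have ht' : Γ.IsTree t' := hF t' ht'F (by rintro rfl; simp at hlt; omega)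
    have hcross' : ∀ y ∈ t', ¬ Γ.Hits y s := by
      rintro y hy ⟨i, hi, h0, hc⟩
      obtain ⟨j, hj, rfl⟩ := exists_getD_of_mem hy
      rcases Nat.eq_zero_or_pos j with rfl | hj0
      · rw [hrt] at hc
        exact hts _ (getD_mem ht0) ⟨i, hi, h0, hc⟩
      · exact ht'X _ (List.mem_append_right _ (getD_mem hi)) ⟨j, hj, hj0, hsym _ _ hc⟩
    obtain ⟨s', hs'F, ⟨hls, hrs, hds⟩, hs'X⟩ := ihs (X ++ t')
      (by rw [List.length_append]; omega) (by
        intro x hx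
        rcases List.mem_append.1 hx with hx | hx
        · exact ⟨(hXs x hx).1, (hXs x hx).2.1⟩
        · exact ⟨hvalid x (ht'.valid_of_mem x hx), hcross' x hx⟩)
    have hjoin : Γ.Joinable k s' t' := by
      refine ⟨by omega, by omega, by omega, by rwa [hrs, hrt], ?_⟩
      refine (cross_iff hsym).2 ⟨?_, fun y hy => hs'X y (List.mem_append_right _ hy)⟩
      rintro x hx ⟨j, hj, h0, hc⟩
      obtain ⟨i, hi, rfl⟩ := exists_getD_of_mem hx
      rcases Nat.eq_zero_or_pos i with rfl | hi0
      · rw [hrs] at hc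
        exact ht'X _ (List.mem_append_right _ (getD_mem hs0)) ⟨j, hj, h0, hc⟩
      · exact hs'X _ (List.mem_append_right _ (getD_mem hj)) ⟨i, hi, hi0, hsym _ _ hc⟩
    obtain ⟨r, hrF, ⟨hlr, hrr, hdr⟩, hrX⟩ := hsat s' hs'F t' ht'F hjoin X (by omega) (by
      intro x hx
      refine ⟨(hXs x hx).1, ?_⟩
      rw [hits_append (by omega)]
      rintro (h | ⟨c, hc, h⟩)
      · exact hs'X x (List.mem_append_left _ hx) h
      · rcases Nat.eq_zero_or_pos c with rfl | hc0
        · rw [hrt] at h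
          exact (hXs x hx).2.2 0 ht0 h
        · exact ht'X x (List.mem_append_left _ hx) ⟨c, hc, hc0, h⟩)
    refine ⟨r, hrF, ⟨?_, ?_, fun i hi => ?_⟩, hrX⟩
    · rw [hlr, List.length_append, List.length_append, hls, hlt]
    · rw [hrr, getD_append_zero (by omega), getD_append_zero hs0, hrs]
    · rw [hdr i hi, listDom_append, listDom_append, hds i hi, hdt i hi]

end Constraints

/-! ### Covering few objects by a bounded number of vertices -/

open Classical in
/-- The objects `r < len` with `cls r` can be covered by at most `k` vertices `x` that do not hit a
given object: the objects of the class are labelled with numbers below `k`, the labelling is encoded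
by its digits in base `k`, and one vertex has to be found for each label. -/
def Coverable (n k len : ℕ) (hit : ℕ → ℕ → Prop) (cls hitT : ℕ → Prop) : Prop :=
  ∃ e < k ^ Nat.count cls len, ∀ c < k,
    (∀ r < len, cls r → e / k ^ Nat.count cls r % k ≠ c) ∨
    ∃ x < n, ¬ hitT x ∧ ∀ r < len, cls r → e / k ^ Nat.count cls r % k = c → hit x r

theorem coverable_iff {n k len : ℕ} {hit : ℕ → ℕ → Prop} {cls hitT : ℕ → Prop} :
    Coverable n k len hit cls hitT ↔ ∃ X : List ℕ, X.length ≤ k ∧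
      (∀ x ∈ X, x < n ∧ ¬ hitT x) ∧ ∀ r < len, cls r → ∃ x ∈ X, hit x r := by
  classical
  constructor
  · rintro ⟨e, he, h⟩
    choose! f hf using fun c (hc : c < k) (hc' : ¬ ∀ r < len, cls r →
      e / k ^ Nat.count cls r % k ≠ c) => (h c hc).resolve_left hc'
    refine ⟨((List.range k).filter fun c => ¬ ∀ r < len, cls r →
      e / k ^ Nat.count cls r % k ≠ c).map f, ?_, ?_, ?_⟩
    · rw [List.length_map]
      exact (List.length_filter_le _ _).trans (by simp)
    · intro x hx
      obtain ⟨c, hc, rfl⟩ := List.mem_map.1 hx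
      obtain ⟨hc, hc'⟩ := List.mem_filter.1 hc
      have := hf c (List.mem_range.1 hc) (of_decide_eq_true hc')
      exact ⟨this.1, this.2.1⟩
    · intro r hr hcr
      have hk : 0 < k := by
        rcases Nat.eq_zero_or_pos k with rfl | hk
        · rw [zero_pow ((Nat.zero_le _).trans_lt (Nat.count_strict_mono hcr hr)).ne'] at he
          exact (Nat.not_lt_zero _ he).elim
        · exact hk
      have hck : e / k ^ Nat.count cls r % k < k := Nat.mod_lt _ hk
      have hne : ¬ ∀ r' < len, cls r' →
          e / k ^ Nat.count cls r' % k ≠ e / k ^ Nat.count cls r % k := fun h => h r hr hcr rfl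
      exact ⟨f _, List.mem_map_of_mem (List.mem_filter.2 ⟨List.mem_range.2 hck,
        decide_eq_true hne⟩), (hf _ hck hne).2.2 r hr hcr rfl⟩
  · rintro ⟨X, hXk, hX, hcov⟩
    have hlab : ∀ r, ∃ i, r < len → cls r → i < X.length ∧ hit (X.getD i 0) r := by
      intro r
      by_cases h : r < len ∧ cls r
      · obtain ⟨x, hx, hxr⟩ := hcov r h.1 h.2
        obtain ⟨i, hi, rfl⟩ := Constraints.exists_getD_of_mem hx
        exact ⟨i, fun _ _ => ⟨hi, hxr⟩⟩
      · exact ⟨0, fun h1 h2 => (h ⟨h1, h2⟩).elim⟩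
    choose lab hlab using hlab
    have hlt : ∀ i : Fin (Nat.count cls len), Nat.nth cls i < len ∧ cls (Nat.nth cls i) := fun i =>
      ⟨Nat.nth_lt_of_lt_count i.2, Nat.nth_mem _ fun hf => i.2.trans_le (Nat.count_le_card hf _)⟩
    let g : Fin (Nat.count cls len) → Fin k := fun i =>
      ⟨lab (Nat.nth cls i), (hlab _ (hlt i).1 (hlt i).2).1.trans_le hXk⟩
    have hdig : ∀ r < len, cls r →
        (finFunctionFinEquiv g : ℕ) / k ^ Nat.count cls r % k = lab r := by
      intro r hr hcr
      have hi : Nat.count cls r < Nat.count cls len := Nat.count_strict_mono hcr hr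
      have h1 := congrFun (finFunctionFinEquiv.symm_apply_apply g) ⟨_, hi⟩
      have h2 := congrArg Fin.val h1
      rw [finFunctionFinEquiv_symm_apply_val] at h2
      rw [h2]
      simp only [g]
      rw [Nat.nth_count hcr]
    refine ⟨finFunctionFinEquiv g, Fin.is_lt _, fun c hc => ?_⟩
    by_cases hcl : ∀ r < len, cls r → lab r ≠ c
    · exact Or.inl fun r hr hcr => by rw [hdig r hr hcr]; exact hcl r hr hcr
    · push Not at hcl
      obtain ⟨r, hr, hcr, rfl⟩ := hcl
      obtain ⟨hi, -⟩ := hlab r hr hcr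
      obtain ⟨hx1, hx2⟩ := hX _ (Constraints.getD_mem hi)
      refine Or.inr ⟨_, hx1, hx2, fun r' hr' hcr' h => ?_⟩
      rw [hdig r' hr' hcr'] at h
      rw [← h]
      exact (hlab r' hr' hcr').2

end DiFPT

namespace DiFPT

/-! ### Out-branchings -/

section OutBranching

variable {V : Type*}

open Relation

theorem IsOutBranching.adj_asymm {T : Digraph V} {D : Finset V} {r : V} (h : IsOutBranching T D r)
    {a b : V} (hab : T.Adj a b) : ¬ T.Adj b a := by
  obtain ⟨-, hD, hr, hu, hreach⟩ := h
  intro hba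
  have har : a ≠ r := by rintro rfl; exact hr _ hba
  have hbr : b ≠ r := by rintro rfl; exact hr _ hab
  -- a walk from the root cannot enter the cycle `a b`
  have key : ∀ x, ReflTransGen T.Adj r x → x ≠ a ∧ x ≠ b := by
    intro x hx
    induction hx with
    | refl => exact ⟨har.symm, hbr.symm⟩
    | tail _ hyx ih =>
      constructor
      · rintro rfl
        exact ih.2 ((hu _ (hD _ _ hab).1 har).unique hyx hba)
      · rintro rfl
        exact ih.1 ((hu _ (hD _ _ hab).2 hbr).unique hyx hab)
  exact (key a (hreach a (hD _ _ hab).1)).1 rfl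

/-- Two out-branchings, the root `w` of the second one made a child of the root `r` of the first. -/
def joinAt (T₁ T₂ : Digraph V) (r w : V) : Digraph V where
  Adj a b := T₁.Adj a b ∨ T₂.Adj a b ∨ (a = r ∧ b = w)

theorem IsOutBranching.joinAt [DecidableEq V] {T₁ T₂ : Digraph V} {D₁ D₂ : Finset V} {r w : V}
    (h₁ : IsOutBranching T₁ D₁ r) (h₂ : IsOutBranching T₂ D₂ w) (hd : Disjoint D₁ D₂) :
    IsOutBranching (joinAt T₁ T₂ r w) (D₁ ∪ D₂) r := by
  obtain ⟨r1, e1, i1, u1, c1⟩ := h₁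
  obtain ⟨r2, e2, i2, u2, c2⟩ := h₂
  rw [Finset.disjoint_left] at hd
  refine ⟨by simp [r1], ?_, ?_, ?_, ?_⟩
  · rintro u v (h | h | ⟨rfl, rfl⟩)
    · simp [e1 _ _ h]
    · simp [e2 _ _ h]
    · simp [r1, r2]
  · rintro u (h | h | ⟨rfl, rfl⟩)
    · exact i1 _ h
    · exact hd r1 (e2 _ _ h).2
    · exact hd r1 r2
  · intro v hv hvr
    rcases Finset.mem_union.1 hv with hv | hv
    · obtain ⟨u, hu, huu⟩ := u1 v hv hvr
      refine ⟨u, Or.inl hu, ?_⟩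
      rintro u' (h | h | ⟨rfl, rfl⟩)
      · exact huu _ h
      · exact (hd hv (e2 _ _ h).2).elim
      · exact (hd hv r2).elim
    · by_cases hvw : v = w
      · subst hvw
        refine ⟨r, Or.inr (Or.inr ⟨rfl, rfl⟩), ?_⟩
        rintro u' (h | h | ⟨rfl, -⟩)
        · exact (hd (e1 _ _ h).2 hv).elim
        · exact (i2 _ h).elim
        · rfl
      · obtain ⟨u, hu, huu⟩ := u2 v hv hvw
        refine ⟨u, Or.inr (Or.inl hu), ?_⟩
        rintro u' (h | h | ⟨rfl, rfl⟩)
        · exact (hd (e1 _ _ h).2 hv).elim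
        · exact huu _ h
        · exact (hvw rfl).elim
  · intro v hv
    rcases Finset.mem_union.1 hv with hv | hv
    · exact ReflTransGen.mono (fun a b h => Or.inl h) _ _ (c1 v hv)
    · exact .head (Or.inr (Or.inr ⟨rfl, rfl⟩))
        (ReflTransGen.mono (fun a b h => Or.inr (Or.inl h)) _ _ (c2 v hv))

/-- An out-branching with more than one vertex splits at an edge `rw` out of the root. -/
theorem IsOutBranching.split [DecidableEq V] {T : Digraph V} {D : Finset V} {r : V}
    (h : IsOutBranching T D r) (hD : D ≠ {r}) :
    ∃ w, ∃ D₁ D₂ : Finset V, T.Adj r w ∧ D₁ ∪ D₂ = D ∧ Disjoint D₁ D₂ ∧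
      IsOutBranching (restrictTo T D₁) D₁ r ∧ IsOutBranching (restrictTo T D₂) D₂ w ∧
      ∀ a b, a ∈ D₁ → b ∈ D₂ → ¬ T.Adj b a ∧ (T.Adj a b → a = r ∧ b = w) := by
  classical
  obtain ⟨hr, hmem, hin, huniq, hreach⟩ := h
  obtain ⟨v, hv, hvr⟩ : ∃ v ∈ D, v ≠ r := by
    by_contra! hcon
    exact hD (Finset.eq_singleton_iff_unique_mem.2 ⟨hr, hcon⟩)
  obtain ⟨w, hrw, -⟩ : ∃ w, T.Adj r w ∧ ReflTransGen T.Adj w v := by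
    rcases (hreach v hv).cases_head with h | h
    · exact (hvr h.symm).elim
    · exact h
  have hwr : w ≠ r := by rintro rfl; exact hin _ hrw
  set D₂ := D.filter fun x => ReflTransGen T.Adj w x with hD₂
  set D₁ := D.filter fun x => ¬ ReflTransGen T.Adj w x with hD₁
  have hrD₂ : ¬ ReflTransGen T.Adj w r := by
    intro h
    rcases h.cases_tail with h | ⟨y, -, hy⟩
    · exact hwr h.symm
    · exact hin _ hy
  have hwD : w ∈ D := (hmem _ _ hrw).2
  have cross : ∀ a b, a ∈ D₁ → b ∈ D₂ → ¬ T.Adj b a ∧ (T.Adj a b → a = r ∧ b = w) := by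
    intro a b ha hb
    have ha := (Finset.mem_filter.1 ha).2
    obtain ⟨hbD, hb⟩ := Finset.mem_filter.1 hb
    refine ⟨fun h => ha (hb.tail h), fun h => ?_⟩
    rcases hb.cases_tail with rfl | ⟨y, hy, hyb⟩
    · exact ⟨(huniq _ hwD hwr).unique h hrw, rfl⟩
    · have hbr : b ≠ r := by rintro rfl; exact hin _ h
      exact (ha (((huniq _ hbD hbr).unique h hyb) ▸ hy)).elim
  refine ⟨w, D₁, D₂, hrw, ?_, ?_, ⟨?_, ?_, ?_, ?_, ?_⟩, ⟨?_, ?_, ?_, ?_, ?_⟩, cross⟩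
  · rw [Finset.union_comm]; exact Finset.filter_union_filter_not_eq _ _
  · exact (Finset.disjoint_filter_filter_not _ _ _).symm
  · exact Finset.mem_filter.2 ⟨hr, hrD₂⟩
  · exact fun a b h => h.2
  · exact fun u h => hin _ h.1
  · intro v hv hvr
    obtain ⟨u, hu, huu⟩ := huniq v (Finset.mem_filter.1 hv).1 hvr
    refine ⟨u, ⟨hu, Finset.mem_coe.2 (Finset.mem_filter.2 ⟨(hmem _ _ hu).1, fun h => ?_⟩), hv⟩,
      fun u' h => huu _ h.1⟩
    exact (Finset.mem_filter.1 hv).2 (h.tail hu)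
  · intro v hv
    have key : ∀ x, ReflTransGen T.Adj r x → ¬ ReflTransGen T.Adj w x →
        ReflTransGen (restrictTo T D₁).Adj r x := by
      intro x hx
      induction hx with
      | refl => exact fun _ => .refl
      | tail hy hyx ih =>
        intro hx
        have hy' := fun h => hx (ReflTransGen.tail h hyx)
        exact (ih hy').tail ⟨hyx, Finset.mem_coe.2 (Finset.mem_filter.2 ⟨(hmem _ _ hyx).1, hy'⟩),
          Finset.mem_coe.2 (Finset.mem_filter.2 ⟨(hmem _ _ hyx).2, hx⟩)⟩
    exact key v (hreach v (Finset.mem_filter.1 hv).1) (Finset.mem_filter.1 hv).2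
  · exact Finset.mem_filter.2 ⟨hwD, .refl⟩
  · exact fun a b h => h.2
  · rintro u ⟨h, hu, -⟩
    have := (huniq _ hwD hwr).unique h hrw
    exact hrD₂ (this ▸ (Finset.mem_filter.1 hu).2)
  · intro v hv hvw
    obtain ⟨hvD, hwv⟩ := Finset.mem_filter.1 hv
    have hvr : v ≠ r := by rintro rfl; exact hrD₂ hwv
    rcases hwv.cases_tail with rfl | ⟨y, hy, hyv⟩
    · exact (hvw rfl).elim
    · exact ⟨y, ⟨hyv, Finset.mem_coe.2 (Finset.mem_filter.2 ⟨(hmem _ _ hyv).1, hy⟩), hv⟩,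
        fun u' h => (huniq v hvD hvr).unique h.1 hyv⟩
  · intro v hv
    have key : ∀ x, ReflTransGen T.Adj w x → ReflTransGen (restrictTo T D₂).Adj w x := by
      intro x hx
      induction hx with
      | refl => exact .refl
      | tail hy hyx ih =>
        exact ih.tail ⟨hyx, Finset.mem_coe.2 (Finset.mem_filter.2 ⟨(hmem _ _ hyx).1, hy⟩),
          Finset.mem_coe.2 (Finset.mem_filter.2 ⟨(hmem _ _ hyx).2, hy.tail hyx⟩)⟩
    exact key v (Finset.mem_filter.1 hv).2

end OutBranching

/-! ### The six problems as one problem about trees -/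

/-- `Reach` for vertices given as natural numbers. -/
def NumReach (G : FinDigraph) (e u v : ℕ) : Prop :=
  ∃ (hu : u < G.n) (hv : v < G.n), Reach G.graph e ⟨u, hu⟩ ⟨v, hv⟩

/-- Adjacency for vertices given as natural numbers. -/
def NumAdj (G : FinDigraph) (u v : ℕ) : Prop :=
  ∃ (hu : u < G.n) (hv : v < G.n), G.graph.Adj ⟨u, hu⟩ ⟨v, hv⟩

/-- The constraints of the six problems. Domination is at distance `d`. Two members of the solution
are in conflict if one reaches the other within distance `e`: the distance `0` expresses that they
are different, the distance `1` that they also are not adjacent. If `tree` holds, then children are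
joined to their parents by edges; otherwise a child only must not be in conflict with its parent, so
that the tree is no restriction. -/
def graphConstraints (G : FinDigraph) (tree : Prop) (e d : ℕ) : Constraints where
  valid v := v < G.n ∧ (e = 0 ∨ ¬ NumAdj G v v)
  att u v := ¬ NumReach G e v u ∧ (tree → NumAdj G u v) ∧ (¬ tree → ¬ NumReach G e u v)
  conf u v := NumReach G e u v ∨ NumReach G e v u
  dom := NumReach G d

/-- There is a tree of size `k` that satisfies the constraints and, if required, dominates. -/
def HasTreeSolution (G : FinDigraph) (tree dom : Prop) (e d k : ℕ) : Prop :=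
  ∃ t, (graphConstraints G tree e d).IsTree t ∧ t.length = k ∧
    (dom → ∀ v < G.n, (graphConstraints G tree e d).ListDom t v)

section Problems

open Constraints

variable {G : FinDigraph}

theorem numReach_coe {e : ℕ} {u v : Fin G.n} : NumReach G e u v ↔ Reach G.graph e u v :=
  ⟨fun ⟨_, _, h⟩ => h, fun h => ⟨u.2, v.2, h⟩⟩

theorem numAdj_coe {u v : Fin G.n} : NumAdj G u v ↔ G.graph.Adj u v :=
  ⟨fun ⟨_, _, h⟩ => h, fun h => ⟨u.2, v.2, h⟩⟩

theorem graphConstraints_symm {tree : Prop} {e d : ℕ} (x y : ℕ) :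
    (graphConstraints G tree e d).conf x y → (graphConstraints G tree e d).conf y x := Or.symm

theorem numReach_self {e u : ℕ} (h : u < G.n) : NumReach G e u u := ⟨h, h, Reach.refl _ _⟩

/-- Domination by a list and by the set of its entries are the same. -/
theorem forall_listDom_iff {tree : Prop} {e d : ℕ} {t : List ℕ} {D : Finset (Fin G.n)}
    (hD : ∀ x : Fin G.n, x ∈ D ↔ (x : ℕ) ∈ t) :
    (∀ v < G.n, (graphConstraints G tree e d).ListDom t v) ↔ IsDominating G.graph d D := by
  constructor
  · intro h v
    obtain ⟨c, hc, h1, _, h2⟩ := h v v.2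
    exact ⟨⟨_, h1⟩, (hD _).2 (getD_mem hc), h2⟩
  · intro h v hv
    obtain ⟨u, hu, h⟩ := h ⟨v, hv⟩
    obtain ⟨c, hc, h1⟩ := exists_getD_of_mem ((hD u).1 hu)
    refine ⟨c, hc, ?_⟩
    rw [h1]
    exact ⟨u.2, hv, h⟩

theorem exists_finset_of_list {n : ℕ} {t : List ℕ} (ht : ∀ x ∈ t, x < n) (hn : t.Nodup) :
    ∃ D : Finset (Fin n), D.card = t.length ∧ ∀ x : Fin n, x ∈ D ↔ (x : ℕ) ∈ t :=
  ⟨t.toFinset.attachFin (by simpa using ht), by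
    rw [Finset.card_attachFin, List.toFinset_card_of_nodup hn], by simp⟩

theorem isTree_iff_pairwise {tree : Prop} (htree : ¬ tree) {e d : ℕ} {t : List ℕ} :
    (graphConstraints G tree e d).IsTree t ↔ t ≠ [] ∧
      (∀ x ∈ t, (graphConstraints G tree e d).valid x) ∧
      t.Pairwise fun x y => ¬ (graphConstraints G tree e d).conf x y := by
  constructor
  · intro h
    refine ⟨fun h0 => by simpa [h0] using h.length_pos, h.valid_of_mem, ?_⟩
    induction h with
    | single => simp
    | join s t hs ht hatt hc ihs iht =>
      refine List.pairwise_append.2 ⟨ihs, iht, fun a ha b hb => ?_⟩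
      obtain ⟨i, hi, rfl⟩ := exists_getD_of_mem ha
      obtain ⟨j, hj, rfl⟩ := exists_getD_of_mem hb
      by_cases hij : 0 < i ∨ 0 < j
      · exact hc i hi j hj hij
      · obtain ⟨rfl, rfl⟩ : i = 0 ∧ j = 0 := by omega
        rintro (h | h)
        · exact hatt.2.2 htree h
        · exact hatt.1 h
  · induction t using List.reverseRecOn with
    | nil => exact fun h => (h.1 rfl).elim
    | append_singleton t a ih =>
      rintro ⟨-, hv, hp⟩
      obtain ⟨hp, -, hpa⟩ := List.pairwise_append.1 hp
      by_cases ht : t = []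
      · subst ht
        exact .single a (hv a (by simp))
      have ht0 : 0 < t.length := List.length_pos_iff.2 ht
      have hta : ∀ i < t.length, ¬ (graphConstraints G tree e d).conf (t.getD i 0) a := fun i hi =>
        hpa _ (getD_mem hi) a (by simp)
      refine .join t [a] (ih ⟨ht, fun x hx => hv x (by simp [hx]), hp⟩) (.single a (hv a (by simp)))
        ⟨fun h => hta 0 ht0 (Or.inr h), fun h => (htree h).elim, fun _ h => hta 0 ht0 (Or.inl h)⟩ ?_
      intro i hi j hj _
      obtain rfl : j = 0 := by simpa using hj
      exact hta i hi

/-- Solutions without tree structure. -/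
theorem hasTreeSolution_iff_of_not {tree dom : Prop} (htree : ¬ tree) {e d k : ℕ} (hk : 1 ≤ k) :
    HasTreeSolution G tree dom e d k ↔ ∃ D : Finset (Fin G.n), D.card = k ∧
      (dom → IsDominating G.graph d D) ∧ (e = 0 ∨ ∀ u ∈ D, ¬ G.graph.Adj u u) ∧
      ∀ u ∈ D, ∀ v ∈ D, u ≠ v → ¬ Reach G.graph e u v := by
  constructor
  · rintro ⟨t, ht, rfl, hdom⟩
    obtain ⟨-, hv, hp⟩ := (isTree_iff_pairwise htree).1 ht
    have hlt : ∀ x ∈ t, x < G.n := fun x hx => (hv x hx).1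
    have hnd : t.Nodup := by
      refine hp.imp_of_mem fun {a b} ha _ h => ?_
      rintro rfl
      exact h (Or.inl (numReach_self (hlt a ha)))
    obtain ⟨D, hDc, hD⟩ := exists_finset_of_list hlt hnd
    refine ⟨D, hDc, fun h => (forall_listDom_iff hD).1 (hdom h), ?_, ?_⟩
    · by_cases he : e = 0
      · exact Or.inl he
      · exact Or.inr fun u hu h => ((hv u ((hD u).1 hu)).2.resolve_left he) (numAdj_coe.2 h)
    · intro u hu v hv' huv h
      have hsymm : Std.Symm fun x y => ¬ (graphConstraints G tree e d).conf x y :=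
        ⟨fun a b h h' => h (Or.symm h')⟩
      have := hp.forall ((hD u).1 hu) ((hD v).1 hv') (by simpa [Fin.ext_iff] using huv)
      exact this (Or.inl (numReach_coe.2 h))
  · rintro ⟨D, rfl, hdom, hloop, hind⟩
    have hmem : ∀ x : Fin G.n, x ∈ D ↔ (x : ℕ) ∈ D.toList.map Fin.val := by
      intro x
      simp [Fin.val_inj]
    have hlt : ∀ x ∈ D.toList.map Fin.val, x < G.n := by
      intro x hx
      obtain ⟨y, -, rfl⟩ := List.mem_map.1 hx
      exact y.2
    refine ⟨D.toList.map Fin.val, (isTree_iff_pairwise htree).2 ⟨?_, ?_, ?_⟩, by simp,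
      fun h => (forall_listDom_iff hmem).2 (hdom h)⟩
    · intro h0
      have := congrArg List.length h0
      simp at this
      simp [this] at hk
    · intro x hx
      refine ⟨hlt x hx, hloop.imp_right fun h hadj => ?_⟩
      exact h ⟨x, hlt x hx⟩ ((hmem ⟨x, hlt x hx⟩).2 hx) hadj.2.2
    · rw [List.pairwise_map]
      refine (Finset.nodup_toList D).imp_of_mem fun {a b} ha hb hab => ?_
      rw [Finset.mem_toList] at ha hb
      rintro (h | h)
      · exact hind a ha b hb hab (numReach_coe.1 h)
      · exact hind b hb a ha hab.symm (numReach_coe.1 h)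

/-- A tree whose children are joined to their parents by edges is an out-branching in the graph; if
adjacent vertices are in conflict, then it contains all edges between its vertices. -/
theorem Constraints.IsTree.exists_outBranching {tree : Prop} (htree : tree) {e d : ℕ} {t : List ℕ}
    (h : (graphConstraints G tree e d).IsTree t) :
    ∃ (D : Finset (Fin G.n)) (T : Digraph (Fin G.n)) (r : Fin G.n), D.card = t.length ∧
      (∀ x : Fin G.n, x ∈ D ↔ (x : ℕ) ∈ t) ∧ (r : ℕ) = t.getD 0 0 ∧ IsOutBranching T D r ∧
      T ≤ G.graph ∧ (1 ≤ e → ∀ a ∈ D, ∀ b ∈ D, G.graph.Adj a b → T.Adj a b) := by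
  induction h with
  | single v hv =>
    refine ⟨{⟨v, hv.1⟩}, ⊥, ⟨v, hv.1⟩, by simp, by simp [Fin.ext_iff], rfl,
      ⟨by simp, by simp, by simp, by simp, ?_⟩, bot_le, ?_⟩
    · simp only [Finset.mem_singleton, forall_eq]
      exact .refl
    · intro he a ha b hb hab
      rw [Finset.mem_singleton] at ha hb
      subst ha hb
      exact (hv.2.resolve_left (by omega) (numAdj_coe.2 hab)).elim
  | join s t hs ht hatt hc ihs iht =>
    obtain ⟨D₁, T₁, r, hc₁, hm₁, hr₁, hb₁, hT₁, hi₁⟩ := ihs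
    obtain ⟨D₂, T₂, w, hc₂, hm₂, hr₂, hb₂, hT₂, hi₂⟩ := iht
    rw [← hr₁, ← hr₂] at hatt
    have hcross : ∀ a ∈ D₁, ∀ b ∈ D₂, (graphConstraints G tree e d).conf a b → a = r ∧ b = w := by
      intro a ha b hb hab
      obtain ⟨i, hi, hia⟩ := exists_getD_of_mem ((hm₁ a).1 ha)
      obtain ⟨j, hj, hjb⟩ := exists_getD_of_mem ((hm₂ b).1 hb)
      by_cases hij : 0 < i ∨ 0 < j
      · refine (hc i hi j hj hij ?_).elim
        rwa [hia, hjb]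
      · obtain ⟨rfl, rfl⟩ : i = 0 ∧ j = 0 := by omega
        exact ⟨Fin.ext (hia.symm.trans hr₁.symm), Fin.ext (hjb.symm.trans hr₂.symm)⟩
    have hdis : Disjoint D₁ D₂ := by
      rw [Finset.disjoint_left]
      intro a ha hb
      obtain ⟨rfl, rfl⟩ := hcross a ha a hb (Or.inl (numReach_self a.2))
      exact hatt.1 (numReach_self (Fin.is_lt _))
    have hrw : G.graph.Adj r w := numAdj_coe.1 (hatt.2.1 htree)
    refine ⟨D₁ ∪ D₂, joinAt T₁ T₂ r w, r, ?_, ?_, ?_, hb₁.joinAt hb₂ hdis, ?_, ?_⟩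
    · rw [Finset.card_union_of_disjoint hdis, List.length_append, hc₁, hc₂]
    · intro x
      rw [Finset.mem_union, hm₁, hm₂, List.mem_append]
    · rw [getD_append_zero hs.length_pos, hr₁]
    · rintro a b (h | h | ⟨rfl, rfl⟩)
      · exact hT₁ h
      · exact hT₂ h
      · exact hrw
    · intro he a ha b hb hab
      have hR : Reach G.graph e a b := Reach.mono (d := 1) he (Or.inr ⟨b, hab, rfl⟩)
      rcases Finset.mem_union.1 ha with ha | ha <;> rcases Finset.mem_union.1 hb with hb | hb
      · exact Or.inl (hi₁ he a ha b hb hab)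
      · exact Or.inr (Or.inr (hcross a ha b hb (Or.inl (numReach_coe.2 hR))))
      · obtain ⟨rfl, rfl⟩ := hcross b hb a ha (Or.inr (numReach_coe.2 hR))
        exact (hatt.1 (numReach_coe.2 hR)).elim
      · exact Or.inr (Or.inl (hi₂ he a ha b hb hab))

/-- An out-branching whose edges may join parents to children, and in which there are no conflicts
except along edges, is listed by a tree: it is split at an edge out of the root. -/
theorem IsOutBranching.exists_isTree {Γ : Constraints} {n : ℕ} {T : Digraph (Fin n)}
    {D : Finset (Fin n)} {r : Fin n} (h : IsOutBranching T D r)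
    (hv : ∀ a ∈ D, Γ.valid a) (hatt : ∀ a b, T.Adj a b → Γ.att a b)
    (hconf : ∀ a ∈ D, ∀ b ∈ D, Γ.conf a b → a = b ∨ T.Adj a b ∨ T.Adj b a) :
    ∃ t, Γ.IsTree t ∧ t.getD 0 0 = r ∧ t.length = D.card ∧ ∀ x, x ∈ t ↔ ∃ a ∈ D, (a : ℕ) = x := by
  induction hs : D.card using Nat.strong_induction_on generalizing D r T with
  | _ s ih =>
    subst hs
    by_cases hD : D = {r}
    · subst hD
      exact ⟨[(r : ℕ)], .single _ (hv r (by simp)), rfl, by simp, by simp [eq_comm]⟩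
    obtain ⟨w, D₁, D₂, hrw, rfl, hdis, h₁, h₂, hcr⟩ := h.split hD
    have hcard := Finset.card_union_of_disjoint hdis
    have hp₁ : 0 < D₁.card := Finset.card_pos.2 ⟨r, h₁.1⟩
    have hp₂ : 0 < D₂.card := Finset.card_pos.2 ⟨w, h₂.1⟩
    have sub : ∀ D' ⊆ D₁ ∪ D₂, ∀ a ∈ D', ∀ b ∈ D', Γ.conf a b →
        a = b ∨ (restrictTo T D').Adj a b ∨ (restrictTo T D').Adj b a := by
      intro D' hD' a ha b hb hab
      rcases hconf a (hD' ha) b (hD' hb) hab with h | h | h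
      · exact Or.inl h
      · exact Or.inr (Or.inl ⟨h, ha, hb⟩)
      · exact Or.inr (Or.inr ⟨h, hb, ha⟩)
    obtain ⟨s, hs, hsr, hsl, hsm⟩ := ih D₁.card (by omega) h₁
      (fun a ha => hv a (Finset.mem_union_left _ ha)) (fun a b h => hatt a b h.1)
      (sub D₁ Finset.subset_union_left) rfl
    obtain ⟨t, ht, htr, htl, htm⟩ := ih D₂.card (by omega) h₂
      (fun a ha => hv a (Finset.mem_union_right _ ha)) (fun a b h => hatt a b h.1)
      (sub D₂ Finset.subset_union_right) rfl
    -- the lists have no repetitions because their lengths are the numbers of their entries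
    have hnd : ∀ (l : List ℕ) (D' : Finset (Fin n)), l.length = D'.card →
        (∀ x, x ∈ l ↔ ∃ a ∈ D', (a : ℕ) = x) → l.Nodup := by
      intro l D' hl hm
      have hl' : l.toFinset = D'.image Fin.val := by
        ext x
        simp [hm]
      have := congrArg Finset.card hl'
      rw [Finset.card_image_of_injective _ Fin.val_injective, ← hl] at this
      exact Multiset.toFinset_card_eq_card_iff_nodup (m := (l : Multiset ℕ)).1 this
    have hroot : ∀ (l : List ℕ), l.Nodup → ∀ i < l.length, l.getD i 0 = l.getD 0 0 → i = 0 := by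
      intro l hl i hi h
      rw [List.getD_eq_getElem _ _ hi, List.getD_eq_getElem _ _ (by omega)] at h
      exact (List.Nodup.getElem_inj_iff hl).1 h
    refine ⟨s ++ t, .join s t hs ht ?_ ?_, ?_, ?_, ?_⟩
    · rw [hsr, htr]; exact hatt r w hrw
    · intro i hi j hj hij hc
      obtain ⟨a, ha, hai⟩ := (hsm _).1 (getD_mem hi)
      obtain ⟨b, hb, hbj⟩ := (htm _).1 (getD_mem hj)
      rw [← hai, ← hbj] at hc
      obtain ⟨hba, hab⟩ := hcr a b ha hb
      rcases hconf a (by simp [ha]) b (by simp [hb]) hc with h | h | h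
      · subst h; exact Finset.disjoint_left.1 hdis ha hb
      · obtain ⟨rfl, rfl⟩ := hab h
        have h1 := hroot s (hnd s D₁ hsl hsm) i hi (by rw [← hai, hsr])
        have h2 := hroot t (hnd t D₂ htl htm) j hj (by rw [← hbj, htr])
        omega
      · exact hba h
    · rw [getD_append_zero hs.length_pos, hsr]
    · rw [List.length_append, hcard, hsl, htl]
    · intro x
      simp only [List.mem_append, hsm, htm, Finset.mem_union, or_and_right, exists_or]

theorem dominatingSet_iff {d k : ℕ} (hk : 1 ≤ k) :
    dominatingSet G d k ↔ HasTreeSolution G False True 0 d k := by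
  rw [hasTreeSolution_iff_of_not not_false hk]
  refine exists_congr fun D => and_congr_right fun _ => ?_
  simp +contextual [Reach]

theorem independentDominatingSet_iff {d k : ℕ} (hk : 1 ≤ k) :
    independentDominatingSet G d k ↔ HasTreeSolution G False True 1 d k := by
  rw [hasTreeSolution_iff_of_not not_false hk]
  refine exists_congr fun D => and_congr_right fun _ => ?_
  rw [true_imp_iff]
  refine and_congr_right fun _ => ⟨fun h => ⟨Or.inr fun u hu => h u hu u hu, ?_⟩, ?_⟩
  · rintro u hu v hv huv (h' | ⟨w, hw, h'⟩)
    · exact huv h'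
    · obtain rfl : w = v := h'
      exact h u hu w hv hw
  · rintro ⟨h1, h2⟩ u hu v hv hadj
    by_cases huv : u = v
    · subst huv
      exact h1.resolve_left (by omega) u hu hadj
    · exact h2 u hu v hv huv (Or.inr ⟨v, hadj, rfl⟩)

theorem isDistIndependent_iff {V : Type*} {H : Digraph V} {d : ℕ} {D : Finset V} :
    IsDistIndependent H d D ↔ (max d 1 = 0 ∨ ∀ u ∈ D, ¬ H.Adj u u) ∧
      ∀ u ∈ D, ∀ v ∈ D, u ≠ v → ¬ Reach H (max d 1) u v := by
  constructor
  · rintro ⟨h1, h2⟩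
    refine ⟨Or.inr fun u hu => h1 u hu u hu, fun u hu v hv huv h => ?_⟩
    rcases Nat.eq_zero_or_pos d with rfl | hd
    · rcases h with h | ⟨w, hw, h⟩
      · exact huv h
      · obtain rfl : w = v := h
        exact h1 u hu w hv hw
    · rw [max_eq_left hd] at h
      exact h2 u hu v hv huv h
  · rintro ⟨h1, h2⟩
    refine ⟨fun u hu v hv h => ?_, fun u hu v hv huv h =>
      h2 u hu v hv huv (Reach.mono (le_max_left _ _) h)⟩
    by_cases huv : u = v
    · subst huv
      exact h1.resolve_left (by omega) u hu h
    · exact h2 u hu v hv huv (Reach.mono (d := 1) (le_max_right _ _) (Or.inr ⟨v, h, rfl⟩))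

theorem distIndependentDominatingSet_iff {d k : ℕ} (hk : 1 ≤ k) :
    distIndependentDominatingSet G d k ↔ HasTreeSolution G False True (max d 1) d k := by
  rw [hasTreeSolution_iff_of_not not_false hk]
  refine exists_congr fun D => and_congr_right fun _ => ?_
  rw [true_imp_iff, isDistIndependent_iff]

theorem independentSet_iff {d k : ℕ} (hk : 1 ≤ k) :
    independentSet G d k ↔ HasTreeSolution G False False (max d 1) d k := by
  rw [hasTreeSolution_iff_of_not not_false hk]
  refine exists_congr fun D => and_congr_right fun _ => ?_
  rw [isDistIndependent_iff]
  simp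

theorem hasTreeSolution_of_outBranching {e d : ℕ} {D : Finset (Fin G.n)} {T : Digraph (Fin G.n)}
    {r : Fin G.n} (h : IsOutBranching T D r) (hT : T ≤ G.graph) (he : e ≤ 1)
    (hind : e = 1 → ∀ a ∈ D, ∀ b ∈ D, G.graph.Adj a b → T.Adj a b)
    (hdom : IsDominating G.graph d D) : HasTreeSolution G True True e d D.card := by
  have hR : ∀ a ∈ D, ∀ b ∈ D, Reach G.graph e a b → a = b ∨ T.Adj a b := by
    intro a ha b hb hab
    interval_cases e
    · exact Or.inl hab
    · rcases hab with h | ⟨w, hw, h⟩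
      · exact Or.inl h
      · obtain rfl : w = b := h
        exact Or.inr (hind rfl a ha w hb hw)
  have hval : ∀ a ∈ D, (graphConstraints G True e d).valid a := by
    intro a ha
    refine ⟨a.2, ?_⟩
    by_cases he0 : e = 0
    · exact Or.inl he0
    · refine Or.inr fun hadj => ?_
      have := hind (by omega) a ha a ha (numAdj_coe.1 hadj)
      exact h.adj_asymm this this
  have hatt : ∀ a b, T.Adj a b → (graphConstraints G True e d).att a b := by
    intro a b hab
    obtain ⟨ha, hb⟩ := h.2.1 a b hab
    refine ⟨fun hba => ?_, fun _ => numAdj_coe.2 (hT hab), fun hh => (hh trivial).elim⟩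
    rcases hR b hb a ha (numReach_coe.1 hba) with h' | h'
    · subst h'; exact h.adj_asymm hab hab
    · exact h.adj_asymm hab h'
  have hconf : ∀ a ∈ D, ∀ b ∈ D, (graphConstraints G True e d).conf a b →
      a = b ∨ T.Adj a b ∨ T.Adj b a := by
    rintro a ha b hb (hab | hab)
    · exact (hR a ha b hb (numReach_coe.1 hab)).imp_right Or.inl
    · exact (hR b hb a ha (numReach_coe.1 hab)).imp Eq.symm Or.inr
  obtain ⟨t, ht, -, htl, htm⟩ := h.exists_isTree hval hatt hconf
  refine ⟨t, ht, htl, fun _ => (forall_listDom_iff fun x => ?_).2 hdom⟩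
  simp [htm, Fin.val_inj]

theorem dominatingOutBranching_iff {d k : ℕ} :
    dominatingOutBranching G d k ↔ HasTreeSolution G True True 1 d k := by
  constructor
  · rintro ⟨D, rfl, hdom, r, hb⟩
    exact hasTreeSolution_of_outBranching hb (fun a b h => h.2.2) le_rfl
      (fun _ a ha b hb h => ⟨ha, hb, h⟩) hdom
  · rintro ⟨t, ht, rfl, hdom⟩
    obtain ⟨D, T, r, hc, hm, -, hb, hT, hi⟩ := ht.exists_outBranching trivial
    refine ⟨D, hc, (forall_listDom_iff hm).1 (hdom trivial), r, ?_⟩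
    have hTD : inducedOn G.graph D = T := by
      ext a b
      exact ⟨fun h => hi le_rfl a h.1 b h.2.1 h.2.2,
        fun h => ⟨(hb.2.1 a b h).1, (hb.2.1 a b h).2, hT h⟩⟩
    rwa [hTD]

theorem dominatingSpanningOutBranching_iff {d k : ℕ} :
    dominatingSpanningOutBranching G d k ↔ HasTreeSolution G True True 0 d k := by
  constructor
  · rintro ⟨D, rfl, hdom, T, hT, r, hb⟩
    exact hasTreeSolution_of_outBranching hb hT (by omega) (by omega) hdom
  · rintro ⟨t, ht, rfl, hdom⟩
    obtain ⟨D, T, r, hc, hm, -, hb, hT, -⟩ := ht.exists_outBranching trivial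
    exact ⟨D, hc, (forall_listDom_iff hm).1 (hdom trivial), T, hT, r, hb⟩

end Problems

end DiFPT

namespace DiFPT

/-! ### The number of representatives -/

section Ladders

open Constraints

variable {G : FinDigraph}

/-- A sequence of objects `Y i`, each of which comes with at most `k` vertices `X i` that do not
reach it but reach all earlier objects, is short if a crown is excluded. If `σ` holds, then also
walks in the other direction count. -/
theorem ladder_card_le {r t D k : ℕ} (hG : ¬ IsDepthMinor r (crown t) G.graph) (hD : D ≤ r)
    (σ : Prop) (I : Finset ℕ) (X Y : ℕ → List ℕ)
    (hX : ∀ i ∈ I, (X i).length ≤ k ∧ ∀ x ∈ X i, x < G.n)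
    (hY : ∀ i ∈ I, (Y i).length ≤ k ∧ Y i ≠ [] ∧ ∀ y ∈ Y i, y < G.n)
    (hmiss : ∀ i ∈ I, ∀ x ∈ X i, ∀ y ∈ Y i, ¬ (NumReach G D x y ∨ σ ∧ NumReach G D y x))
    (hhit : ∀ i ∈ I, ∀ j ∈ I, j < i →
      ∃ x ∈ X i, ∃ y ∈ Y j, NumReach G D x y ∨ σ ∧ NumReach G D y x) :
    I.card ≤ ladderLength t r (2 * k) + 1 := by
  rcases I.eq_empty_or_nonempty with rfl | hI
  · simp
  set i₀ := I.min' hI with hi₀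
  have hi₀I : i₀ ∈ I := I.min'_mem hI
  have hn : 0 < G.n := by
    obtain ⟨y, hy⟩ := List.exists_mem_of_ne_nil _ (hY i₀ hi₀I).2.1
    exact (Nat.zero_le _).trans_lt ((hY i₀ hi₀I).2.2 y hy)
  let Z : Fin k ⊕ Fin k → ℕ → ℕ := fun l i =>
    Sum.elim (fun a : Fin k => (X i).getD a ((X i).getD 0 0))
      (fun b : Fin k => (Y i).getD b ((Y i).getD 0 0)) l
  let P : Fin k ⊕ Fin k → ℕ → Fin G.n := fun l i =>
    if h : Z l i < G.n then ⟨Z l i, h⟩ else ⟨0, hn⟩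
  have hmem : ∀ (l : List ℕ) (a : ℕ), l ≠ [] → l.getD a (l.getD 0 0) ∈ l := by
    intro l a hl
    by_cases ha : a < l.length
    · rw [List.getD_eq_getElem _ _ ha]; exact List.getElem_mem ha
    · rw [List.getD_eq_default _ _ (by omega)]; exact getD_mem (List.length_pos_iff.2 hl)
  have hXne : ∀ i ∈ I.erase i₀, X i ≠ [] := by
    intro i hi h0
    obtain ⟨hne, hi⟩ := Finset.mem_erase.1 hi
    obtain ⟨x, hx, -⟩ := hhit i hi i₀ hi₀I (lt_of_le_of_ne (I.min'_le i hi) hne.symm)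
    simp [h0] at hx
  have hP : ∀ l, ∀ i ∈ I.erase i₀, (P l i : ℕ) = Z l i := by
    intro l i hi
    have : Z l i < G.n := by
      rcases l with a | b
      · exact (hX i (Finset.mem_of_mem_erase hi)).2 _ (hmem _ _ (hXne i hi))
      · exact (hY i (Finset.mem_of_mem_erase hi)).2.2 _
          (hmem _ _ (hY i (Finset.mem_of_mem_erase hi)).2.1)
    simp only [P, dif_pos this]
  have hZX : ∀ i ∈ I, ∀ x ∈ X i, ∃ a, Z (.inl a) i = x := by
    intro i hi x hx
    obtain ⟨a, ha, rfl⟩ := List.mem_iff_getElem.1 hx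
    exact ⟨⟨a, ha.trans_le (hX i hi).1⟩, List.getD_eq_getElem _ _ ha⟩
  have hZY : ∀ i ∈ I, ∀ y ∈ Y i, ∃ b, Z (.inr b) i = y := by
    intro i hi y hy
    obtain ⟨b, hb, rfl⟩ := List.mem_iff_getElem.1 hy
    exact ⟨⟨b, hb.trans_le (hY i hi).1⟩, List.getD_eq_getElem _ _ hb⟩
  have hcard := ladder_bound hG hD P
    {l | (∃ a b, l = (.inl a, .inr b)) ∨ (σ ∧ ∃ a b, l = (.inr b, .inl a))} (I.erase i₀) ?_ ?_
  · rw [Fintype.card_sum, Fintype.card_fin, ← two_mul, Finset.card_erase_of_mem hi₀I] at hcard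
    omega
  · rintro l (⟨a, b, rfl⟩ | ⟨hσ, a, b, rfl⟩) i hi h
    all_goals
      rw [← numReach_coe, hP _ _ hi, hP _ _ hi] at h
      have h1 := hmem (X i) a (hXne i hi)
      have h2 := hmem (Y i) b (hY i (Finset.mem_of_mem_erase hi)).2.1
    · exact hmiss i (Finset.mem_of_mem_erase hi) _ h1 _ h2 (Or.inl h)
    · exact hmiss i (Finset.mem_of_mem_erase hi) _ h1 _ h2 (Or.inr ⟨hσ, h⟩)
  · have key : ∀ i ∈ I.erase i₀, ∀ j ∈ I.erase i₀, j < i → ∃ l, ((∃ a b, l = (.inl a, .inr b)) ∨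
        (σ ∧ ∃ a b, l = (.inr b, .inl a))) ∧ (Reach G.graph D (P l.1 i) (P l.2 j) ∨
          Reach G.graph D (P l.1 j) (P l.2 i)) := by
      intro i hi j hj hji
      obtain ⟨x, hx, y, hy, h⟩ := hhit i (Finset.mem_of_mem_erase hi) j
        (Finset.mem_of_mem_erase hj) hji
      obtain ⟨a, rfl⟩ := hZX i (Finset.mem_of_mem_erase hi) x hx
      obtain ⟨b, rfl⟩ := hZY j (Finset.mem_of_mem_erase hj) y hy
      rw [← hP _ i hi, ← hP _ j hj, numReach_coe, numReach_coe] at h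
      rcases h with h | ⟨hσ, h⟩
      · exact ⟨_, Or.inl ⟨a, b, rfl⟩, Or.inl h⟩
      · exact ⟨_, Or.inr ⟨hσ, a, b, rfl⟩, Or.inr h⟩
    intro i hi j hj hij
    rcases Nat.lt_or_gt_of_ne hij with h | h
    · obtain ⟨l, hl, h⟩ := key j hj i hi h
      exact ⟨l, hl, h.symm⟩
    · exact key i hi j hj h

end Ladders

namespace Constraints

variable (Γ : Constraints)

/-! ### Domination cores -/

/-- The vertex `v` has to be added to `B`: there are at most `k` vertices that dominate `B` but do
not dominate `v`. -/
def CoreNeeds (n k : ℕ) (B : List ℕ) (v : ℕ) : Prop :=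
  ∃ X : List ℕ, X.length ≤ k ∧ (∀ x ∈ X, x < n ∧ ¬ Γ.dom x v) ∧
    ∀ j < B.length, ∃ x ∈ X, Γ.dom x (B.getD j 0)

/-- Every entry of `B` had to be added when `B` consisted of the earlier entries. -/
def IsCore (n k : ℕ) (B : List ℕ) : Prop :=
  ∀ i < B.length, B.getD i 0 < n ∧ Γ.CoreNeeds n k (B.take i) (B.getD i 0)

variable {Γ}

theorem IsCore.append {n k : ℕ} {B : List ℕ} (h : Γ.IsCore n k B) {v : ℕ} (hv : v < n)
    (hneed : Γ.CoreNeeds n k B v) : Γ.IsCore n k (B ++ [v]) := by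
  intro i hi
  rw [List.length_append, List.length_singleton] at hi
  rcases Nat.lt_succ_iff_lt_or_eq.1 hi with hi | rfl
  · rw [List.getD_append _ _ _ _ hi, List.take_append_of_le_length hi.le]
    exact h i hi
  · rw [List.getD_append_right _ _ _ _ le_rfl, Nat.sub_self, List.take_left']
    · exact ⟨hv, hneed⟩
    · rfl

/-! ### Collections of representatives -/

variable (Γ)

/-- The tree `t` has to be added to `F`: there are at most `k` vertices that are not in conflict
with it, but are in conflict with all members of `F` that are like it. Conflicts with roots do not
count: trees that are alike have the same root. -/
def Needs (n k : ℕ) (B : List ℕ) (F : List (List ℕ)) (t : List ℕ) : Prop :=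
  ∃ X : List ℕ, X.length ≤ k ∧ (∀ x ∈ X, x < n ∧ ¬ Γ.Hits x t) ∧
    ∀ j < F.length, Γ.Alike B (F.getD j []) t → ∃ x ∈ X, Γ.Hits x (F.getD j [])

open Classical in
/-- The first `n` members of `F` are the trees with one vertex, or empty for the vertices that are
not valid; each later member is a tree that had to be added when `F` consisted of the earlier ones.
-/
structure IsCollection (n k : ℕ) (B : List ℕ) (F : List (List ℕ)) : Prop where
  le_length : n ≤ F.length
  single : ∀ v < n, F.getD v [] = if Γ.valid v then [v] else []
  isTree : ∀ i < F.length, n ≤ i → Γ.IsTree (F.getD i []) ∧ 2 ≤ (F.getD i []).length ∧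
    (F.getD i []).length ≤ k ∧ Γ.Needs n k B (F.take i) (F.getD i [])

variable {Γ}

theorem Alike.symm {B s t : List ℕ} (h : Γ.Alike B s t) : Γ.Alike B t s :=
  ⟨h.1.symm, h.2.1.symm, fun i hi => (h.2.2 i hi).symm⟩

theorem Alike.trans {B r s t : List ℕ} (h : Γ.Alike B r s) (h' : Γ.Alike B s t) :
    Γ.Alike B r t :=
  ⟨h.1.trans h'.1, h.2.1.trans h'.2.1, fun i hi => (h.2.2 i hi).trans (h'.2.2 i hi)⟩

theorem getD_append_list {F F' : List (List ℕ)} {i : ℕ} (h : i < F.length) :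
    (F ++ F').getD i [] = F.getD i [] := List.getD_append _ _ _ _ h

theorem IsCollection.isTree_of_ne_nil {n k : ℕ} {B : List ℕ} {F : List (List ℕ)}
    (h : Γ.IsCollection n k B F) : ∀ t ∈ F, t ≠ [] → Γ.IsTree t := by
  intro t ht hne
  obtain ⟨i, hi, rfl⟩ := List.mem_iff_getElem.1 ht
  rw [← List.getD_eq_getElem (d := []) _ hi] at hne ⊢
  by_cases hin : i < n
  · rw [h.single i hin] at hne ⊢
    split_ifs at hne ⊢ with hv
    · exact .single i hv
    · exact (hne rfl).elim
  · exact (h.isTree i hi (by omega)).1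

theorem IsCollection.append {n k : ℕ} {B : List ℕ} {F : List (List ℕ)}
    (h : Γ.IsCollection n k B F) {s t : List ℕ} (hs : s ∈ F) (ht : t ∈ F)
    (hj : Γ.Joinable k s t) (hneed : Γ.Needs n k B F (s ++ t)) :
    Γ.IsCollection n k B (F ++ [s ++ t]) := by
  refine ⟨h.le_length.trans (by simp), fun v hv => ?_, fun i hi hni => ?_⟩
  · rw [getD_append_list (hv.trans_le h.le_length)]
    exact h.single v hv
  · rw [List.length_append, List.length_singleton] at hi
    rcases Nat.lt_succ_iff_lt_or_eq.1 hi with hi | rfl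
    · rw [getD_append_list hi, List.take_append_of_le_length hi.le]
      exact h.isTree i hi hni
    · rw [List.getD_append_right _ _ _ _ le_rfl, Nat.sub_self, List.take_left' rfl]
      have hs0 : s ≠ [] := List.length_pos_iff.1 hj.1
      have ht0 : t ≠ [] := List.length_pos_iff.1 hj.2.1
      obtain ⟨h1, h2, h3, h4, h5⟩ := hj
      refine ⟨.join s t (h.isTree_of_ne_nil s hs hs0) (h.isTree_of_ne_nil t ht ht0) h4 h5, ?_, ?_,
        hneed⟩
      · simp only [List.getD_cons_zero, List.length_append]; omega
      · simpa using h3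

/-- When nothing has to be added any more, the problem can be read off from the collection. -/
theorem exists_solution_iff {n k : ℕ} (hk : 1 ≤ k) {dom : Prop}
    {B : List ℕ} {F : List (List ℕ)}
    (hsym : ∀ x y, Γ.conf x y → Γ.conf y x) (hvalid : ∀ v, Γ.valid v → v < n)
    (hB : ∀ i < B.length, B.getD i 0 < n) (hB0 : ¬ dom → B = [])
    (hcore : dom → ∀ v < n, ¬ Γ.CoreNeeds n k B v)
    (hF : Γ.IsCollection n k B F)
    (hsat : ∀ i < F.length, ∀ j < F.length, Γ.Joinable k (F.getD i []) (F.getD j []) →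
      ¬ Γ.Needs n k B F (F.getD i [] ++ F.getD j [])) :
    (∃ i < F.length, (F.getD i []).length = k ∧
      ∀ b < B.length, Γ.ListDom (F.getD i []) (B.getD b 0)) ↔
    ∃ t, Γ.IsTree t ∧ t.length = k ∧ (dom → ∀ v < n, Γ.ListDom t v) := by
  have hmemF : ∀ i < F.length, F.getD i [] ∈ F := fun i hi => by
    rw [List.getD_eq_getElem _ _ hi]; exact List.getElem_mem hi
  constructor
  · rintro ⟨i, hi, hik, hib⟩
    have ht : Γ.IsTree (F.getD i []) := hF.isTree_of_ne_nil _ (hmemF i hi) (by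
      intro h0; rw [h0] at hik; simp at hik; omega)
    refine ⟨_, ht, hik, fun hd v hv => ?_⟩
    by_contra hcon
    refine hcore hd v hv
      ⟨F.getD i [], hik.le, fun x hx => ⟨hvalid x (ht.valid_of_mem x hx), ?_⟩, ?_⟩
    · intro hxv
      obtain ⟨c, hc, rfl⟩ := exists_getD_of_mem hx
      exact hcon ⟨c, hc, hxv⟩
    · intro b hb
      obtain ⟨c, hc, h⟩ := hib b hb
      exact ⟨_, getD_mem hc, h⟩
  · rintro ⟨t, ht, rfl, hdom⟩
    have hsat' : Γ.Saturated n t.length B F := by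
      intro s hs u hu hj X hX hXn
      by_contra! hcon
      obtain ⟨i, hi, rfl⟩ := List.mem_iff_getElem.1 hs
      obtain ⟨j, hj', rfl⟩ := List.mem_iff_getElem.1 hu
      rw [← List.getD_eq_getElem (d := []) _ hi, ← List.getD_eq_getElem (d := []) _ hj'] at *
      refine hsat i hi j hj' hj ⟨X, hX, hXn, fun r hr hal => ?_⟩
      exact hcon _ (hmemF r hr) hal
    have hsingle : ∀ v, Γ.valid v → [v] ∈ F := by
      intro v hv
      have h1 := hF.single v (hvalid v hv)
      rw [if_pos hv] at h1
      rw [← h1]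
      exact hmemF v ((hvalid v hv).trans_le hF.le_length)
    obtain ⟨r, hr, ⟨hl, -, hd⟩, -⟩ := ht.exists_representative hsym hvalid hsingle
      hF.isTree_of_ne_nil hsat' [] (by simp) (by simp)
    obtain ⟨i, hi, rfl⟩ := List.mem_iff_getElem.1 hr
    rw [← List.getD_eq_getElem (d := []) _ hi] at hl hd
    refine ⟨i, hi, hl, fun b hb => (hd b hb).2 ?_⟩
    by_cases hdm : dom
    · exact hdom hdm _ (hB b hb)
    · rw [hB0 hdm] at hb
      exact (Nat.not_lt_zero _ hb).elim

end Constraints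

section Bounds

open Constraints

variable {G : FinDigraph}

/-- Bound on the size of a domination core and on the number of representatives of each kind. -/
def coreBound (t d k : ℕ) : ℕ := ladderLength t (d + 1) (2 * k) + 1

theorem getD_take {B : List ℕ} {i j : ℕ} (h : j < i) : (B.take i).getD j 0 = B.getD j 0 := by
  simp [List.getD_eq_getElem?_getD, h]

theorem Constraints.IsCore.length_le {t d e k : ℕ} {tree : Prop} (hk : 1 ≤ k)
    (hG : ¬ IsDepthMinor (d + 1) (crown t) G.graph) {B : List ℕ}
    (hB : (graphConstraints G tree e d).IsCore G.n k B) : B.length ≤ coreBound t d k := by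
  choose! hn X hXk hX hXB using hB
  have h := ladder_card_le (D := d) (k := k) hG (by omega) False (Finset.range B.length) X
    (fun i => [B.getD i 0]) ?_ ?_ ?_ ?_
  · simpa [coreBound] using h
  · exact fun i hi =>
      ⟨hXk i (Finset.mem_range.1 hi), fun x hx => (hX i (Finset.mem_range.1 hi) x hx).1⟩
  · intro i hi
    refine ⟨by simpa using hk, by simp, ?_⟩
    simpa using hn i (Finset.mem_range.1 hi)
  · intro i hi x hx y hy
    obtain rfl := List.mem_singleton.1 hy
    rintro (h | h)
    · exact (hX i (Finset.mem_range.1 hi) x hx).2 h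
    · exact h.1
  · intro i hi j hj hji
    rw [Finset.mem_range] at hi hj
    obtain ⟨x, hx, h⟩ := hXB i hi j (by simp; omega)
    rw [getD_take hji] at h
    exact ⟨x, hx, _, List.mem_singleton_self _, Or.inl h⟩

open Classical in
/-- The number of members of a collection that are like a given tree. -/
theorem Constraints.IsCollection.count_le {t d e k : ℕ} (he : e ≤ d + 1) {tree : Prop}
    (hG : ¬ IsDepthMinor (d + 1) (crown t) G.graph) {B : List ℕ} {F : List (List ℕ)}
    (hF : (graphConstraints G tree e d).IsCollection G.n k B F) {u : List ℕ} (hu : 2 ≤ u.length) :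
    ((Finset.range F.length).filter fun i =>
      (graphConstraints G tree e d).Alike B (F.getD i []) u).card ≤ coreBound t d k := by
  set I := (Finset.range F.length).filter fun i =>
      (graphConstraints G tree e d).Alike B (F.getD i []) u with hI
  have hmem : ∀ i ∈ I, i < F.length ∧ (graphConstraints G tree e d).Alike B (F.getD i []) u ∧
      G.n ≤ i := by
    intro i hi
    obtain ⟨h1, h2⟩ := Finset.mem_filter.1 hi
    refine ⟨Finset.mem_range.1 h1, h2, ?_⟩
    by_contra! hcon
    have h3 := h2.1
    rw [hF.single i hcon] at h3
    split_ifs at h3 <;> simp at h3 <;> omega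
  choose! ht h2 hk X hXk hX hXF using hF.isTree
  have htail : ∀ (x : ℕ) (s : List ℕ), (graphConstraints G tree e d).Hits x s ↔
      ∃ y ∈ s.tail, NumReach G e x y ∨ True ∧ NumReach G e y x := by
    intro x s
    constructor
    · rintro ⟨c, hc, h0, h⟩
      refine ⟨s.getD c 0, ?_, h.imp_right fun h => ⟨trivial, h⟩⟩
      obtain ⟨c, rfl⟩ : ∃ c', c = c' + 1 := ⟨c - 1, by omega⟩
      cases s with
      | nil => simp at hc
      | cons a s => simpa using getD_mem (t := s) (by simpa using hc)
    · rintro ⟨y, hy, h⟩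
      cases s with
      | nil => simp at hy
      | cons a s =>
        obtain ⟨c, hc, rfl⟩ := exists_getD_of_mem hy
        exact ⟨c + 1, by simpa using hc, by omega, h.imp_right fun h => h.2⟩
  refine ladder_card_le (D := e) (k := k) hG (by omega) True I X (fun i => (F.getD i []).tail)
    ?_ ?_ ?_ ?_
  · intro i hi
    obtain ⟨h1, -, h3⟩ := hmem i hi
    exact ⟨hXk i h1 h3, fun x hx => (hX i h1 h3 x hx).1⟩
  · intro i hi
    obtain ⟨h1, -, h3⟩ := hmem i hi
    have := h2 i h1 h3
    have := hk i h1 h3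
    refine ⟨by rw [List.length_tail]; omega, ?_, fun y hy =>
      ((ht i h1 h3).valid_of_mem y (List.mem_of_mem_tail hy)).1⟩
    rw [← List.length_pos_iff, List.length_tail]
    omega
  · intro i hi x hx y hy h
    obtain ⟨h1, -, h3⟩ := hmem i hi
    exact (hX i h1 h3 x hx).2 ((htail _ _).2 ⟨y, hy, h⟩)
  · intro i hi j hj hji
    obtain ⟨h1, h1', h3⟩ := hmem i hi
    obtain ⟨h4, h4', -⟩ := hmem j hj
    have hji' : (F.take i).getD j [] = F.getD j [] := by
      simp [List.getD_eq_getElem?_getD, hji]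
    obtain ⟨x, hx, h⟩ := hXF i h1 h3 j (by simp; omega) (by rw [hji']; exact h4'.trans h1'.symm)
    rw [hji'] at h
    exact ⟨x, hx, (htail _ _).1 h⟩

open Classical in
theorem Constraints.IsCollection.length_le {t d e k : ℕ} (he : e ≤ d + 1) {tree : Prop}
    (hG : ¬ IsDepthMinor (d + 1) (crown t) G.graph) {B : List ℕ} {F : List (List ℕ)}
    (hF : (graphConstraints G tree e d).IsCollection G.n k B F) :
    F.length ≤ G.n + coreBound t d k * (G.n * ((k + 1) * 2 ^ B.length)) := by
  set Γ := graphConstraints G tree e d with hΓ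
  let f : ℕ → ℕ × ℕ × Finset ℕ := fun i => ((F.getD i []).getD 0 0, (F.getD i []).length,
    (Finset.range B.length).filter fun b => Γ.ListDom (F.getD i []) (B.getD b 0))
  have h := Finset.card_le_mul_card_image_of_maps_to (s := Finset.Ico G.n F.length) (f := f)
    (t := Finset.range G.n ×ˢ Finset.range (k + 1) ×ˢ (Finset.range B.length).powerset)
    ?_ (coreBound t d k) ?_
  · simp only [Nat.card_Ico, Finset.card_product, Finset.card_range, Finset.card_powerset] at h
    omega
  · intro i hi
    obtain ⟨h1, h2⟩ := Finset.mem_Ico.1 hi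
    obtain ⟨ht, h3, h4, -⟩ := hF.isTree i h2 h1
    simp only [f, Finset.mem_product, Finset.mem_range, Finset.mem_powerset]
    exact ⟨(ht.valid_of_mem _ (getD_mem (by omega))).1, by omega, Finset.filter_subset _ _⟩
  · intro c _
    rcases ((Finset.Ico G.n F.length).filter fun i => f i = c).eq_empty_or_nonempty with
      h0 | ⟨i, hi⟩
    · rw [h0]; simp
    obtain ⟨hi, hic⟩ := Finset.mem_filter.1 hi
    obtain ⟨h1, h2⟩ := Finset.mem_Ico.1 hi
    refine le_trans (Finset.card_le_card ?_) (hF.count_le he hG (hF.isTree i h2 h1).2.1)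
    intro j hj
    obtain ⟨hj, hjc⟩ := Finset.mem_filter.1 hj
    obtain ⟨-, h4⟩ := Finset.mem_Ico.1 hj
    refine Finset.mem_filter.2 ⟨Finset.mem_range.2 h4, ?_⟩
    have hf := hjc.trans hic.symm
    simp only [f, Prod.mk.injEq] at hf
    refine ⟨hf.2.1, hf.1, fun b hb => ?_⟩
    have := Finset.ext_iff.1 hf.2.2 b
    simpa [hb] using this

end Bounds

end DiFPT

namespace DiFPT

/-! ### Running programs -/

/-- The program `P` takes the state `s` to the state `s'` in at most `T` steps. -/
def Run (P : Program) (s s' : MachineState) (T : ℕ) : Prop :=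
  ∃ t ≤ T, Exec P s s' t

section Run

theorem Run.mono {P : Program} {s s' : MachineState} {T T' : ℕ} (h : Run P s s' T) (hT : T ≤ T') :
    Run P s s' T' :=
  let ⟨t, ht, h⟩ := h
  ⟨t, ht.trans hT, h⟩

theorem Run.seq {P Q : Program} {s s₁ s₂ : MachineState} {T₁ T₂ : ℕ} (h₁ : Run P s s₁ T₁)
    (h₂ : Run Q s₁ s₂ T₂) : Run (.seq P Q) s s₂ (T₁ + T₂) :=
  let ⟨t₁, ht₁, h₁⟩ := h₁
  let ⟨t₂, ht₂, h₂⟩ := h₂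
  ⟨t₁ + t₂, Nat.add_le_add ht₁ ht₂, .seq h₁ h₂⟩

theorem Run.const (x a : ℕ) (s : MachineState) : Run (.const x a) s (s.setReg x a) 1 :=
  ⟨1, le_rfl, .const x a s⟩

theorem Run.add (x y z : ℕ) (s : MachineState) :
    Run (.add x y z) s (s.setReg x (s.reg y + s.reg z)) 1 := ⟨1, le_rfl, .add x y z s⟩

theorem Run.sub (x y z : ℕ) (s : MachineState) :
    Run (.sub x y z) s (s.setReg x (s.reg y - s.reg z)) 1 := ⟨1, le_rfl, .sub x y z s⟩

theorem Run.load (x y : ℕ) (s : MachineState) :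
    Run (.load x y) s (s.setReg x (s.mem (s.reg y))) 1 := ⟨1, le_rfl, .load x y s⟩

theorem Run.store (x y : ℕ) (s : MachineState) :
    Run (.store x y) s (s.setMem (s.reg x) (s.reg y)) 1 := ⟨1, le_rfl, .store x y s⟩

theorem Run.ifPos {x : ℕ} {P Q : Program} {s s' : MachineState} {T : ℕ}
    (h₁ : 0 < s.reg x → Run P s s' T) (h₂ : s.reg x = 0 → Run Q s s' T) :
    Run (.ifPos x P Q) s s' (T + 1) := by
  rcases Nat.eq_zero_or_pos (s.reg x) with h | h
  · obtain ⟨t, ht, h'⟩ := h₂ h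
    exact ⟨t + 1, by omega, .ifPos_false h h'⟩
  · obtain ⟨t, ht, h'⟩ := h₁ h
    exact ⟨t + 1, by omega, .ifPos_true h h'⟩

/-- A loop whose body is run at most `k` times. The state after `j` rounds satisfies `J j`. -/
theorem Run.whilePos {x : ℕ} {P : Program} (J : ℕ → MachineState → Prop) (k T : ℕ)
    (hbody : ∀ j s, J j s → 0 < s.reg x → j < k ∧ ∃ s', Run P s s' T ∧ J (j + 1) s')
    (s : MachineState) (hs : J 0 s) :
    ∃ j s', Run (.whilePos x P) s s' (k * (T + 1) + 1) ∧ J j s' ∧ s'.reg x = 0 := by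
  have key : ∀ i j s, J j s → k ≤ i + j →
      ∃ j s', Run (.whilePos x P) s s' (i * (T + 1) + 1) ∧ J j s' ∧ s'.reg x = 0 := by
    intro i
    induction i with
    | zero =>
      intro j s hs hk
      rcases Nat.eq_zero_or_pos (s.reg x) with h0 | h0
      · exact ⟨j, s, ⟨1, by omega, Exec.whilePos_stop h0⟩, hs, h0⟩
      · exact absurd (hbody j s hs h0).1 (by omega)
    | succ i ih =>
      intro j s hs hk
      rcases Nat.eq_zero_or_pos (s.reg x) with h0 | h0
      · exact ⟨j, s, ⟨1, by omega, Exec.whilePos_stop h0⟩, hs, h0⟩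
      · obtain ⟨-, s₁, ⟨t₁, ht₁, h₁⟩, hs₁⟩ := hbody j s hs h0
        obtain ⟨j', s₂, ⟨t₂, ht₂, h₂⟩, hs₂, h0'⟩ := ih (j + 1) s₁ hs₁ (by omega)
        exact ⟨j', s₂, ⟨t₁ + t₂ + 1, by rw [Nat.succ_mul]; omega, .whilePos_step h0 h₁ h₂⟩,
          hs₂, h0'⟩
  exact key k 0 s hs (by omega)

@[simp]
theorem setReg_reg_self (s : MachineState) (x a : ℕ) : (s.setReg x a).reg x = a :=
  Function.update_self ..

theorem setReg_reg_of_ne (s : MachineState) {x y : ℕ} (a : ℕ) (h : y ≠ x) :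
    (s.setReg x a).reg y = s.reg y := Function.update_of_ne h ..

end Run

/-! ### Expressions that are evaluated in polynomial time -/

section Poly

theorem add_le_pow {a x y c d : ℕ} (ha : 2 ≤ a) (hx : x ≤ a ^ c) (hy : y ≤ a ^ d) :
    x + y ≤ a ^ (c + d + 1) := by
  have h1 : a ^ c ≤ a ^ (c + d) := Nat.pow_le_pow_right (by omega) (by omega)
  have h2 : a ^ d ≤ a ^ (c + d) := Nat.pow_le_pow_right (by omega) (by omega)
  calc x + y ≤ a ^ (c + d) * 2 := by omega
    _ ≤ a ^ (c + d) * a := by gcongr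
    _ = a ^ (c + d + 1) := (pow_succ ..).symm

theorem succ_le_pow {a x c : ℕ} (ha : 2 ≤ a) (hx : x ≤ a ^ c) : x + 1 ≤ a ^ (c + 1) :=
  add_le_pow (d := 0) ha hx (pow_zero _).ge

theorem mul_le_pow {a x y c d : ℕ} (hx : x ≤ a ^ c) (hy : y ≤ a ^ d) : x * y ≤ a ^ (c + d) := by
  rw [pow_add]
  exact Nat.mul_le_mul hx hy

theorem const_le_pow {a : ℕ} (ha : 2 ≤ a) (x : ℕ) : x ≤ a ^ x :=
  (Nat.lt_two_pow_self).le.trans (Nat.pow_le_pow_left ha x)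

end Poly

/-- A description of machine states by abstract data of type `β`: the state `s` represents `b` if
`I b s`. This depends only on the memory and on the registers below `m`; the measure `N b` is what
running times are compared with. -/
structure Ctx (β : Type) where
  m : ℕ
  I : β → MachineState → Prop
  N : β → ℕ
  stable : ∀ b s s', I b s → s'.mem = s.mem → (∀ x < m, s'.reg x = s.reg x) → I b s'

/-- The number `f b` can be computed from states that represent `b`, in time polynomial in the
measure: for every register `m` that is free there is a program which writes the value into it and
leaves the registers below `m` and the memory as they are. -/
def Ev {β : Type} (Γ : Ctx β) (f : β → ℕ) : Prop :=
  ∀ m ≥ Γ.m, ∃ P c, ∀ b s, Γ.I b s → ∃ s', Run P s s' ((Γ.N b + 2) ^ c) ∧ s'.mem = s.mem ∧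
    (∀ x < m, s'.reg x = s.reg x) ∧ s'.reg m = f b

open Classical in
/-- The same for a condition. -/
def EvP {β : Type} (Γ : Ctx β) (p : β → Prop) : Prop := Ev Γ fun b => if p b then 1 else 0

/-- The number `f b` is bounded by a polynomial in the measure. -/
def PolyBdd {β : Type} (Γ : Ctx β) (f : β → ℕ) : Prop :=
  ∃ c, ∀ b s, Γ.I b s → f b ≤ (Γ.N b + 2) ^ c

/-- `Γ'` contains all data of `Γ`; the map `π` forgets the additional data. -/
structure Ext {β β' : Type} (Γ : Ctx β) (Γ' : Ctx β') (π : β' → β) : Prop where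
  le : Γ.m ≤ Γ'.m
  inv : ∀ b s, Γ'.I b s → Γ.I (π b) s
  measure_eq : ∀ b, Γ'.N b = Γ.N (π b)

/-- Additional data: a number `x` in register `r` with the property `Q b x`. -/
def Ctx.push {β : Type} (Γ : Ctx β) (r : ℕ) (Q : β → ℕ → Prop) : Ctx (β × ℕ) where
  m := max Γ.m (r + 1)
  I p s := Γ.I p.1 s ∧ s.reg r = p.2 ∧ Q p.1 p.2
  N p := Γ.N p.1
  stable := fun _ s s' h hm hr => ⟨Γ.stable _ s s' h.1 hm fun x hx => hr x (by omega),
    (hr r (by omega)).trans h.2.1, h.2.2⟩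

/-- The same data, with the additional information that `p` holds. -/
def Ctx.restrict {β : Type} (Γ : Ctx β) (p : β → Prop) : Ctx β where
  m := Γ.m
  I b s := Γ.I b s ∧ p b
  N := Γ.N
  stable := fun b s s' h hm hr => ⟨Γ.stable b s s' h.1 hm hr, h.2⟩

/-- The function `f b` of one number can be computed wherever the data `b` are available. -/
def Fn1 {β : Type} (Γ : Ctx β) (f : β → ℕ → ℕ) : Prop :=
  ∀ (β' : Type) (Γ' : Ctx β') (π : β' → β), Ext Γ Γ' π → ∀ e : β' → ℕ, Ev Γ' e →
    Ev Γ' fun b => f (π b) (e b)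

/-- The property `p b` of a number can be decided wherever the data `b` are available. -/
def Pr1 {β : Type} (Γ : Ctx β) (p : β → ℕ → Prop) : Prop :=
  ∀ (β' : Type) (Γ' : Ctx β') (π : β' → β), Ext Γ Γ' π → ∀ e : β' → ℕ, Ev Γ' e →
    EvP Γ' fun b => p (π b) (e b)

/-- The relation `p b` between two numbers can be decided wherever the data `b` are available. -/
def Pr2 {β : Type} (Γ : Ctx β) (p : β → ℕ → ℕ → Prop) : Prop :=
  ∀ (β' : Type) (Γ' : Ctx β') (π : β' → β), Ext Γ Γ' π → ∀ e₁ e₂ : β' → ℕ, Ev Γ' e₁ → Ev Γ' e₂ →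
    EvP Γ' fun b => p (π b) (e₁ b) (e₂ b)

section Ev

variable {β β' β'' : Type} {Γ : Ctx β} {Γ' : Ctx β'} {Γ'' : Ctx β''}

theorem Ext.refl (Γ : Ctx β) : Ext Γ Γ fun b => b := ⟨le_rfl, fun _ _ h => h, fun _ => rfl⟩

theorem Ext.push {π : β' → β} (h : Ext Γ Γ' π) (r : ℕ) (Q : β' → ℕ → Prop) :
    Ext Γ (Γ'.push r Q) fun p => π p.1 :=
  ⟨h.le.trans (le_max_left _ _), fun _ _ hp => h.inv _ _ hp.1, fun _ => h.measure_eq _⟩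

theorem Ext.restrict (Γ : Ctx β) (p : β → Prop) : Ext Γ (Γ.restrict p) fun b => b :=
  ⟨le_rfl, fun _ _ h => h.1, fun _ => rfl⟩

theorem Ext.trans {π : β' → β} {π' : β'' → β'} (h : Ext Γ Γ' π) (h' : Ext Γ' Γ'' π') :
    Ext Γ Γ'' fun b => π (π' b) :=
  ⟨h.le.trans h'.le, fun _ _ hb => h.inv _ _ (h'.inv _ _ hb),
    fun b => (h'.measure_eq b).trans (h.measure_eq _)⟩

theorem Ev.ext {π : β' → β} (hπ : Ext Γ Γ' π) {f : β → ℕ} (h : Ev Γ f) :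
    Ev Γ' fun b => f (π b) := by
  intro m hm
  obtain ⟨P, c, h⟩ := h m (hπ.le.trans hm)
  refine ⟨P, c, fun b s hb => ?_⟩
  rw [hπ.measure_eq]
  exact h _ s (hπ.inv b s hb)

theorem EvP.ext {π : β' → β} (hπ : Ext Γ Γ' π) {p : β → Prop} (h : EvP Γ p) :
    EvP Γ' fun b => p (π b) := Ev.ext hπ h

theorem PolyBdd.ext {π : β' → β} (hπ : Ext Γ Γ' π) {f : β → ℕ} (h : PolyBdd Γ f) :
    PolyBdd Γ' fun b => f (π b) := by
  obtain ⟨c, h⟩ := h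
  refine ⟨c, fun b s hb => ?_⟩
  rw [hπ.measure_eq]
  exact h _ s (hπ.inv b s hb)

theorem Fn1.ext {π : β' → β} (hπ : Ext Γ Γ' π) {f : β → ℕ → ℕ} (h : Fn1 Γ f) :
    Fn1 Γ' fun b => f (π b) := fun _ _ _ hπ' e he => h _ _ _ (hπ.trans hπ') e he

theorem Pr1.ext {π : β' → β} (hπ : Ext Γ Γ' π) {p : β → ℕ → Prop} (h : Pr1 Γ p) :
    Pr1 Γ' fun b => p (π b) := fun _ _ _ hπ' e he => h _ _ _ (hπ.trans hπ') e he

theorem Pr2.ext {π : β' → β} (hπ : Ext Γ Γ' π) {p : β → ℕ → ℕ → Prop} (h : Pr2 Γ p) :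
    Pr2 Γ' fun b => p (π b) := fun _ _ _ hπ' e he => h _ _ _ (hπ.trans hπ') e he

theorem PolyBdd.of_le {f g : β → ℕ} (hg : PolyBdd Γ g) (h : ∀ b s, Γ.I b s → f b ≤ g b) :
    PolyBdd Γ f :=
  let ⟨c, hc⟩ := hg
  ⟨c, fun b s hb => (h b s hb).trans (hc b s hb)⟩

theorem PolyBdd.const (a : ℕ) : PolyBdd Γ fun _ => a :=
  ⟨a, fun _ _ _ => const_le_pow (Nat.le_add_left 2 _) a⟩

theorem PolyBdd.measure : PolyBdd Γ Γ.N := ⟨1, fun b _ _ => by rw [pow_one]; omega⟩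

theorem PolyBdd.add {f g : β → ℕ} (hf : PolyBdd Γ f) (hg : PolyBdd Γ g) :
    PolyBdd Γ fun b => f b + g b :=
  let ⟨c, hc⟩ := hf
  let ⟨d, hd⟩ := hg
  ⟨c + d + 1, fun b s hb => add_le_pow (Nat.le_add_left 2 _) (hc b s hb) (hd b s hb)⟩

theorem PolyBdd.mul {f g : β → ℕ} (hf : PolyBdd Γ f) (hg : PolyBdd Γ g) :
    PolyBdd Γ fun b => f b * g b :=
  let ⟨c, hc⟩ := hf
  let ⟨d, hd⟩ := hg
  ⟨c + d, fun b s hb => mul_le_pow (hc b s hb) (hd b s hb)⟩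

theorem Ev.congr {f g : β → ℕ} (hf : Ev Γ f) (h : ∀ b s, Γ.I b s → f b = g b) : Ev Γ g := by
  intro m hm
  obtain ⟨P, c, hP⟩ := hf m hm
  refine ⟨P, c, fun b s hb => ?_⟩
  rw [← h b s hb]
  exact hP b s hb

theorem EvP.congr {p q : β → Prop} (hp : EvP Γ p) (h : ∀ b s, Γ.I b s → (p b ↔ q b)) : EvP Γ q :=
  by
  classical exact Ev.congr hp fun b s hb => if_congr (h b s hb) rfl rfl

theorem Ev.const (a : ℕ) : Ev Γ fun _ => a := fun m _ =>
  ⟨.const m a, 0, fun b s _ => ⟨_, Run.const m a s, rfl,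
    fun x hx => setReg_reg_of_ne _ _ (by omega), setReg_reg_self ..⟩⟩

theorem Ev.reg {f : β → ℕ} (j : ℕ) (hj : j < Γ.m) (h : ∀ b s, Γ.I b s → s.reg j = f b) :
    Ev Γ f := fun m hm =>
  ⟨.seq (.const m 0) (.add m j m), 1, fun b s hb =>
    ⟨_, ((Run.const m 0 s).seq (Run.add m j m _)).mono (by rw [pow_one]; omega), rfl,
      fun x hx => by
        rw [setReg_reg_of_ne _ _ (by omega), setReg_reg_of_ne _ _ (by omega)], by
        rw [setReg_reg_self, setReg_reg_self, setReg_reg_of_ne _ _ (by omega), h b s hb, add_zero]⟩⟩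

theorem Ev.var (r : ℕ) (Q : β → ℕ → Prop) : Ev (Γ.push r Q) fun p => p.2 :=
  Ev.reg r (by simp [Ctx.push]) fun _ _ h => h.2.1

/-- An instruction with one operand, applied to the value of an expression. -/
theorem Ev.unary {f g : β → ℕ} (hf : Ev Γ f) (instr : ℕ → Program)
    (h : ∀ m b s, Γ.I b s → s.reg m = f b → Run (instr m) s (s.setReg m (g b)) 1) : Ev Γ g := by
  intro m hm
  obtain ⟨P, c, hP⟩ := hf m hm
  refine ⟨.seq P (instr m), c + 0 + 1, fun b s hb => ?_⟩
  obtain ⟨s', hrun, hmem, hreg, hval⟩ := hP b s hb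
  have hb' := Γ.stable b s s' hb hmem fun x hx => hreg x (by omega)
  refine ⟨_, (hrun.seq (h m b s' hb' hval)).mono
    (add_le_pow (Nat.le_add_left 2 _) le_rfl (pow_zero _).ge), hmem, fun x hx => ?_,
    setReg_reg_self ..⟩
  rw [setReg_reg_of_ne _ _ (by omega), hreg x hx]

/-- An instruction with two operands, applied to the values of two expressions. -/
theorem Ev.binary {f g h : β → ℕ} (hf : Ev Γ f) (hg : Ev Γ g) (instr : ℕ → Program)
    (H : ∀ m b s, s.reg m = f b → s.reg (m + 1) = g b → Run (instr m) s (s.setReg m (h b)) 1) :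
    Ev Γ h := by
  intro m hm
  obtain ⟨P, c, hP⟩ := hf m hm
  obtain ⟨Q, d, hQ⟩ := hg (m + 1) (by omega)
  refine ⟨.seq P (.seq Q (instr m)), c + (d + 0 + 1) + 1, fun b s hb => ?_⟩
  obtain ⟨s₁, hrun, hmem, hreg, hval⟩ := hP b s hb
  obtain ⟨s₂, hrun', hmem', hreg', hval'⟩ := hQ b s₁
    (Γ.stable b s s₁ hb hmem fun x hx => hreg x (by omega))
  refine ⟨_, (hrun.seq (hrun'.seq (H m b s₂ ?_ hval'))).mono
    (add_le_pow (Nat.le_add_left 2 _) le_rfl (add_le_pow (Nat.le_add_left 2 _) le_rfl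
      (pow_zero _).ge)), hmem'.trans hmem, fun x hx => ?_, setReg_reg_self ..⟩
  · rw [hreg' m (by omega), hval]
  · rw [setReg_reg_of_ne _ _ (by omega), hreg' x (by omega), hreg x hx]

theorem Ev.add {f g : β → ℕ} (hf : Ev Γ f) (hg : Ev Γ g) : Ev Γ fun b => f b + g b :=
  Ev.binary hf hg (fun m => .add m m (m + 1)) fun m b s h1 h2 => by
    rw [← h1, ← h2]; exact Run.add ..

theorem Ev.sub {f g : β → ℕ} (hf : Ev Γ f) (hg : Ev Γ g) : Ev Γ fun b => f b - g b :=
  Ev.binary hf hg (fun m => .sub m m (m + 1)) fun m b s h1 h2 => by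
    rw [← h1, ← h2]; exact Run.sub ..

theorem Ev.load {f g : β → ℕ} (hf : Ev Γ f) (h : ∀ b s, Γ.I b s → s.mem (f b) = g b) : Ev Γ g :=
  hf.unary (fun m => .load m m) fun m b s hb h1 => by
    rw [← h b s hb, ← h1]; exact Run.load ..

theorem Ev.itePos {f g h : β → ℕ} (hf : Ev Γ f) (hg : Ev (Γ.restrict fun b => 0 < f b) g)
    (hh : Ev (Γ.restrict fun b => ¬ 0 < f b) h) :
    Ev Γ fun b => if 0 < f b then g b else h b := by
  intro m hm
  obtain ⟨P, c, hP⟩ := hf m hm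
  obtain ⟨Q, d, hQ⟩ := hg m hm
  obtain ⟨R, e, hR⟩ := hh m hm
  refine ⟨.seq P (.ifPos m Q R), c + ((d + e + 1) + 1) + 1, fun b s hb => ?_⟩
  obtain ⟨s₁, hrun, hmem, hreg, hval⟩ := hP b s hb
  have hb₁ := Γ.stable b s s₁ hb hmem fun x hx => hreg x (by omega)
  have hde : ∀ x, x ≤ (Γ.N b + 2) ^ d ∨ x ≤ (Γ.N b + 2) ^ e → x ≤ (Γ.N b + 2) ^ (d + e + 1) := by
    intro x hx
    have := add_le_pow (a := Γ.N b + 2) (by omega) (le_refl ((Γ.N b + 2) ^ d))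
      (le_refl ((Γ.N b + 2) ^ e))
    omega
  by_cases hpos : 0 < f b
  · obtain ⟨s₂, hrun', hmem', hreg', hval'⟩ := hQ b s₁ ⟨hb₁, hpos⟩
    refine ⟨s₂, (hrun.seq
      (Run.ifPos (fun _ => hrun'.mono (hde _ (Or.inl le_rfl))) fun h0 => ?_)).mono
      (add_le_pow (Nat.le_add_left 2 _) le_rfl (succ_le_pow (Nat.le_add_left 2 _) le_rfl)),
      hmem'.trans hmem, fun x hx => (hreg' x hx).trans (hreg x hx),
      hval'.trans (if_pos hpos).symm⟩
    omega
  · obtain ⟨s₂, hrun', hmem', hreg', hval'⟩ := hR b s₁ ⟨hb₁, hpos⟩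
    refine ⟨s₂, (hrun.seq
      (Run.ifPos (fun h0 => ?_) fun _ => hrun'.mono (hde _ (Or.inr le_rfl)))).mono
      (add_le_pow (Nat.le_add_left 2 _) le_rfl (succ_le_pow (Nat.le_add_left 2 _) le_rfl)),
      hmem'.trans hmem, fun x hx => (hreg' x hx).trans (hreg x hx),
      hval'.trans (if_neg hpos).symm⟩
    omega

/-- The end of a round of a loop: the index in register `m` is increased, the accumulator in
register `m + 1` is updated, and the number of remaining rounds in register `m + 2` is decreased. -/
theorem run_endRound (m : ℕ) (s : MachineState) :
    ∃ s', Run (.seq (.const (m + 4) 0) (.seq (.add (m + 1) (m + 3) (m + 4))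
      (.seq (.const (m + 4) 1) (.seq (.add m m (m + 4)) (.sub (m + 2) (m + 2) (m + 4)))))) s s' 6 ∧
      s'.mem = s.mem ∧ (∀ x < m, s'.reg x = s.reg x) ∧ s'.reg m = s.reg m + 1 ∧
      s'.reg (m + 1) = s.reg (m + 3) ∧ s'.reg (m + 2) = s.reg (m + 2) - 1 := by
  refine ⟨_, ((Run.const (m + 4) 0 _).seq ((Run.add (m + 1) (m + 3) (m + 4) _).seq
    ((Run.const (m + 4) 1 _).seq ((Run.add m m (m + 4) _).seq
      (Run.sub (m + 2) (m + 2) (m + 4) _))))).mono (by omega), rfl, fun x hx => ?_, ?_, ?_, ?_⟩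
  · rw [setReg_reg_of_ne _ _ (by omega), setReg_reg_of_ne _ _ (by omega),
      setReg_reg_of_ne _ _ (by omega), setReg_reg_of_ne _ _ (by omega),
      setReg_reg_of_ne _ _ (by omega)]
  all_goals simp [MachineState.setReg]

/-- Bounded recursion: the value of `acc ↦ step b i acc`, iterated for `i = 0, 1, …, cnt b - 1`. -/
theorem Ev.fold {cnt init : β → ℕ} {step : β → ℕ → ℕ → ℕ} (hcnt : Ev Γ cnt) (hbd : PolyBdd Γ cnt)
    (hinit : Ev Γ init)
    (hstep : ∀ r, Γ.m ≤ r → Ev ((Γ.push r fun b i => i < cnt b).push (r + 1) fun _ _ => True)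
      fun p => step p.1.1 p.1.2 p.2) :
    Ev Γ fun b => Nat.rec (init b) (fun i acc => step b i acc) (cnt b) := by
  intro m hm
  obtain ⟨P, c₁, hP⟩ := hinit (m + 1) (by omega)
  obtain ⟨Q, c₂, hQ⟩ := hcnt (m + 2) (by omega)
  obtain ⟨R, c₃, hR⟩ := hstep m hm (m + 3) (by simp only [Ctx.push]; omega)
  obtain ⟨c₄, hbd⟩ := hbd
  -- registers: `m` the index, `m + 1` the accumulator, `m + 2` the number of remaining rounds
  let body : Program := .seq R (.seq (.const (m + 4) 0) (.seq (.add (m + 1) (m + 3) (m + 4))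
    (.seq (.const (m + 4) 1) (.seq (.add m m (m + 4)) (.sub (m + 2) (m + 2) (m + 4))))))
  refine ⟨.seq (.const m 0) (.seq P (.seq Q (.seq (.whilePos (m + 2) body)
    (.add m (m + 1) (m + 2))))),
    0 + (c₁ + (c₂ + (c₄ + (c₃ + 6 + 1 + 1) + 1 + 1) + 1) + 1) + 1, fun b s hb => ?_⟩
  have hst : ∀ s' : MachineState, s'.mem = s.mem → (∀ x < m, s'.reg x = s.reg x) → Γ.I b s' :=
    fun s' h1 h2 => Γ.stable b s s' hb h1 fun x hx => h2 x (by omega)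
  obtain ⟨s₂, hrun₂, hmem₂, hreg₂, hval₂⟩ := hP b (s.setReg m 0)
    (hst _ rfl fun x hx => setReg_reg_of_ne _ _ (by omega))
  have hreg₂' : ∀ x < m, s₂.reg x = s.reg x := fun x hx => by
    rw [hreg₂ x (by omega), setReg_reg_of_ne _ _ (by omega)]
  obtain ⟨s₃, hrun₃, hmem₃, hreg₃, hval₃⟩ := hQ b s₂ (hst _ hmem₂ hreg₂')
  let val : ℕ → ℕ := fun j => Nat.rec (init b) (fun i acc => step b i acc) j
  let J : ℕ → MachineState → Prop := fun j s' => s'.mem = s.mem ∧ (∀ x < m, s'.reg x = s.reg x) ∧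
    s'.reg m = j ∧ s'.reg (m + 1) = val j ∧ s'.reg (m + 2) = cnt b - j ∧ j ≤ cnt b
  obtain ⟨j, s₄, hrun₄, ⟨hJ1, hJ2, hJ3, hJ4, hJ5, hJ6⟩, h0⟩ := Run.whilePos (x := m + 2)
    (P := body) J (cnt b) ((Γ.N b + 2) ^ (c₃ + 6 + 1)) (by
      rintro j s' ⟨h1, h2, h3, h4, h5, h6⟩ hpos
      have hj : j < cnt b := by omega
      refine ⟨hj, ?_⟩
      obtain ⟨s'', hr, hm', hreg', hval'⟩ := hR ((b, j), val j) s'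
        ⟨⟨hst s' h1 h2, h3, hj⟩, h4, trivial⟩
      obtain ⟨s₅, hr₅, hm₅, hreg₅, h₅, h₅', h₅''⟩ := run_endRound m s''
      refine ⟨s₅, (hr.seq hr₅).mono (add_le_pow (Nat.le_add_left 2 _) le_rfl
        (const_le_pow (Nat.le_add_left 2 _) 6)), (hm₅.trans hm').trans h1,
        fun x hx => ?_, ?_, ?_, ?_, hj⟩
      · rw [hreg₅ x hx, hreg' x (by omega), h2 x hx]
      · rw [h₅, hreg' m (by omega), h3]
      · rw [h₅', hval']
      · rw [h₅'', hreg' (m + 2) (by omega), h5, Nat.sub_sub]) s₃ (by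
      refine ⟨hmem₃.trans hmem₂, fun x hx => (hreg₃ x (by omega)).trans (hreg₂' x hx), ?_, ?_, ?_,
        Nat.zero_le _⟩
      · rw [hreg₃ m (by omega), hreg₂ m (by omega), setReg_reg_self]
      · exact (hreg₃ (m + 1) (by omega)).trans hval₂
      · rw [hval₃, Nat.sub_zero])
  obtain rfl : j = cnt b := by omega
  have hloop : cnt b * ((Γ.N b + 2) ^ (c₃ + 6 + 1) + 1) + 1 ≤
      (Γ.N b + 2) ^ (c₄ + (c₃ + 6 + 1 + 1) + 1) :=
    succ_le_pow (Nat.le_add_left 2 _)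
      (mul_le_pow (hbd b s hb) (succ_le_pow (Nat.le_add_left 2 _) le_rfl))
  refine ⟨_, ((Run.const m 0 s).seq (hrun₂.seq (hrun₃.seq ((hrun₄.mono hloop).seq
    (Run.add m (m + 1) (m + 2) _))))).mono (add_le_pow (Nat.le_add_left 2 _) (pow_zero _).ge
      (add_le_pow (Nat.le_add_left 2 _) le_rfl (add_le_pow (Nat.le_add_left 2 _) le_rfl
        (succ_le_pow (Nat.le_add_left 2 _) le_rfl)))), hJ1, fun x hx => ?_, ?_⟩
  · rw [setReg_reg_of_ne _ _ (by omega), hJ2 x hx]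
  · rw [setReg_reg_self, hJ4, h0, add_zero]

end Ev

end DiFPT

namespace DiFPT

/-! ### Logical connectives, bounded search and arithmetic on the machine -/

/-- `Pr1` for arguments that are known to be smaller than `cnt`. -/
def Pr1Below {β : Type} (Γ : Ctx β) (cnt : β → ℕ) (p : β → ℕ → Prop) : Prop :=
  ∀ (β' : Type) (Γ' : Ctx β') (π : β' → β), Ext Γ Γ' π → ∀ x : β' → ℕ, Ev Γ' x →
    (∀ b s, Γ'.I b s → x b < cnt (π b)) → EvP Γ' fun b => p (π b) (x b)

open Classical in
/-- The least number below `m` with the property `p`, and `m` if there is none. -/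
noncomputable def firstBelow (p : ℕ → Prop) (m : ℕ) : ℕ :=
  Nat.rec 0 (fun i acc => if acc = i ∧ ¬ p i then i + 1 else acc) m

open Classical in
theorem firstBelow_spec (p : ℕ → Prop) (m : ℕ) : firstBelow p m ≤ m ∧
    (∀ j < firstBelow p m, ¬ p j) ∧ (firstBelow p m < m → p (firstBelow p m)) := by
  induction m with
  | zero =>
    exact ⟨le_rfl, fun j hj => absurd hj (Nat.not_lt_zero j), fun h => absurd h (lt_irrefl 0)⟩
  | succ m ih =>
    obtain ⟨h1, h2, h3⟩ := ih
    have hs : firstBelow p (m + 1) =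
      if firstBelow p m = m ∧ ¬ p m then m + 1 else firstBelow p m := rfl
    by_cases h : firstBelow p m = m ∧ ¬ p m
    · rw [hs, if_pos h]
      refine ⟨le_rfl, fun j hj => ?_, fun h => absurd h (lt_irrefl _)⟩
      rcases Nat.lt_succ_iff_lt_or_eq.1 hj with hj | rfl
      · exact h2 j (by omega)
      · exact h.2
    · rw [hs, if_neg h]
      refine ⟨by omega, h2, fun _ => ?_⟩
      rcases h1.lt_or_eq with h4 | h4
      · exact h3 h4
      · by_contra h5
        exact h ⟨h4, h4 ▸ h5⟩

theorem firstBelow_lt_iff {p : ℕ → Prop} {m : ℕ} : firstBelow p m < m ↔ ∃ i < m, p i := by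
  obtain ⟨h1, h2, h3⟩ := firstBelow_spec p m
  refine ⟨fun h => ⟨_, h, h3 h⟩, fun ⟨i, hi, hp⟩ => ?_⟩
  by_contra h
  exact h2 i (by omega) hp

theorem firstBelow_eq {p : ℕ → Prop} {m q : ℕ} (hq : q ≤ m) (h : ∀ j < q, ¬ p j)
    (h' : q < m → p q) : firstBelow p m = q := by
  obtain ⟨h1, h2, h3⟩ := firstBelow_spec p m
  rcases lt_trichotomy (firstBelow p m) q with h4 | h4 | h4
  · exact absurd (h3 (by omega)) (h _ h4)
  · exact h4
  · exact absurd (h' (by omega)) (h2 _ h4)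

section Closure

variable {β β' : Type} {Γ : Ctx β} {Γ' : Ctx β'} {p q : β → Prop} {f g cnt : β → ℕ}

theorem EvP.pos (hf : Ev Γ f) : EvP Γ fun b => 0 < f b :=
  (hf.itePos (.const 1) (.const 0)).congr fun b _ _ => by congr

open Classical in
/-- A definition by cases in which each case is evaluated only if it applies. -/
theorem Ev.iteOf (hp : EvP Γ p) (hf : Ev (Γ.restrict p) f) (hg : Ev (Γ.restrict fun b => ¬ p b) g) :
    Ev Γ fun b => if p b then f b else g b := by
  have h : ∀ b, (0 < if p b then 1 else 0) ↔ p b := fun b => by by_cases h : p b <;> simp [h]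
  have h' := Ev.itePos (f := fun b => if p b then 1 else 0) (g := f) (h := g) hp
  simp only [h] at h'
  exact h' hf hg

open Classical in
theorem Ev.ite (hp : EvP Γ p) (hf : Ev Γ f) (hg : Ev Γ g) :
    Ev Γ fun b => if p b then f b else g b :=
  Ev.iteOf hp (hf.ext (Ext.restrict ..)) (hg.ext (Ext.restrict ..))

theorem EvP.of_const (c : Prop) : EvP Γ fun _ => c := by
  by_cases h : c
  · exact (Ev.const 1).congr fun b _ _ => (if_pos h).symm
  · exact (Ev.const 0).congr fun b _ _ => (if_neg h).symm

theorem EvP.not (hp : EvP Γ p) : EvP Γ fun b => ¬ p b :=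
  (Ev.ite hp (.const 0) (.const 1)).congr fun b _ _ => by by_cases h : p b <;> simp [h]

/-- A conjunction whose second part is evaluated only if the first one holds. -/
theorem EvP.andOf (hp : EvP Γ p) (hq : EvP (Γ.restrict p) q) : EvP Γ fun b => p b ∧ q b := by
  classical
  exact (Ev.iteOf hp hq (.const 0)).congr fun b _ _ => by
    by_cases h : p b <;> by_cases h' : q b <;> simp [h, h']

theorem EvP.and (hp : EvP Γ p) (hq : EvP Γ q) : EvP Γ fun b => p b ∧ q b :=
  hp.andOf (hq.ext (Ext.restrict ..))

theorem EvP.or (hp : EvP Γ p) (hq : EvP Γ q) : EvP Γ fun b => p b ∨ q b :=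
  by
  classical
  exact (Ev.ite hp (.const 1) hq).congr fun b _ _ => by
    by_cases h : p b <;> by_cases h' : q b <;> simp [h, h']

theorem EvP.imp (hp : EvP Γ p) (hq : EvP Γ q) : EvP Γ fun b => p b → q b :=
  (hp.not.or hq).congr fun _ _ _ => imp_iff_not_or.symm

theorem EvP.iff (hp : EvP Γ p) (hq : EvP Γ q) : EvP Γ fun b => p b ↔ q b :=
  ((hp.imp hq).and (hq.imp hp)).congr fun _ _ _ => iff_def.symm

theorem EvP.lt (hf : Ev Γ f) (hg : Ev Γ g) : EvP Γ fun b => f b < g b :=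
  (EvP.pos (hg.sub hf)).congr fun _ _ _ => Nat.sub_pos_iff_lt

theorem EvP.le (hf : Ev Γ f) (hg : Ev Γ g) : EvP Γ fun b => f b ≤ g b :=
  (EvP.lt hg hf).not.congr fun _ _ _ => not_lt

theorem EvP.eq (hf : Ev Γ f) (hg : Ev Γ g) : EvP Γ fun b => f b = g b :=
  ((EvP.le hf hg).and (EvP.le hg hf)).congr fun _ _ _ => le_antisymm_iff.symm

theorem Pr1.below {p : β → ℕ → Prop} (hp : Pr1 Γ p) : Pr1Below Γ cnt p :=
  fun _ _ _ hπ _ hx _ => hp _ _ _ hπ _ hx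

theorem Pr2.of {p : β → ℕ → ℕ → Prop} (hp : Pr2 Γ p) {e e' : β → ℕ} (he : Ev Γ e) (he' : Ev Γ e') :
    EvP Γ fun b => p b (e b) (e' b) := hp _ _ _ (Ext.refl Γ) e e' he he'

/-- Bounded recursion, with a step that can be computed wherever the data, the index and the
accumulator are available. -/
theorem Ev.recursion {init : β → ℕ} {step : β → ℕ → ℕ → ℕ} (hcnt : Ev Γ cnt) (hbd : PolyBdd Γ cnt)
    (hinit : Ev Γ init)
    (hstep : ∀ (β' : Type) (Γ' : Ctx β') (π : β' → β), Ext Γ Γ' π → ∀ i acc : β' → ℕ, Ev Γ' i →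
      Ev Γ' acc → (∀ b s, Γ'.I b s → i b < cnt (π b)) → Ev Γ' fun b => step (π b) (i b) (acc b)) :
    Ev Γ fun b => Nat.rec (init b) (fun i acc => step b i acc) (cnt b) :=
  hcnt.fold hbd hinit fun r _ => hstep _ ((Γ.push r fun b i => i < cnt b).push (r + 1)
    fun _ _ => True) (fun p => p.1.1) (((Ext.refl Γ).push r _).push _ _)
    (fun p => p.1.2) (fun p => p.2) ((Ev.var r _).ext ((Ext.refl _).push _ _)) (Ev.var _ _)
    fun _ _ h => h.1.2.2

theorem Ev.firstBelow {p : β → ℕ → Prop} (hcnt : Ev Γ cnt) (hbd : PolyBdd Γ cnt)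
    (hp : Pr1Below Γ cnt p) : Ev Γ fun b => firstBelow (p b) (cnt b) := by
  classical
  exact Ev.recursion (init := fun _ => 0)
    (step := fun b i acc => if acc = i ∧ ¬ p b i then i + 1 else acc) hcnt hbd (.const 0)
    fun _ _ π hπ i acc hi hacc hlt =>
      (Ev.ite ((EvP.eq hacc hi).and (hp _ _ _ hπ i hi hlt).not) (hi.add (.const 1)) hacc).congr
        fun _ _ _ => by congr

theorem EvP.ex {p : β → ℕ → Prop} (hcnt : Ev Γ cnt) (hbd : PolyBdd Γ cnt)
    (hp : Pr1Below Γ cnt p) : EvP Γ fun b => ∃ i < cnt b, p b i :=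
  (EvP.lt (Ev.firstBelow hcnt hbd hp) hcnt).congr fun _ _ _ => firstBelow_lt_iff

theorem EvP.all {p : β → ℕ → Prop} (hcnt : Ev Γ cnt) (hbd : PolyBdd Γ cnt)
    (hp : Pr1Below Γ cnt p) : EvP Γ fun b => ∀ i < cnt b, p b i :=
  (EvP.ex (p := fun b i => ¬ p b i) hcnt hbd fun _ _ _ hπ x hx hlt =>
    (hp _ _ _ hπ x hx hlt).not).not.congr fun _ _ _ => by
      simp only [not_exists, not_and, not_not]

open Classical in
theorem Ev.count {p : β → ℕ → Prop} (hcnt : Ev Γ cnt) (hbd : PolyBdd Γ cnt)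
    (hp : Pr1Below Γ cnt p) : Ev Γ fun b => Nat.count (p b) (cnt b) := by
  refine (Ev.recursion (init := fun _ => 0) (step := fun b i acc => acc + if p b i then 1 else 0)
    hcnt hbd (.const 0) fun _ _ π hπ i acc hi hacc hlt => hacc.add (hp _ _ _ hπ i hi hlt)).congr
    fun b _ _ => ?_
  induction cnt b with
  | zero => rfl
  | succ m ih =>
    rw [Nat.count_succ, ← ih]

theorem Ev.mul (hf : Ev Γ f) (hg : Ev Γ g) (hbd : PolyBdd Γ g) : Ev Γ fun b => f b * g b := by
  refine (Ev.recursion (init := fun _ => 0) (step := fun b _ acc => acc + f b) hg hbd (.const 0)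
    fun _ _ π hπ i acc _ hacc _ => hacc.add (hf.ext hπ)).congr fun b _ _ => ?_
  induction g b with
  | zero => rfl
  | succ m ih => rw [Nat.mul_succ, ← ih]

theorem Ev.pow (hf : Ev Γ f) (hg : Ev Γ g) (hfb : PolyBdd Γ f) (hgb : PolyBdd Γ g) :
    Ev Γ fun b => f b ^ g b := by
  refine (Ev.recursion (init := fun _ => 1) (step := fun b _ acc => acc * f b) hg hgb (.const 1)
    fun _ _ π hπ i acc _ hacc _ => hacc.mul (hf.ext hπ) (hfb.ext hπ)).congr fun b _ _ => ?_
  induction g b with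
  | zero => rfl
  | succ m ih => rw [Nat.pow_succ, ← ih]

theorem Ev.div (hf : Ev Γ f) (hg : Ev Γ g) (hfb : PolyBdd Γ f) : Ev Γ fun b => f b / g b := by
  classical
  refine (Ev.ite (EvP.eq hg (.const 0)) (.const 0) (Ev.firstBelow
    (p := fun b q => f b < g b * (q + 1)) hf hfb fun _ _ π hπ x hx hlt => EvP.lt (hf.ext hπ)
      ((hg.ext hπ).mul (hx.add (.const 1)) (PolyBdd.of_le (hfb.ext hπ) fun b s hb =>
        hlt b s hb)))).congr fun b _ _ => ?_
  by_cases h0 : g b = 0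
  · rw [if_pos h0, h0, Nat.div_zero]
  · rw [if_neg h0]
    have hpos : 0 < g b := Nat.pos_of_ne_zero h0
    refine firstBelow_eq (Nat.div_le_self _ _) (fun j hj => ?_) fun _ => Nat.lt_mul_div_succ _ hpos
    rw [not_lt, mul_comm]
    exact (Nat.le_div_iff_mul_le hpos).1 hj

theorem Ev.mod (hf : Ev Γ f) (hg : Ev Γ g) (hfb : PolyBdd Γ f) : Ev Γ fun b => f b % g b :=
  (hf.sub (hg.mul (hf.div hg hfb) (hfb.of_le fun _ _ _ => Nat.div_le_self _ _))).congr
    fun b _ _ => by have := Nat.mod_add_div (f b) (g b); omega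

/-- Whether there is a small set of vertices that hits the members of a class can be decided in time
polynomial in the number of partitions of this class into `k` parts. -/
theorem EvP.coverable {n k len : β → ℕ} {hit : β → ℕ → ℕ → Prop} {cls hitT : β → ℕ → Prop}
    (hn : Ev Γ n) (hnb : PolyBdd Γ n) (hk : Ev Γ k) (hkb : PolyBdd Γ k) (hlen : Ev Γ len)
    (hlenb : PolyBdd Γ len) (hhit : Pr2 Γ hit) (hcls : Pr1 Γ cls) (hhitT : Pr1 Γ hitT)
    (hbd : ∀ inst : ∀ b, DecidablePred (cls b),
      PolyBdd Γ fun b => k b ^ @Nat.count (cls b) (inst b) (len b)) :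
    EvP Γ fun b => Coverable (n b) (k b) (len b) (hit b) (cls b) (hitT b) := by
  classical
  have hcount : Ev Γ fun b => Nat.count (cls b) (len b) := Ev.count hlen hlenb hcls.below
  have hcountb : PolyBdd Γ fun b => Nat.count (cls b) (len b) :=
    hlenb.of_le fun _ _ _ => Nat.count_le _
  refine EvP.ex (hk.pow hcount hkb hcountb) (hbd _) ?_
  intro β₁ Γ₁ π₁ hπ₁ e he he'
  have heb : PolyBdd Γ₁ e := PolyBdd.of_le ((hbd _).ext hπ₁) fun b s hb => (he' b s hb).le
  refine EvP.all (hk.ext hπ₁) (hkb.ext hπ₁) ?_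
  intro β₂ Γ₂ π₂ hπ₂ c hc hc'
  -- the digit of `e` that belongs to the member `r` of the class is the part that contains `r`
  have digit : ∀ (β' : Type) (Γ' : Ctx β') (π : β' → β₂), Ext Γ₂ Γ' π → ∀ r : β' → ℕ, Ev Γ' r →
      (∀ b s, Γ'.I b s → r b < len (π₁ (π₂ (π b)))) → EvP Γ' fun b =>
        e (π₂ (π b)) / k (π₁ (π₂ (π b))) ^ Nat.count (cls (π₁ (π₂ (π b)))) (r b) %
          k (π₁ (π₂ (π b))) = c (π b) := by
    intro β' Γ' π hπ r hr hlt
    have h₁ := hπ₁.trans (hπ₂.trans hπ)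
    have hrb : PolyBdd Γ' r := PolyBdd.of_le (hlenb.ext h₁) fun b s hb => (hlt b s hb).le
    have he₂ := he.ext (hπ₂.trans hπ)
    have heb₂ := heb.ext (hπ₂.trans hπ)
    have hcnt : Ev Γ' fun b => Nat.count (cls (π₁ (π₂ (π b)))) (r b) :=
      Ev.count hr hrb (hcls.ext h₁).below
    exact EvP.eq (((he₂.div ((hk.ext h₁).pow hcnt (hkb.ext h₁)
      (hrb.of_le fun _ _ _ => Nat.count_le _)) heb₂)).mod (hk.ext h₁)
        (heb₂.of_le fun _ _ _ => Nat.div_le_self _ _)) (hc.ext hπ)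
  have h₂ := hπ₁.trans hπ₂
  refine EvP.or (EvP.all (hlen.ext h₂) (hlenb.ext h₂) ?_) (EvP.ex (hn.ext h₂) (hnb.ext h₂) ?_)
  · intro β₃ Γ₃ π₃ hπ₃ r hr hr'
    exact (hcls _ _ _ (h₂.trans hπ₃) r hr).imp (digit _ _ _ hπ₃ r hr hr').not
  · intro β₃ Γ₃ π₃ hπ₃ x hx hx'
    refine (hhitT _ _ _ (h₂.trans hπ₃) x hx).not.and ?_
    refine EvP.all (hlen.ext (h₂.trans hπ₃)) (hlenb.ext (h₂.trans hπ₃)) ?_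
    intro β₄ Γ₄ π₄ hπ₄ r hr hr'
    exact (hcls _ _ _ (h₂.trans (hπ₃.trans hπ₄)) r hr).imp
      ((digit _ _ _ (hπ₃.trans hπ₄) r hr hr').imp
        (hhit _ _ _ (h₂.trans (hπ₃.trans hπ₄)) _ r (hx.ext hπ₄) hr))

end Closure

end DiFPT

namespace DiFPT

/-! ### Partial solutions on the machine -/

/-- The list `t b` can be read: its length and its entries can be computed. -/
structure EvList {β : Type} (Γ : Ctx β) (t : β → List ℕ) : Prop where
  length : Ev Γ fun b => (t b).length
  bounded : PolyBdd Γ fun b => (t b).length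
  entry : Fn1 Γ fun b c => (t b).getD c 0

/-- The constraints `C b` can be checked. -/
structure EvConstraints {β : Type} (Γ : Ctx β) (C : β → Constraints) : Prop where
  valid : Pr1 Γ fun b => (C b).valid
  att : Pr2 Γ fun b => (C b).att
  conf : Pr2 Γ fun b => (C b).conf
  dom : Pr2 Γ fun b => (C b).dom

section Lists

variable {β β' : Type} {Γ : Ctx β} {Γ' : Ctx β'} {C : β → Constraints} {r s t B : β → List ℕ}
  {x n k len : β → ℕ}

theorem EvList.ext {π : β' → β} (hπ : Ext Γ Γ' π) (h : EvList Γ t) : EvList Γ' fun b => t (π b) :=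
  ⟨h.length.ext hπ, h.bounded.ext hπ, h.entry.ext hπ⟩

theorem EvList.getD (h : EvList Γ t) (hx : Ev Γ x) : Ev Γ fun b => (t b).getD (x b) 0 :=
  h.entry _ _ _ (Ext.refl Γ) x hx

theorem EvConstraints.ext {π : β' → β} (hπ : Ext Γ Γ' π) (h : EvConstraints Γ C) :
    EvConstraints Γ' fun b => C (π b) :=
  ⟨h.valid.ext hπ, h.att.ext hπ, h.conf.ext hπ, h.dom.ext hπ⟩

theorem EvList.append (hs : EvList Γ s) (ht : EvList Γ t) : EvList Γ fun b => s b ++ t b := by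
  refine ⟨(hs.length.add ht.length).congr fun _ _ _ => List.length_append.symm,
    (hs.bounded.add ht.bounded).of_le fun _ _ _ => List.length_append.le, ?_⟩
  intro β₁ Γ₁ π₁ h₁ c hc
  classical
  refine (Ev.ite (EvP.lt hc (hs.length.ext h₁)) ((hs.ext h₁).getD hc)
    ((ht.ext h₁).getD (hc.sub (hs.length.ext h₁)))).congr fun b _ _ => ?_
  split_ifs with h
  · exact (List.getD_append _ _ _ _ h).symm
  · exact (List.getD_append_right _ _ _ _ (by omega)).symm

theorem EvP.listDom (hC : EvConstraints Γ C) (ht : EvList Γ t) (hx : Ev Γ x) :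
    EvP Γ fun b => (C b).ListDom (t b) (x b) :=
  EvP.ex ht.length ht.bounded fun _ _ _ h₁ _ hc _ =>
    (hC.ext h₁).dom.of ((ht.ext h₁).getD hc) (hx.ext h₁)

theorem EvP.hits (hC : EvConstraints Γ C) (ht : EvList Γ t) (hx : Ev Γ x) :
    EvP Γ fun b => (C b).Hits (x b) (t b) :=
  EvP.ex ht.length ht.bounded fun _ _ _ h₁ _ hc _ =>
    (EvP.pos hc).and ((hC.ext h₁).conf.of (hx.ext h₁) ((ht.ext h₁).getD hc))

theorem EvP.alike (hC : EvConstraints Γ C) (hB : EvList Γ B) (hr : EvList Γ r) (ht : EvList Γ t) :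
    EvP Γ fun b => (C b).Alike (B b) (r b) (t b) :=
  (EvP.eq hr.length ht.length).and ((EvP.eq (hr.getD (.const 0)) (ht.getD (.const 0))).and
    (EvP.all hB.length hB.bounded fun _ _ _ h₁ _ hc _ =>
      (EvP.listDom (hC.ext h₁) (hr.ext h₁) ((hB.ext h₁).getD hc)).iff
        (EvP.listDom (hC.ext h₁) (ht.ext h₁) ((hB.ext h₁).getD hc))))

theorem EvP.cross (hC : EvConstraints Γ C) (hs : EvList Γ s) (ht : EvList Γ t) :
    EvP Γ fun b => (C b).Cross (s b) (t b) :=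
  EvP.all hs.length hs.bounded fun _ _ _ h₁ _ hi _ =>
    EvP.all (ht.length.ext h₁) (ht.bounded.ext h₁) fun _ _ _ h₂ _ hj _ =>
      ((EvP.pos (hi.ext h₂)).or (EvP.pos hj)).imp
        ((hC.ext (h₁.trans h₂)).conf.of ((hs.ext (h₁.trans h₂)).getD (hi.ext h₂))
          ((ht.ext (h₁.trans h₂)).getD hj)).not

theorem EvP.joinable (hC : EvConstraints Γ C) (hk : Ev Γ k) (hs : EvList Γ s) (ht : EvList Γ t) :
    EvP Γ fun b => (C b).Joinable (k b) (s b) (t b) :=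
  (EvP.pos hs.length).and ((EvP.pos ht.length).and ((EvP.le (hs.length.add ht.length) hk).and
    ((hC.att.of (hs.getD (.const 0)) (ht.getD (.const 0))).and (EvP.cross hC hs ht))))

theorem Constraints.coreNeeds_iff {C : Constraints} {n k v : ℕ} {B : List ℕ} :
    C.CoreNeeds n k B v ↔
      Coverable n k B.length (fun x j => C.dom x (B.getD j 0)) (fun _ => True) (C.dom · v) := by
  simp [coverable_iff, CoreNeeds]

theorem EvP.coreNeeds (hC : EvConstraints Γ C) (hn : Ev Γ n) (hnb : PolyBdd Γ n) (hk : Ev Γ k)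
    (hkb : PolyBdd Γ k) (hB : EvList Γ B) (hbd : PolyBdd Γ fun b => k b ^ (B b).length)
    (hx : Ev Γ x) : EvP Γ fun b => (C b).CoreNeeds (n b) (k b) (B b) (x b) := by
  simp only [Constraints.coreNeeds_iff]
  refine EvP.coverable hn hnb hk hkb hB.length hB.bounded ?_ (fun _ _ _ _ _ _ => .of_const True) ?_
    fun inst => ?_
  · exact fun _ _ _ h₁ _ _ he he' => (hC.ext h₁).dom.of he ((hB.ext h₁).getD he')
  · exact fun _ _ _ h₁ _ he => (hC.ext h₁).dom.of he (hx.ext h₁)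
  · have hcount : ∀ b m, @Nat.count (fun _ => True) (inst b) m = m := fun b m => by
      induction m with
      | zero => rfl
      | succ m ih => rw [Nat.count_succ, ih, if_pos trivial]
    simpa only [hcount] using hbd

/-- For the pairs of trees that can be joined, the join has at least two vertices. This condition
in the class of the representatives to be considered bounds their number for all other pairs. -/
theorem Constraints.joinable_and_needs_iff {C : Constraints} {n k : ℕ} {B s t : List ℕ}
    {F : List (List ℕ)} :
    C.Joinable k s t ∧ C.Needs n k B F (s ++ t) ↔ C.Joinable k s t ∧
      Coverable n k F.length (fun x j => C.Hits x (F.getD j []))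
        (fun j => 2 ≤ (s ++ t).length ∧ C.Alike B (F.getD j []) (s ++ t))
          (C.Hits · (s ++ t)) := by
  refine and_congr_right fun h => ?_
  have h2 : 2 ≤ (s ++ t).length := by
    have := h.1
    have := h.2.1
    rw [List.length_append]
    omega
  simp only [coverable_iff, Needs, h2, true_and]

theorem EvP.needs {F : β → List (List ℕ)} (hC : EvConstraints Γ C) (hn : Ev Γ n)
    (hnb : PolyBdd Γ n) (hk : Ev Γ k) (hkb : PolyBdd Γ k) (hB : EvList Γ B)
    (hlen : Ev Γ fun b => (F b).length) (hlenb : PolyBdd Γ fun b => (F b).length)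
    (hF : ∀ (β' : Type) (Γ' : Ctx β') (π : β' → β), Ext Γ Γ' π → ∀ i : β' → ℕ, Ev Γ' i →
      EvList Γ' fun b => (F (π b)).getD (i b) [])
    (hs : EvList Γ s) (ht : EvList Γ t)
    (hbd : ∀ inst : ∀ b, DecidablePred fun j =>
      2 ≤ (s b ++ t b).length ∧ (C b).Alike (B b) ((F b).getD j []) (s b ++ t b),
      PolyBdd Γ fun b => k b ^ @Nat.count _ (inst b) (F b).length) :
    EvP Γ fun b => (C b).Joinable (k b) (s b) (t b) ∧
      (C b).Needs (n b) (k b) (B b) (F b) (s b ++ t b) := by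
  simp only [Constraints.joinable_and_needs_iff]
  refine (EvP.joinable hC hk hs ht).and
    (EvP.coverable hn hnb hk hkb hlen hlenb ?_ ?_ ?_ hbd)
  · exact fun _ _ _ h₁ _ _ he he' => EvP.hits (hC.ext h₁) (hF _ _ _ h₁ _ he') he
  · exact fun _ _ _ h₁ _ he => (EvP.le (.const 2) ((hs.append ht).length.ext h₁)).and
      (EvP.alike (hC.ext h₁) (hB.ext h₁) (hF _ _ _ h₁ _ he) ((hs.append ht).ext h₁))
  · exact fun _ _ _ h₁ _ he => EvP.hits (hC.ext h₁) ((hs.append ht).ext h₁) he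

end Lists

end DiFPT

namespace DiFPT

/-! ### Sequences of programs, and loops that fill the memory -/

/-- There is a program that takes states which represent data `b` to states which represent some
data `b'` for the same instance, in time polynomial in the measure. -/
def Phase {β β' ι : Type} (Γ : Ctx β) (Γ' : Ctx β') (κ : β → ι) (κ' : β' → ι) : Prop :=
  ∃ P c, ∀ b s, Γ.I b s → ∃ b' s', Run P s s' ((Γ.N b + 2) ^ c) ∧ Γ'.I b' s' ∧ κ' b' = κ b

section Phase

variable {β β' β'' ι : Type} {Γ : Ctx β} {Γ' : Ctx β'} {Γ'' : Ctx β''} {κ : β → ι} {κ' : β' → ι}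
  {κ'' : β'' → ι}

theorem Phase.comp (h : Phase Γ Γ' κ κ') (h' : Phase Γ' Γ'' κ' κ'')
    (hN : ∀ b b', κ' b' = κ b → Γ'.N b' = Γ.N b) : Phase Γ Γ'' κ κ'' := by
  obtain ⟨P, c, hP⟩ := h
  obtain ⟨Q, d, hQ⟩ := h'
  refine ⟨.seq P Q, c + d + 1, fun b s hb => ?_⟩
  obtain ⟨b₁, s₁, hrun, hb₁, hκ⟩ := hP b s hb
  obtain ⟨b₂, s₂, hrun', hb₂, hκ'⟩ := hQ b₁ s₁ hb₁
  rw [hN b b₁ hκ] at hrun'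
  exact ⟨b₂, s₂, (hrun.seq hrun').mono (add_le_pow (Nat.le_add_left 2 _) le_rfl le_rfl), hb₂,
    hκ'.trans hκ⟩

/-- The value of an expression is written into the register `j`. -/
theorem Phase.set {f : β → ℕ} (hf : Ev Γ f) (j : ℕ) (g : β → β') (hκ : ∀ b, κ' (g b) = κ b)
    (h : ∀ b s s', Γ.I b s → s'.mem = s.mem → s'.reg j = f b →
      (∀ x < Γ.m, x ≠ j → s'.reg x = s.reg x) → Γ'.I (g b) s') : Phase Γ Γ' κ κ' := by
  obtain ⟨P, c, hP⟩ := hf (max Γ.m (j + 1)) (le_max_left _ _)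
  refine ⟨.seq P (.seq (.const (max Γ.m (j + 1) + 1) 0)
    (.add j (max Γ.m (j + 1)) (max Γ.m (j + 1) + 1))), c + 2 + 1, fun b s hb => ?_⟩
  obtain ⟨s₁, hrun, hmem, hreg, hval⟩ := hP b s hb
  refine ⟨g b, _, (hrun.seq ((Run.const _ 0 _).seq (Run.add ..))).mono
    (add_le_pow (Nat.le_add_left 2 _) le_rfl (const_le_pow (Nat.le_add_left 2 _) 2)),
    h b s _ hb hmem ?_ fun x hx hxj => ?_, hκ b⟩
  · rw [setReg_reg_self, setReg_reg_self, setReg_reg_of_ne _ _ (by omega), hval, add_zero]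
  · rw [setReg_reg_of_ne _ _ hxj, setReg_reg_of_ne _ _ (by omega), hreg x (by omega)]

/-- A loop that writes a value into the first free memory cell as long as a condition holds. The
register `top` holds the address of this cell. -/
theorem Phase.loop {cond : β → Prop} {val μ : β → ℕ} (next : β → β) (top : ℕ) (htop : top < Γ.m)
    (hN : ∀ b b', κ b' = κ b → Γ.N b' = Γ.N b) (hcond : EvP Γ cond)
    (hval : Ev (Γ.restrict cond) val) (hμ : PolyBdd Γ μ)
    (hnext : ∀ b s, Γ.I b s → cond b → κ (next b) = κ b ∧ μ (next b) < μ b ∧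
      Γ.I (next b) ⟨Function.update s.reg top (s.reg top + 1),
        Function.update s.mem (s.reg top) (val b)⟩) :
    Phase Γ (Γ.restrict fun b => ¬ cond b) κ κ := by
  classical
  obtain ⟨P, c₁, hP⟩ := hcond Γ.m le_rfl
  obtain ⟨Q, c₂, hQ⟩ := hval (Γ.m + 1) (Nat.le_succ _)
  obtain ⟨c₃, hμ⟩ := hμ
  let body : Program := .seq Q (.seq (.store top (Γ.m + 1)) (.seq (.const (Γ.m + 1) 1)
    (.seq (.add top top (Γ.m + 1)) P)))
  refine ⟨.seq P (.whilePos Γ.m body), c₁ + (c₃ + (c₂ + (3 + c₁ + 1) + 1 + 1) + 1) + 1,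
    fun b s hb => ?_⟩
  obtain ⟨s₁, hrun₁, hmem₁, hreg₁, hval₁⟩ := hP b s hb
  obtain ⟨j, s₂, hrun₂, ⟨b', hb', hκ, hcond', -⟩, h0⟩ := Run.whilePos (x := Γ.m) (P := body)
    (fun j s' => ∃ b', Γ.I b' s' ∧ κ b' = κ b ∧ s'.reg Γ.m = (if cond b' then 1 else 0) ∧
      μ b' + j ≤ μ b) (μ b) ((Γ.N b + 2) ^ (c₂ + (3 + c₁ + 1) + 1)) (by
      rintro j s' ⟨b', hb', hκ, hreg, hj⟩ hpos
      have hc : cond b' := by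
        by_contra hc
        rw [hreg, if_neg hc] at hpos
        exact lt_irrefl 0 hpos
      obtain ⟨s₃, hrun₃, hmem₃, hreg₃, hval₃⟩ := hQ b' s' ⟨hb', hc⟩
      have hb₃ := Γ.stable b' s' s₃ hb' hmem₃ fun x hx => hreg₃ x (by omega)
      obtain ⟨hκ', hμ', hI⟩ := hnext b' s₃ hb₃ hc
      have hrun₄ := (Run.store top (Γ.m + 1) s₃).seq ((Run.const (Γ.m + 1) 1 _).seq
        (Run.add top top (Γ.m + 1) _))
      set s₄ := (((s₃.setMem (s₃.reg top) (s₃.reg (Γ.m + 1))).setReg (Γ.m + 1) 1).setReg top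
        ((((s₃.setMem (s₃.reg top) (s₃.reg (Γ.m + 1))).setReg (Γ.m + 1) 1).reg top) +
          ((s₃.setMem (s₃.reg top) (s₃.reg (Γ.m + 1))).setReg (Γ.m + 1) 1).reg (Γ.m + 1))) with hs₄
      have hI₄ : Γ.I (next b') s₄ := by
        refine Γ.stable _ _ _ hI ?_ fun x hx => ?_
        · show Function.update s₃.mem (s₃.reg top) (s₃.reg (Γ.m + 1)) = _
          rw [hval₃]
        · have e : ∀ y, y < Γ.m → y ≠ Γ.m + 1 := fun y hy => by omega
          rcases eq_or_ne x top with rfl | hxt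
          · rw [hs₄, setReg_reg_self, setReg_reg_of_ne _ _ (e _ htop), setReg_reg_self]
            simp [MachineState.setMem]
          · rw [hs₄, setReg_reg_of_ne _ _ hxt, setReg_reg_of_ne _ _ (e x hx)]
            simp [MachineState.setMem, hxt]
      obtain ⟨s₅, hrun₅, hmem₅, hreg₅, hval₅⟩ := hP (next b') s₄ hI₄
      have hNb := hN b b' hκ
      have hNb' := hN b (next b') (hκ'.trans hκ)
      have hrun₃' : Run Q s' s₃ ((Γ.N b + 2) ^ c₂) := hNb ▸ hrun₃
      rw [hNb'] at hrun₅
      refine ⟨by omega, s₅, ?_, next b', Γ.stable _ _ _ hI₄ hmem₅ hreg₅, hκ'.trans hκ, hval₅,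
        by omega⟩
      obtain ⟨t₃, ht₃, h₃⟩ := hrun₃'
      obtain ⟨t₅, ht₅, h₅⟩ := hrun₅
      refine Run.mono ⟨_, le_rfl, h₃.seq (.seq (.store ..) (.seq (.const ..) (.seq (.add ..) h₅)))⟩
        (add_le_pow (Nat.le_add_left 2 _) ht₃ ?_)
      have := add_le_pow (Nat.le_add_left 2 _) (const_le_pow (Nat.le_add_left 2 (Γ.N b)) 3) ht₅
      omega) s₁ ⟨b, Γ.stable _ _ _ hb hmem₁ hreg₁, rfl, hval₁, le_rfl⟩
  refine ⟨b', s₂, (hrun₁.seq hrun₂).mono (add_le_pow (Nat.le_add_left 2 _) le_rfl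
    (succ_le_pow (Nat.le_add_left 2 _) (mul_le_pow (hμ b s hb)
      (succ_le_pow (Nat.le_add_left 2 _) le_rfl)))), ⟨hb', fun hc => ?_⟩, hκ⟩
  rw [hcond', if_pos hc] at h0
  exact one_ne_zero h0

end Phase

end DiFPT

namespace DiFPT

/-! ### Tables of distances -/

/-- An instance with a positive parameter, and a crown that is excluded from the digraph. -/
structure Instance where
  G : FinDigraph
  d : ℕ
  k : ℕ
  t : ℕ
  pos : 1 ≤ k
  crownFree : ¬ IsDepthMinor (d + 1) (crown t) G.graph

/-- The part of the running time that depends on the parameters. -/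
def parameterBound (t d k : ℕ) : ℕ := d + k + 2 ^ coreBound t d k + (k + 1) ^ coreBound t d k

/-- The measure that running times are compared with. -/
def Instance.size (i : Instance) : ℕ := parameterBound i.t i.d i.k * (i.G.n + 1)

/-- The address of the first memory cell after the adjacency matrix and the tables that tell which
vertices are at distance at most `e`, for `e = 0, …, d + 1`. -/
def Instance.tableEnd (i : Instance) : ℕ := (i.d + 3) * (i.G.n * i.G.n)

open Classical in
/-- The content of the memory cell `a` of the tables. The adjacency matrix comes first. -/
noncomputable def cell (G : FinDigraph) (a : ℕ) : ℕ :=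
  if a < G.n * G.n then (if NumAdj G (a / G.n) (a % G.n) then 1 else 0)
  else if NumReach G (a / (G.n * G.n) - 1) (a / G.n % G.n) (a % G.n) then 1 else 0

section Cells

variable {G : FinDigraph} {e u v : ℕ}

theorem pair_lt {n u v : ℕ} (hu : u < n) (hv : v < n) : u * n + v < n * n :=
  calc u * n + v < u * n + n := by omega
    _ = (u + 1) * n := (Nat.succ_mul u n).symm
    _ ≤ n * n := Nat.mul_le_mul_right n hu

theorem cell_adj_pos (hu : u < G.n) (hv : v < G.n) : 0 < cell G (u * G.n + v) ↔ NumAdj G u v := by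
  have hn : 0 < G.n := by omega
  have h1 : (u * G.n + v) / G.n = u := by
    rw [mul_comm, Nat.mul_add_div hn, Nat.div_eq_of_lt hv, add_zero]
  have h2 : (u * G.n + v) % G.n = v := by rw [mul_comm, Nat.mul_add_mod, Nat.mod_eq_of_lt hv]
  rw [cell, if_pos (pair_lt hu hv), h1, h2]
  by_cases h : NumAdj G u v <;> simp [h]

theorem cell_reach_pos (hu : u < G.n) (hv : v < G.n) :
    0 < cell G ((e + 1) * (G.n * G.n) + (u * G.n + v)) ↔ NumReach G e u v := by
  have hn : 0 < G.n := by omega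
  have h0 : (e + 1) * (G.n * G.n) + (u * G.n + v) = G.n * ((e + 1) * G.n + u) + v := by ring
  have h1 : ((e + 1) * (G.n * G.n) + (u * G.n + v)) / (G.n * G.n) = e + 1 := by
    rw [mul_comm (e + 1), Nat.mul_add_div (Nat.mul_pos hn hn), Nat.div_eq_of_lt (pair_lt hu hv),
      add_zero]
  have h2 : ((e + 1) * (G.n * G.n) + (u * G.n + v)) / G.n % G.n = u := by
    rw [h0, Nat.mul_add_div hn, Nat.div_eq_of_lt hv, add_zero, mul_comm, Nat.mul_add_mod,
      Nat.mod_eq_of_lt hu]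
  have h3 : ((e + 1) * (G.n * G.n) + (u * G.n + v)) % G.n = v := by
    rw [h0, Nat.mul_add_mod, Nat.mod_eq_of_lt hv]
  have h4 : ¬ (e + 1) * (G.n * G.n) + (u * G.n + v) < G.n * G.n := by
    rw [Nat.succ_mul]; omega
  rw [cell, if_neg h4, h1, h2, h3, Nat.add_sub_cancel]
  by_cases h : NumReach G e u v <;> simp [h]

theorem numReach_zero (hu : u < G.n) (hv : v < G.n) : NumReach G 0 u v ↔ u = v := by
  simp [NumReach, Reach, hu, hv]

theorem numReach_succ (hu : u < G.n) (hv : v < G.n) :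
    NumReach G (e + 1) u v ↔ u = v ∨ ∃ w < G.n, NumAdj G u w ∧ NumReach G e w v := by
  constructor
  · rintro ⟨_, _, h | ⟨w, h, h'⟩⟩
    · exact Or.inl (congrArg Fin.val h)
    · exact Or.inr ⟨w, w.2, ⟨hu, w.2, h⟩, ⟨w.2, hv, h'⟩⟩
  · rintro (rfl | ⟨w, hw, ⟨_, _, h⟩, ⟨_, _, h'⟩⟩)
    · exact numReach_self hu
    · exact ⟨hu, hv, Or.inr ⟨⟨w, hw⟩, h, h'⟩⟩

end Cells

/-- The registers `0`, `1`, `2` hold the numbers of the instance, and the memory below `l` is that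
of the tables. -/
def HoldsInput (i : Instance) (l : ℕ) (s : MachineState) : Prop :=
  s.reg 0 = i.G.n ∧ s.reg 1 = i.k ∧ s.reg 2 = i.d ∧ ∀ a < l, s.mem a = cell i.G a

theorem HoldsInput.stable {i : Instance} {l : ℕ} {s s' : MachineState} (h : HoldsInput i l s)
    (hm : s'.mem = s.mem) (hr : ∀ x < 3, s'.reg x = s.reg x) : HoldsInput i l s' :=
  ⟨(hr 0 (by omega)).trans h.1, (hr 1 (by omega)).trans h.2.1, (hr 2 (by omega)).trans h.2.2.1,
    hm ▸ h.2.2.2⟩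

/-- The states in which the memory below `l i` is that of the tables. -/
def inputCtx (l : Instance → ℕ) : Ctx Instance where
  m := 3
  I i s := HoldsInput i (l i) s
  N := Instance.size
  stable _ _ _ h hm hr := h.stable hm hr

/-- The states in the computation of the tables: the memory below the address in register `3` is
that of the tables. -/
def tableCtx : Ctx (Instance × ℕ) where
  m := 4
  I b s := HoldsInput b.1 b.2 s ∧ s.reg 3 = b.2 ∧ b.1.G.n * b.1.G.n ≤ b.2 ∧ b.2 ≤ b.1.tableEnd
  N b := b.1.size
  stable _ _ _ h hm hr := ⟨h.1.stable hm fun x hx => hr x (by omega), (hr 3 (by omega)).trans h.2.1,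
    h.2.2⟩

section Input

variable {β : Type} {Γ : Ctx β} {l : Instance → ℕ} {π : β → Instance}

theorem one_le_parameterBound (t d k : ℕ) : 1 ≤ parameterBound t d k := by
  have := Nat.one_le_two_pow (n := coreBound t d k)
  rw [parameterBound]
  omega

theorem Instance.parameterBound_le_size (i : Instance) : parameterBound i.t i.d i.k ≤ i.size :=
  Nat.le_mul_of_pos_right _ (Nat.succ_pos _)

theorem Instance.n_le_size (i : Instance) : i.G.n ≤ i.size :=
  (Nat.le_succ _).trans (Nat.le_mul_of_pos_left _ (one_le_parameterBound ..))

theorem PolyBdd.of_le_size (hN : ∀ b, Γ.N b = (π b).size) {f : β → ℕ}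
    (h : ∀ b s, Γ.I b s → f b ≤ (π b).size) : PolyBdd Γ f :=
  PolyBdd.measure.of_le fun b s hb => by rw [hN]; exact h b s hb

theorem PolyBdd.of_le_parameterBound (hN : ∀ b, Γ.N b = (π b).size) {f : β → ℕ}
    (h : ∀ b s, Γ.I b s → f b ≤ parameterBound (π b).t (π b).d (π b).k) : PolyBdd Γ f :=
  PolyBdd.of_le_size hN fun b s hb => (h b s hb).trans (π b).parameterBound_le_size

theorem PolyBdd.n (hN : ∀ b, Γ.N b = (π b).size) : PolyBdd Γ fun b => (π b).G.n :=
  PolyBdd.of_le_size hN fun b _ _ => (π b).n_le_size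

theorem PolyBdd.d (hN : ∀ b, Γ.N b = (π b).size) : PolyBdd Γ fun b => (π b).d :=
  PolyBdd.of_le_parameterBound hN fun b _ _ => by
    rw [parameterBound, add_assoc, add_assoc]; exact Nat.le_add_right _ _

theorem PolyBdd.k (hN : ∀ b, Γ.N b = (π b).size) : PolyBdd Γ fun b => (π b).k :=
  PolyBdd.of_le_parameterBound hN fun b _ _ => by
    rw [parameterBound, add_assoc]; exact (Nat.le_add_left _ _).trans (Nat.le_add_right _ _)

theorem Ev.n (h : Ext (inputCtx l) Γ π) : Ev Γ fun b => (π b).G.n :=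
  Ev.reg 0 (lt_of_lt_of_le (show 0 < 3 by decide) h.le) fun b s hb => (h.inv b s hb).1

theorem Ev.k (h : Ext (inputCtx l) Γ π) : Ev Γ fun b => (π b).k :=
  Ev.reg 1 (lt_of_lt_of_le (show 1 < 3 by decide) h.le) fun b s hb => (h.inv b s hb).2.1

theorem Ev.d (h : Ext (inputCtx l) Γ π) : Ev Γ fun b => (π b).d :=
  Ev.reg 2 (lt_of_lt_of_le (show 2 < 3 by decide) h.le) fun b s hb => (h.inv b s hb).2.2.1

theorem Ev.nn (h : Ext (inputCtx l) Γ π) : Ev Γ fun b => (π b).G.n * (π b).G.n :=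
  (Ev.n h).mul (Ev.n h) (PolyBdd.n h.measure_eq)

theorem PolyBdd.nn (hN : ∀ b, Γ.N b = (π b).size) : PolyBdd Γ fun b => (π b).G.n * (π b).G.n :=
  (PolyBdd.n hN).mul (PolyBdd.n hN)

theorem Ev.tableEnd (h : Ext (inputCtx l) Γ π) : Ev Γ fun b => (π b).tableEnd :=
  ((Ev.d h).add (.const 3)).mul (Ev.nn h) (PolyBdd.nn h.measure_eq)

theorem PolyBdd.tableEnd (hN : ∀ b, Γ.N b = (π b).size) : PolyBdd Γ fun b => (π b).tableEnd :=
  ((PolyBdd.d hN).add (.const 3)).mul (PolyBdd.nn hN)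

/-- The address of an entry of a matrix can be computed. -/
theorem Ev.address (h : Ext (inputCtx l) Γ π) {e u v : β → ℕ} (he : Ev Γ e) (hu : Ev Γ u)
    (hv : Ev Γ v) : Ev Γ fun b => e b * ((π b).G.n * (π b).G.n) + (u b * (π b).G.n + v b) :=
  (he.mul (Ev.nn h) (PolyBdd.nn h.measure_eq)).add
    ((hu.mul (Ev.n h) (PolyBdd.n h.measure_eq)).add hv)

end Input

theorem tableCtx_ext : Ext (inputCtx fun i => i.G.n * i.G.n) tableCtx Prod.fst :=
  ⟨by decide, fun _ _ h => ⟨h.1.1, h.1.2.1, h.1.2.2.1, fun a ha => h.1.2.2.2 a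
    (lt_of_lt_of_le ha h.2.2.1)⟩, fun _ => rfl⟩

/-- The next entry of the tables can be computed from the earlier ones. -/
theorem tableCtx_cell : Ev (tableCtx.restrict fun b => b.2 < b.1.tableEnd)
    fun b => cell b.1.G b.2 := by
  classical
  set Γ := tableCtx.restrict fun b => b.2 < b.1.tableEnd with hΓ
  have h₀ := tableCtx_ext.trans (Ext.restrict tableCtx fun b => b.2 < b.1.tableEnd)
  have hN := h₀.measure_eq
  have ha : Ev Γ fun b => b.2 := Ev.reg 3 (by decide) fun b s hb => hb.1.2.1
  have hab : PolyBdd Γ fun b => b.2 := (PolyBdd.tableEnd hN).of_le fun b s hb => hb.2.le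
  have hu : Ev Γ fun b => b.2 / b.1.G.n % b.1.G.n :=
    (ha.div (Ev.n h₀) hab).mod (Ev.n h₀) (hab.of_le fun _ _ _ => Nat.div_le_self _ _)
  have hv : Ev Γ fun b => b.2 % b.1.G.n := ha.mod (Ev.n h₀) hab
  have he : Ev Γ fun b => b.2 / (b.1.G.n * b.1.G.n) - 1 := (ha.div (Ev.nn h₀) hab).sub (.const 1)
  have main : EvP Γ fun b => b.2 / b.1.G.n % b.1.G.n = b.2 % b.1.G.n ∨
      (0 < b.2 / (b.1.G.n * b.1.G.n) - 1 ∧ ∃ w < b.1.G.n,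
        0 < cell b.1.G (b.2 / b.1.G.n % b.1.G.n * b.1.G.n + w) ∧
        0 < cell b.1.G ((b.2 / (b.1.G.n * b.1.G.n) - 1) * (b.1.G.n * b.1.G.n) +
          (w * b.1.G.n + b.2 % b.1.G.n))) := by
    refine (EvP.eq hu hv).or ((EvP.pos he).and (EvP.ex (Ev.n h₀) (PolyBdd.n hN) ?_))
    intro β₁ Γ₁ π₁ h₁ w hw hlt
    have h₂ := h₀.trans h₁
    refine (EvP.pos (Ev.load (((hu.ext h₁).mul (Ev.n h₂) (PolyBdd.n h₂.measure_eq)).add hw) ?_)).and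
      (EvP.pos (Ev.load (Ev.address h₂ (he.ext h₁) hw (hv.ext h₁)) ?_))
    · intro b s hb
      have hw : w b < (π₁ b).1.G.n := hlt b s hb
      obtain ⟨h, -⟩ := h₁.inv b s hb
      exact h.1.2.2.2 _ ((pair_lt (Nat.mod_lt _ (by omega)) hw).trans_le h.2.2.1)
    · intro b s hb
      have hw : w b < (π₁ b).1.G.n := hlt b s hb
      obtain ⟨h, -⟩ := h₁.inv b s hb
      refine h.1.2.2.2 _ ?_
      have hn : 0 < (π₁ b).1.G.n := by omega
      have h1 := pair_lt hw (Nat.mod_lt (π₁ b).2 hn)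
      have h2 : 1 ≤ (π₁ b).2 / ((π₁ b).1.G.n * (π₁ b).1.G.n) :=
        (Nat.one_le_div_iff (Nat.mul_pos hn hn)).2 h.2.2.1
      have h3 := Nat.div_mul_le_self (π₁ b).2 ((π₁ b).1.G.n * (π₁ b).1.G.n)
      obtain ⟨e, he⟩ := Nat.exists_eq_add_of_le' h2
      rw [he, Nat.succ_mul] at h3
      rw [he, Nat.add_sub_cancel]
      exact (Nat.add_lt_add_left h1 _).trans_le h3
  refine Ev.congr main fun b s hb => ?_
  obtain ⟨⟨i, a⟩, s⟩ := b, s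
  obtain ⟨⟨-, -, h, -⟩, hlt⟩ := hb
  dsimp only at h hlt ⊢
  have hn : 0 < i.G.n := by
    rcases Nat.eq_zero_or_pos i.G.n with h0 | h0
    · simp [Instance.tableEnd, h0] at hlt
    · exact h0
  have hu := Nat.mod_lt (a / i.G.n) hn
  have hv := Nat.mod_lt a hn
  rw [cell, if_neg (show ¬ a < i.G.n * i.G.n by omega)]
  suffices hiff : (a / i.G.n % i.G.n = a % i.G.n ∨ (0 < a / (i.G.n * i.G.n) - 1 ∧ ∃ w < i.G.n,
      0 < cell i.G (a / i.G.n % i.G.n * i.G.n + w) ∧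
      0 < cell i.G ((a / (i.G.n * i.G.n) - 1) * (i.G.n * i.G.n) + (w * i.G.n + a % i.G.n)))) ↔
      NumReach i.G (a / (i.G.n * i.G.n) - 1) (a / i.G.n % i.G.n) (a % i.G.n) by
    by_cases h : NumReach i.G (a / (i.G.n * i.G.n) - 1) (a / i.G.n % i.G.n) (a % i.G.n)
    · rw [if_pos h]
      exact if_pos (hiff.2 h)
    · rw [if_neg h]
      exact if_neg fun h' => h (hiff.1 h')
  rcases Nat.eq_zero_or_pos (a / (i.G.n * i.G.n) - 1) with h0 | h0
  · rw [h0, numReach_zero hu hv]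
    simp
  · obtain ⟨e, he⟩ : ∃ e, a / (i.G.n * i.G.n) - 1 = e + 1 := ⟨_, (Nat.succ_pred_eq_of_pos h0).symm⟩
    rw [he, numReach_succ hu hv]
    refine or_congr_right ⟨?_, ?_⟩
    · rintro ⟨-, w, hw, h1, h2⟩
      exact ⟨w, hw, (cell_adj_pos hu hw).1 h1, (cell_reach_pos hw hv).1 h2⟩
    · rintro ⟨w, hw, h1, h2⟩
      exact ⟨Nat.succ_pos _, w, hw, (cell_adj_pos hu hw).2 h1, (cell_reach_pos hw hv).2 h2⟩

theorem holdsInput_update {i : Instance} {l top a val : ℕ} {s : MachineState}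
    (h : HoldsInput i l s) (htop : 3 ≤ top) (ha : l ≤ a) (x : ℕ) :
    HoldsInput i l ⟨Function.update s.reg top x, Function.update s.mem a val⟩ := by
  obtain ⟨h1, h2, h3, h4⟩ := h
  refine ⟨?_, ?_, ?_, fun a' ha' => ?_⟩
  · exact (Function.update_of_ne (by omega) ..).trans h1
  · exact (Function.update_of_ne (by omega) ..).trans h2
  · exact (Function.update_of_ne (by omega) ..).trans h3
  · exact (Function.update_of_ne (by omega) ..).trans (h4 a' ha')

/-- The computation of the tables. -/
theorem phase_tables : Phase (inputCtx fun i => i.G.n * i.G.n)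
    (tableCtx.restrict fun b => ¬ b.2 < b.1.tableEnd) id Prod.fst := by
  have h₁ : Phase (inputCtx fun i => i.G.n * i.G.n) tableCtx id Prod.fst :=
    Phase.set (Ev.nn (Ext.refl _)) 3 (fun i => (i, i.G.n * i.G.n)) (fun _ => rfl)
      fun i s s' h hm h3 hr => ⟨h.stable hm fun x hx => hr x hx (by omega), h3, le_rfl,
        Nat.le_mul_of_pos_left _ (by omega)⟩
  refine h₁.comp (Phase.loop (val := fun b => cell b.1.G b.2) (μ := fun b => b.1.tableEnd - b.2)
    (fun b => (b.1, b.2 + 1)) 3 (by decide) (fun b b' h => congrArg Instance.size h)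
    (EvP.lt (Ev.reg 3 (by decide) fun b s hb => hb.2.1) (Ev.tableEnd tableCtx_ext)) tableCtx_cell
    ((PolyBdd.tableEnd tableCtx_ext.measure_eq).of_le fun _ _ _ => Nat.sub_le _ _) ?_)
    fun b b' h => congrArg Instance.size h
  rintro ⟨i, a⟩ s ⟨h, h3, hle, -⟩ hlt
  dsimp only at h h3 hle hlt ⊢
  refine ⟨rfl, by omega, ?_, ?_, ?_, hlt⟩
  · rw [h3]
    obtain ⟨h1, h2, h4, h5⟩ := holdsInput_update (val := cell i.G a) h le_rfl le_rfl (a + 1)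
    refine ⟨h1, h2, h4, fun a' ha' => ?_⟩
    rcases Nat.lt_succ_iff_lt_or_eq.1 ha' with ha' | rfl
    · exact h5 a' ha'
    · exact Function.update_self ..
  · show Function.update s.reg 3 (s.reg 3 + 1) 3 = _
    rw [Function.update_self, h3]
  · show i.G.n * i.G.n ≤ a + 1
    omega

/-- The states in which all tables have been computed. -/
abbrev baseCtx : Ctx Instance := inputCtx Instance.tableEnd

section Tables

variable {β : Type} {Γ : Ctx β} {π : β → Instance}

theorem pr2_numAdj : Pr2 baseCtx fun i => NumAdj i.G := by
  intro β Γ π hπ u v hu hv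
  refine (EvP.andOf ((EvP.lt hu (Ev.n hπ)).and (EvP.lt hv (Ev.n hπ))) (EvP.pos
    (Ev.load (g := fun b => cell (π b).G (u b * (π b).G.n + v b)) (((hu.mul (Ev.n hπ)
      (PolyBdd.n hπ.measure_eq)).add hv).ext (Ext.restrict ..)) ?_))).congr ?_
  · rintro b s ⟨hb, h1, h2⟩
    refine (hπ.inv b s hb).2.2.2 _ ((pair_lt h1 h2).trans_le ?_)
    exact Nat.le_mul_of_pos_left _ (by omega)
  · intro b s hb
    constructor
    · rintro ⟨⟨h1, h2⟩, h⟩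
      exact (cell_adj_pos h1 h2).1 h
    · rintro ⟨h1, h2, h⟩
      exact ⟨⟨h1, h2⟩, (cell_adj_pos h1 h2).2 ⟨h1, h2, h⟩⟩

theorem pr2_numReach {e : Instance → ℕ} (he : Ev baseCtx e) (hed : ∀ i, e i ≤ i.d + 1) :
    Pr2 baseCtx fun i => NumReach i.G (e i) := by
  intro β Γ π hπ u v hu hv
  refine (EvP.andOf ((EvP.lt hu (Ev.n hπ)).and (EvP.lt hv (Ev.n hπ))) (EvP.pos
    (Ev.load (g := fun b => cell (π b).G ((e (π b) + 1) * ((π b).G.n * (π b).G.n) +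
      (u b * (π b).G.n + v b))) ((Ev.address hπ ((he.ext hπ).add (.const 1)) hu hv).ext
        (Ext.restrict ..)) ?_))).congr ?_
  · rintro b s ⟨hb, h1, h2⟩
    refine (hπ.inv b s hb).2.2.2 _ ((Nat.add_lt_add_left (pair_lt h1 h2) _).trans_le ?_)
    rw [← Nat.succ_mul]
    exact Nat.mul_le_mul_right _ (by have := hed (π b); omega)
  · intro b s hb
    constructor
    · rintro ⟨⟨h1, h2⟩, h⟩
      exact (cell_reach_pos h1 h2).1 h
    · rintro ⟨h1, h2, h⟩
      exact ⟨⟨h1, h2⟩, (cell_reach_pos h1 h2).2 ⟨h1, h2, h⟩⟩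

/-- With the tables, the constraints can be checked. -/
theorem evConstraints_base {tree : Prop} {em : ℕ → ℕ} (hem : Ev baseCtx fun i => em i.d)
    (hed : ∀ d, em d ≤ d + 1) :
    EvConstraints baseCtx fun i => graphConstraints i.G tree (em i.d) i.d := by
  have hreach := pr2_numReach hem fun i => hed i.d
  have hreach' : Pr2 baseCtx fun i => NumReach i.G i.d :=
    pr2_numReach (Ev.d (Ext.refl _)) fun i => Nat.le_succ _
  refine ⟨?_, ?_, ?_, hreach'⟩
  · exact fun _ _ _ hπ _ hx => (EvP.lt hx (Ev.n hπ)).and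
      ((EvP.eq (hem.ext hπ) (.const 0)).or (pr2_numAdj _ _ _ hπ _ _ hx hx).not)
  · exact fun _ _ _ hπ _ _ hx hy => (hreach _ _ _ hπ _ _ hy hx).not.and
      (((EvP.of_const tree).imp (pr2_numAdj _ _ _ hπ _ _ hx hy)).and
        ((EvP.of_const ¬tree).imp (hreach _ _ _ hπ _ _ hx hy).not))
  · exact fun _ _ _ hπ _ _ hx hy => (hreach _ _ _ hπ _ _ hx hy).or (hreach _ _ _ hπ _ _ hy hx)

end Tables

end DiFPT

namespace DiFPT

/-! ### The computation of a domination core -/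

/-- The constraints on solutions of the instance. -/
def Instance.constraints (i : Instance) (tree : Prop) (em : ℕ → ℕ) : Constraints :=
  graphConstraints i.G tree (em i.d) i.d

/-- The states in the computation of a domination core `B`: its members are stored after the tables,
and the register `r` holds the first address after them. -/
def coreCtx (tree dom : Prop) (em : ℕ → ℕ) (r : ℕ) : Ctx (Instance × List ℕ) where
  m := max 3 (r + 1)
  I b s := HoldsInput b.1 b.1.tableEnd s ∧ s.reg r = b.1.tableEnd + b.2.length ∧
    (∀ j < b.2.length, s.mem (b.1.tableEnd + j) = b.2.getD j 0) ∧
    (b.1.constraints tree em).IsCore b.1.G.n b.1.k b.2 ∧ (¬ dom → b.2 = [])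
  N b := b.1.size
  stable _ _ _ h hm hr := ⟨h.1.stable hm fun x hx => hr x (by omega),
    (hr _ (by omega)).trans h.2.1, hm ▸ h.2.2.1, h.2.2.2⟩

/-- Some vertex has to be added to the domination core. -/
def CoreGrows (tree dom : Prop) (em : ℕ → ℕ) (b : Instance × List ℕ) : Prop :=
  dom ∧ ∃ v < b.1.G.n, (b.1.constraints tree em).CoreNeeds b.1.G.n b.1.k b.2 v

section Core

variable {tree dom : Prop} {em : ℕ → ℕ} {r : ℕ}

theorem coreCtx_ext : Ext baseCtx (coreCtx tree dom em r) Prod.fst :=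
  ⟨le_max_left _ _, fun _ _ h => h.1, fun _ => rfl⟩

theorem coreBound_le_parameterBound (t d k : ℕ) : coreBound t d k ≤ parameterBound t d k := by
  rw [parameterBound]
  exact Nat.lt_two_pow_self.le.trans ((Nat.le_add_left _ _).trans (Nat.le_add_right _ _))

theorem two_pow_le_parameterBound (t d k : ℕ) : 2 ^ coreBound t d k ≤ parameterBound t d k :=
  (Nat.le_add_left _ _).trans (Nat.le_add_right _ _)

theorem pow_le_parameterBound {t d k j : ℕ} (hj : j ≤ coreBound t d k) :
    k ^ j ≤ parameterBound t d k :=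
  calc k ^ j ≤ (k + 1) ^ j := Nat.pow_le_pow_left (Nat.le_succ k) j
    _ ≤ (k + 1) ^ coreBound t d k := Nat.pow_le_pow_right (Nat.succ_pos k) hj
    _ ≤ parameterBound t d k := Nat.le_add_left _ _

theorem coreCtx_length_le {b : Instance × List ℕ} {s : MachineState}
    (h : (coreCtx tree dom em r).I b s) : b.2.length ≤ coreBound b.1.t b.1.d b.1.k :=
  Constraints.IsCore.length_le b.1.pos b.1.crownFree h.2.2.2.1

theorem coreCtx_evList : EvList (coreCtx tree dom em r) Prod.snd := by
  have hr : Ev (coreCtx tree dom em r) fun b => b.1.tableEnd + b.2.length :=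
    Ev.reg r (lt_of_lt_of_le (Nat.lt_succ_self r) (le_max_right _ _)) fun b s h => h.2.1
  have hlen : Ev (coreCtx tree dom em r) fun b => b.2.length :=
    (hr.sub (Ev.tableEnd coreCtx_ext)).congr fun _ _ _ => Nat.add_sub_cancel_left ..
  refine ⟨hlen, PolyBdd.of_le_parameterBound coreCtx_ext.measure_eq fun b s h =>
    (coreCtx_length_le h).trans (coreBound_le_parameterBound ..), ?_⟩
  intro β Γ π hπ c hc
  classical
  refine (Ev.iteOf (EvP.lt hc (hlen.ext hπ)) (Ev.load (g := fun b => (π b).2.getD (c b) 0)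
    (((Ev.tableEnd (coreCtx_ext.trans hπ)).add hc).ext (Ext.restrict ..)) ?_)
    (.const 0)).congr fun b s _ => ?_
  · rintro b s ⟨hb, hlt⟩
    exact (hπ.inv b s hb).2.2.1 _ hlt
  · split_ifs with h
    · rfl
    · exact (List.getD_eq_default _ _ (not_lt.1 h)).symm

theorem coreCtx_coreNeeds (hem : Ev baseCtx fun i => em i.d) (hed : ∀ d, em d ≤ d + 1) :
    Pr1 (coreCtx tree dom em r) fun b v =>
      (b.1.constraints tree em).CoreNeeds b.1.G.n b.1.k b.2 v := by
  intro β Γ π hπ v hv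
  have h₁ := coreCtx_ext.trans hπ
  exact EvP.coreNeeds ((evConstraints_base hem hed).ext h₁) (Ev.n h₁) (PolyBdd.n h₁.measure_eq)
    (Ev.k h₁) (PolyBdd.k h₁.measure_eq) (coreCtx_evList.ext hπ)
    (PolyBdd.of_le_parameterBound h₁.measure_eq fun b s hb =>
      pow_le_parameterBound (coreCtx_length_le (hπ.inv b s hb))) hv

/-- The computation of a domination core to which no vertex has to be added. -/
theorem phase_core (hem : Ev baseCtx fun i => em i.d) (hed : ∀ d, em d ≤ d + 1) :
    Phase (tableCtx.restrict fun b => ¬ b.2 < b.1.tableEnd)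
      ((coreCtx tree dom em 3).restrict fun b => ¬ CoreGrows tree dom em b) Prod.fst Prod.fst := by
  have h₁ : Phase (tableCtx.restrict fun b => ¬ b.2 < b.1.tableEnd) (coreCtx tree dom em 3)
      Prod.fst Prod.fst := by
    refine Phase.set (f := fun b => b.2) (Ev.reg 3 (by decide) fun b s hb => hb.1.2.1) 3
      (fun b => (b.1, [])) (fun _ => rfl) ?_
    rintro ⟨i, a⟩ s s' ⟨⟨h, -, -, hle⟩, hge⟩ hm h3 hr
    obtain rfl : a = i.tableEnd := le_antisymm hle (not_lt.1 hge)
    refine ⟨h.stable hm fun x hx => hr x ?_ (by omega), h3, ?_, ?_, fun _ => rfl⟩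
    · show x < 4
      omega
    · intro j hj
      exact absurd hj (Nat.not_lt_zero j)
    · intro j hj
      exact absurd hj (Nat.not_lt_zero j)
  have hneeds := coreCtx_coreNeeds (tree := tree) (dom := dom) (r := 3) hem hed
  refine h₁.comp (Phase.loop
    (val := fun b => firstBelow
      (fun v => (b.1.constraints tree em).CoreNeeds b.1.G.n b.1.k b.2 v) b.1.G.n)
    (μ := fun b => coreBound b.1.t b.1.d b.1.k + 1 - b.2.length)
    (fun b => (b.1, b.2 ++ [firstBelow
      (fun v => (b.1.constraints tree em).CoreNeeds b.1.G.n b.1.k b.2 v) b.1.G.n])) 3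
    (show 3 < 4 by decide) (fun b b' h => congrArg Instance.size h) ?_ ?_ ?_ ?_)
    fun b b' h => congrArg Instance.size h
  · exact (EvP.of_const dom).and (EvP.ex (Ev.n coreCtx_ext) (PolyBdd.n coreCtx_ext.measure_eq)
      hneeds.below)
  · exact (Ev.firstBelow (Ev.n coreCtx_ext) (PolyBdd.n coreCtx_ext.measure_eq) hneeds.below).ext
      (Ext.restrict ..)
  · exact ((PolyBdd.of_le_parameterBound coreCtx_ext.measure_eq fun b _ _ =>
      coreBound_le_parameterBound ..).add (.const 1)).of_le fun _ _ _ => Nat.sub_le _ _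
  · rintro ⟨i, B⟩ s hI ⟨hdom, hex⟩
    have hlen := coreCtx_length_le hI
    obtain ⟨h, h3, hmem, hcore, -⟩ := hI
    dsimp only at h h3 hmem hcore hex hlen ⊢
    have hlt := firstBelow_lt_iff.2 hex
    have hv := (firstBelow_spec _ _).2.2 hlt
    set v := firstBelow (fun v => (i.constraints tree em).CoreNeeds i.G.n i.k B v) i.G.n
    refine ⟨rfl, ?_, holdsInput_update h le_rfl (by omega) _, ?_, ?_, hcore.append hlt hv,
      fun h => absurd hdom h⟩
    · rw [List.length_append, List.length_singleton]
      omega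
    · show Function.update s.reg 3 (s.reg 3 + 1) 3 = _
      rw [Function.update_self, h3, List.length_append, List.length_singleton, add_assoc]
    · intro j hj
      rw [List.length_append, List.length_singleton] at hj
      show Function.update s.mem (s.reg 3) v (i.tableEnd + j) = _
      rw [h3]
      rcases Nat.lt_succ_iff_lt_or_eq.1 hj with hj | rfl
      · rw [Function.update_of_ne (by omega), List.getD_append _ _ _ _ hj]
        exact hmem j hj
      · rw [Function.update_self, List.getD_append_right _ _ _ _ le_rfl, Nat.sub_self,
          List.getD_cons_zero]

end Core

/-! ### The computation of a collection of representatives -/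

/-- A tree is stored in `k + 1` consecutive cells: its size, and then its vertices. -/
def recordCell (t : List ℕ) (c : ℕ) : ℕ := if c = 0 then t.length else t.getD (c - 1) 0

/-- The trees `F[a]` and `F[b]` can be joined, and their join has to be added to the collection. -/
def PairNeeded (tree : Prop) (em : ℕ → ℕ) (b : Instance × List ℕ) (F : List (List ℕ))
    (x y : ℕ) : Prop :=
  (b.1.constraints tree em).Joinable b.1.k (F.getD x []) (F.getD y []) ∧
    (b.1.constraints tree em).Needs b.1.G.n b.1.k b.2 F (F.getD x [] ++ F.getD y [])

/-- Some tree has to be added to the collection. -/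
def CollectionGrows (tree : Prop) (em : ℕ → ℕ) (b : Instance × List ℕ) (F : List (List ℕ)) :
    Prop :=
  ∃ x < F.length, ∃ y < F.length, PairNeeded tree em b F x y

/-- The first pair of trees whose join has to be added to the collection. -/
noncomputable def firstNeeded (tree : Prop) (em : ℕ → ℕ) (b : Instance × List ℕ)
    (F : List (List ℕ)) : ℕ × ℕ :=
  let x := firstBelow (fun x => ∃ y < F.length, PairNeeded tree em b F x y) F.length
  (x, firstBelow (fun y => PairNeeded tree em b F x y) F.length)

/-- The next tree to be added to the collection. -/
noncomputable def nextTree (tree : Prop) (em : ℕ → ℕ) (b : Instance × List ℕ)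
    (F : List (List ℕ)) : List ℕ :=
  F.getD (firstNeeded tree em b F).1 [] ++ F.getD (firstNeeded tree em b F).2 []

/-- The address of the cell `c` of the record of the tree `F[j]`. The trees with one vertex, which
have the first `n` indices, are not stored. -/
def recordAddress (b : Instance × List ℕ) (j c : ℕ) : ℕ :=
  b.1.tableEnd + b.2.length + ((j - b.1.G.n) * (b.1.k + 1) + c)

/-- The states in the computation of the collection `F`. The records of its members are stored after
the domination core; `c` cells of the record of the next tree have been written already. The
registers `3` and `4` hold the addresses of the first free cell and of the first record. -/
def collectionCtx (tree dom : Prop) (em : ℕ → ℕ) :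
    Ctx ((Instance × List ℕ) × List (List ℕ) × ℕ) where
  m := 5
  I b s := (coreCtx tree dom em 4).I b.1 s ∧ ¬ CoreGrows tree dom em b.1 ∧
    s.reg 3 = recordAddress b.1 b.2.1.length b.2.2 ∧ b.2.2 ≤ b.1.1.k ∧
    (b.1.1.constraints tree em).IsCollection b.1.1.G.n b.1.1.k b.1.2 b.2.1 ∧
    (∀ j < b.2.1.length, b.1.1.G.n ≤ j → ∀ c ≤ b.1.1.k,
      s.mem (recordAddress b.1 j c) = recordCell (b.2.1.getD j []) c) ∧
    ∀ c < b.2.2, s.mem (recordAddress b.1 b.2.1.length c) =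
      recordCell (nextTree tree em b.1 b.2.1) c
  N b := b.1.1.size
  stable b s s' h hm hr := ⟨(coreCtx tree dom em 4).stable _ s s' h.1 hm fun x hx =>
    hr x hx, h.2.1, (hr 3 (by omega)).trans h.2.2.1, h.2.2.2.1, h.2.2.2.2.1, hm ▸ h.2.2.2.2.2⟩

section Collection

variable {tree dom : Prop} {em : ℕ → ℕ}

theorem collectionCtx_ext_core : Ext (coreCtx tree dom em 4) (collectionCtx tree dom em) Prod.fst :=
  ⟨le_rfl, fun _ _ h => h.1, fun _ => rfl⟩

theorem collectionCtx_ext : Ext baseCtx (collectionCtx tree dom em) fun b => b.1.1 :=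
  coreCtx_ext.trans collectionCtx_ext_core

/-- A bound on the number of trees in a collection. -/
def collectionBound (i : Instance) : ℕ :=
  i.G.n + coreBound i.t i.d i.k * (i.G.n * ((i.k + 1) * 2 ^ coreBound i.t i.d i.k))

theorem collectionCtx_length_le (hed : ∀ d, em d ≤ d + 1)
    {b : (Instance × List ℕ) × List (List ℕ) × ℕ} {s : MachineState}
    (h : (collectionCtx tree dom em).I b s) :
    b.2.1.length ≤ collectionBound b.1.1 := by
  refine (Constraints.IsCollection.length_le (hed _) b.1.1.crownFree h.2.2.2.2.1).trans ?_
  rw [collectionBound]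
  gcongr
  · exact one_le_two
  · exact coreCtx_length_le h.1

theorem polyBdd_collectionBound :
    PolyBdd (collectionCtx tree dom em) fun b => collectionBound b.1.1 := by
  have hN : ∀ b, (collectionCtx tree dom em).N b = b.1.1.size := collectionCtx_ext.measure_eq
  refine (PolyBdd.n hN).add (PolyBdd.mul (PolyBdd.of_le_parameterBound hN fun b _ _ =>
    coreBound_le_parameterBound ..) ((PolyBdd.n hN).mul (((PolyBdd.k hN).add (.const 1)).mul
      (PolyBdd.of_le_parameterBound hN fun b _ _ => two_pow_le_parameterBound ..))))

theorem ev_recordStart : Ev (collectionCtx tree dom em) fun b => b.1.1.tableEnd + b.1.2.length :=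
  Ev.reg 4 (show 4 < 5 by decide) fun b s h => h.1.2.1

theorem ev_offset : Ev (collectionCtx tree dom em)
    fun b => (b.2.1.length - b.1.1.G.n) * (b.1.1.k + 1) + b.2.2 :=
  ((Ev.reg (Γ := collectionCtx tree dom em) (f := fun b => recordAddress b.1 b.2.1.length b.2.2) 3
    (show 3 < 5 by decide) fun b s h => h.2.2.1).sub ev_recordStart).congr
      fun _ _ _ => Nat.add_sub_cancel_left ..

theorem polyBdd_offset (hed : ∀ d, em d ≤ d + 1) :
    PolyBdd (collectionCtx tree dom em)
      fun b => (b.2.1.length - b.1.1.G.n) * (b.1.1.k + 1) + b.2.2 := by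
  have hk : PolyBdd (collectionCtx tree dom em) fun b => b.1.1.k :=
    PolyBdd.k collectionCtx_ext.measure_eq
  refine ((polyBdd_collectionBound.mul (hk.add (.const 1))).add hk).of_le fun b s h => ?_
  refine Nat.add_le_add (Nat.mul_le_mul_right _ ?_) h.2.2.2.1
  exact (Nat.sub_le _ _).trans (collectionCtx_length_le hed h)

theorem ev_succ_k : Ev (collectionCtx tree dom em) fun b => b.1.1.k + 1 :=
  (Ev.k collectionCtx_ext).add (.const 1)

theorem ev_collection_length (hed : ∀ d, em d ≤ d + 1) :
    Ev (collectionCtx tree dom em) fun b => b.2.1.length :=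
  ((Ev.n collectionCtx_ext).add (ev_offset.div ev_succ_k (polyBdd_offset hed))).congr
    fun b s h => by
      have h1 : b.2.2 < b.1.1.k + 1 := Nat.lt_succ_of_le h.2.2.2.1
      rw [mul_comm, Nat.mul_add_div (Nat.succ_pos _), Nat.div_eq_of_lt h1, add_zero]
      exact Nat.add_sub_cancel' h.2.2.2.2.1.le_length

theorem ev_cellIndex (hed : ∀ d, em d ≤ d + 1) :
    Ev (collectionCtx tree dom em) fun b => b.2.2 :=
  (ev_offset.mod ev_succ_k (polyBdd_offset hed)).congr fun b s h => by
    rw [mul_comm, Nat.mul_add_mod, Nat.mod_eq_of_lt (Nat.lt_succ_of_le h.2.2.2.1)]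

theorem polyBdd_collection_length (hed : ∀ d, em d ≤ d + 1) :
    PolyBdd (collectionCtx tree dom em) fun b => b.2.1.length :=
  polyBdd_collectionBound.of_le fun _ _ h => collectionCtx_length_le hed h

/-- The trees of the collection can be read. -/
theorem collection_evList (hem : Ev baseCtx fun i => em i.d) (hed : ∀ d, em d ≤ d + 1)
    {β : Type} {Γ : Ctx β} {π : β → (Instance × List ℕ) × List (List ℕ) × ℕ}
    (hπ : Ext (collectionCtx tree dom em) Γ π)
    {x : β → ℕ} (hx : Ev Γ x) : EvList Γ fun b => (π b).2.1.getD (x b) [] := by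
  classical
  have h₁ : Ext baseCtx Γ fun b => (π b).1.1 := collectionCtx_ext.trans hπ
  have hvalid : EvP Γ fun b => ((π b).1.1.constraints tree em).valid (x b) :=
    (evConstraints_base hem hed).valid _ _ _ h₁ x hx
  have haddr : ∀ (β' : Type) (Γ' : Ctx β') (π' : β' → β), Ext Γ Γ' π' → ∀ c : β' → ℕ, Ev Γ' c →
      Ev Γ' fun b => recordAddress (π (π' b)).1 (x (π' b)) (c b) := fun β' Γ' π' h' c hc =>
    (ev_recordStart.ext (hπ.trans h')).add ((((hx.ext h').sub (Ev.n (h₁.trans h'))).mul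
      (ev_succ_k.ext (hπ.trans h')) (((PolyBdd.k h₁.measure_eq).add (.const 1)).ext h')).add hc)
  have hlen : Ev Γ fun b => ((π b).2.1.getD (x b) []).length := by
    refine (Ev.ite (EvP.lt hx (Ev.n h₁)) (Ev.ite hvalid (.const 1) (.const 0))
      (Ev.iteOf ((EvP.lt hx ((ev_collection_length hed).ext hπ)).and (EvP.le (Ev.n h₁) hx))
        (Ev.load (g := fun b => ((π b).2.1.getD (x b) []).length)
          (haddr _ _ _ (Ext.restrict ..) _ (.const 0)) ?_) (.const 0))).congr ?_
    · rintro b s ⟨hb, h2, h3⟩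
      exact ((hπ.inv b s hb).2.2.2.2.2.1 _ h2 h3 0 (Nat.zero_le _)).trans (if_pos rfl)
    · intro b s hb
      have hF := (hπ.inv b s hb).2.2.2.2.1
      split_ifs with h2 h3 h4
      · rw [hF.single _ h2, if_pos h3, List.length_singleton]
      · rw [hF.single _ h2, if_neg h3, List.length_nil]
      · rfl
      · rw [List.getD_eq_default _ _ (by omega), List.length_nil]
  have hle : ∀ b s, Γ.I b s → ((π b).2.1.getD (x b) []).length ≤ (π b).1.1.k := by
    intro b s hb
    have hF := (hπ.inv b s hb).2.2.2.2.1
    by_cases h2 : x b < (π b).1.1.G.n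
    · rw [hF.single _ h2]
      have := (π b).1.1.pos
      split_ifs
      · exact this
      · exact Nat.zero_le _
    · by_cases h3 : x b < (π b).2.1.length
      · exact (hF.isTree _ h3 (by omega)).2.2.1
      · rw [List.getD_eq_default _ _ (by omega)]
        exact Nat.zero_le _
  refine ⟨hlen, (PolyBdd.k h₁.measure_eq).of_le hle, ?_⟩
  intro β' Γ' π' h' c hc
  refine (Ev.ite (EvP.lt (hx.ext h') (Ev.n (h₁.trans h')))
    (Ev.ite ((EvP.eq hc (.const 0)).and (hvalid.ext h')) (hx.ext h') (.const 0))
    (Ev.iteOf ((EvP.lt hc (hlen.ext h')).and (EvP.le (Ev.n (h₁.trans h')) (hx.ext h')))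
      (Ev.load (g := fun b => ((π (π' b)).2.1.getD (x (π' b)) []).getD (c b) 0)
        (haddr _ _ _ (h'.trans (Ext.restrict ..)) _ ((hc.add (.const 1)).ext (Ext.restrict ..))) ?_)
      (.const 0))).congr ?_
  · rintro b s ⟨hb, h2, h3⟩
    have hb' := h'.inv b s hb
    have h4 : x (π' b) < (π (π' b)).2.1.length := by
      by_contra h4
      rw [List.getD_eq_default _ _ (not_lt.1 h4)] at h2
      exact absurd h2 (Nat.not_lt_zero _)
    exact ((hπ.inv _ s hb').2.2.2.2.2.1 _ h4 h3 _ (h2.trans_le (hle _ s hb'))).trans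
      (if_neg (Nat.succ_ne_zero _))
  · intro b s hb
    have hF := (hπ.inv _ s (h'.inv b s hb)).2.2.2.2.1
    show _ = ((π (π' b)).2.1.getD (x (π' b)) []).getD (c b) 0
    split_ifs with h2 h3 h4
    · rw [hF.single _ h2, if_pos h3.2, h3.1, List.getD_cons_zero]
    · rw [hF.single _ h2]
      split_ifs with h4
      · rw [List.getD_eq_default]
        rw [List.length_singleton]
        exact Nat.one_le_iff_ne_zero.2 fun h5 => h3 ⟨h5, h4⟩
      · exact (List.getD_nil ..).symm
    · rfl
    · exact (List.getD_eq_default _ _ (by omega)).symm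

theorem pr2_pairNeeded (hem : Ev baseCtx fun i => em i.d) (hed : ∀ d, em d ≤ d + 1) :
    Pr2 (collectionCtx tree dom em) fun b => PairNeeded tree em b.1 b.2.1 := by
  intro β Γ π hπ x y hx hy
  have h₁ : Ext baseCtx Γ fun b => (π b).1.1 := collectionCtx_ext.trans hπ
  refine EvP.needs (F := fun b => (π b).2.1) ((evConstraints_base hem hed).ext h₁) (Ev.n h₁)
    (PolyBdd.n h₁.measure_eq) (Ev.k h₁) (PolyBdd.k h₁.measure_eq)
    (coreCtx_evList.ext (collectionCtx_ext_core.trans hπ)) ((ev_collection_length hed).ext hπ)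
    ((polyBdd_collection_length hed).ext hπ) ?_ (collection_evList hem hed hπ hx)
    (collection_evList hem hed hπ hy) ?_
  · exact fun _ _ _ h' _ hi => collection_evList hem hed (hπ.trans h') hi
  · refine fun inst => PolyBdd.of_le_parameterBound h₁.measure_eq fun b s hb =>
      pow_le_parameterBound ?_
    have hF := (hπ.inv b s hb).2.2.2.2.1
    classical
    rw [Nat.count_eq_card_filter_range]
    by_cases h2 : 2 ≤ ((π b).2.1.getD (x b) [] ++ (π b).2.1.getD (y b) []).length
    · refine le_trans (Finset.card_le_card fun j hj => ?_)
        (Constraints.IsCollection.count_le (hed _) (π b).1.1.crownFree hF h2)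
      obtain ⟨h3, h4⟩ := Finset.mem_filter.1 hj
      exact Finset.mem_filter.2 ⟨h3, h4.2⟩
    · rw [Finset.filter_false_of_mem fun j _ h3 => h2 h3.1]
      exact Nat.zero_le _

theorem evP_collectionGrows (hem : Ev baseCtx fun i => em i.d) (hed : ∀ d, em d ≤ d + 1) :
    EvP (collectionCtx tree dom em) fun b => CollectionGrows tree em b.1 b.2.1 :=
  EvP.ex (ev_collection_length hed) (polyBdd_collection_length hed) fun _ _ _ h₁ _ hx _ =>
    EvP.ex ((ev_collection_length hed).ext h₁) ((polyBdd_collection_length hed).ext h₁)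
      fun _ _ _ h₂ _ hy _ => pr2_pairNeeded hem hed _ _ _ (h₁.trans h₂) _ _ (hx.ext h₂) hy

theorem evList_nextTree (hem : Ev baseCtx fun i => em i.d) (hed : ∀ d, em d ≤ d + 1) :
    EvList (collectionCtx tree dom em) fun b => nextTree tree em b.1 b.2.1 := by
  have hl := ev_collection_length (tree := tree) (dom := dom) hed
  have hlb := polyBdd_collection_length (tree := tree) (dom := dom) hed
  have h1 : Ev (collectionCtx tree dom em) fun b => (firstNeeded tree em b.1 b.2.1).1 :=
    Ev.firstBelow hl hlb fun _ _ _ h₁ _ hx _ =>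
      EvP.ex (hl.ext h₁) (hlb.ext h₁) fun _ _ _ h₂ _ hy _ =>
        pr2_pairNeeded hem hed _ _ _ (h₁.trans h₂) _ _ (hx.ext h₂) hy
  have h2 : Ev (collectionCtx tree dom em) fun b => (firstNeeded tree em b.1 b.2.1).2 :=
    Ev.firstBelow hl hlb fun _ _ _ h₁ _ hy _ =>
      pr2_pairNeeded hem hed _ _ _ h₁ _ _ (h1.ext h₁) hy
  exact (collection_evList hem hed (Ext.refl _) h1).append
    (collection_evList hem hed (Ext.refl _) h2)

end Collection

end DiFPT

namespace DiFPT

section Solve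

variable {tree dom : Prop} {em : ℕ → ℕ}

open Classical in
/-- The collection of the trees with one vertex. -/
noncomputable def singleTrees (C : Constraints) (n : ℕ) : List (List ℕ) :=
  (List.range n).map fun v => if C.valid v then [v] else []

theorem singleTrees_isCollection (C : Constraints) (n k : ℕ) (B : List ℕ) :
    C.IsCollection n k B (singleTrees C n) := by
  classical
  have hlen : (singleTrees C n).length = n := by
    rw [singleTrees, List.length_map, List.length_range]
  refine ⟨hlen.ge, fun v hv => ?_, fun i hi hni => absurd hi (by omega)⟩
  rw [List.getD_eq_getElem _ _ (by omega)]
  simp only [singleTrees, List.getElem_map, List.getElem_range]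

theorem recordAddress_lt {b : Instance × List ℕ} {j l c c' : ℕ} (hj : b.1.G.n ≤ j) (hjl : j < l)
    (hc : c ≤ b.1.k) : recordAddress b j c < recordAddress b l c' := by
  have h : (j - b.1.G.n + 1) * (b.1.k + 1) ≤ (l - b.1.G.n) * (b.1.k + 1) :=
    Nat.mul_le_mul_right _ (by omega)
  rw [Nat.succ_mul] at h
  simp only [recordAddress]
  omega

theorem le_recordAddress (b : Instance × List ℕ) (j c : ℕ) :
    b.1.tableEnd + b.2.length ≤ recordAddress b j c := Nat.le_add_right _ _

theorem recordAddress_of_length (b : Instance × List ℕ) {j : ℕ} (hj : b.1.G.n ≤ j) :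
    recordAddress b (j + 1) 0 = recordAddress b j b.1.k + 1 := by
  simp only [recordAddress, Nat.sub_add_comm hj, Nat.succ_mul]
  omega

/-- Writing into a cell after the domination core leaves everything up to there as it is. -/
theorem coreCtx_update {b : Instance × List ℕ} {s : MachineState}
    (h : (coreCtx tree dom em 4).I b s) {a : ℕ} (ha : b.1.tableEnd + b.2.length ≤ a) (x v : ℕ) :
    (coreCtx tree dom em 4).I b ⟨Function.update s.reg 3 x, Function.update s.mem a v⟩ := by
  obtain ⟨h1, h2, h3, h4⟩ := h
  refine ⟨holdsInput_update h1 le_rfl (by omega) x, ?_, fun j hj => ?_, h4⟩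
  · exact (Function.update_of_ne (show 4 ≠ 3 by omega) x s.reg).trans h2
  · exact (Function.update_of_ne (show b.1.tableEnd + j ≠ a by omega) ..).trans (h3 j hj)

theorem pairNeeded_firstNeeded {b : Instance × List ℕ} {F : List (List ℕ)}
    (h : CollectionGrows tree em b F) :
    (firstNeeded tree em b F).1 < F.length ∧ (firstNeeded tree em b F).2 < F.length ∧
      PairNeeded tree em b F (firstNeeded tree em b F).1 (firstNeeded tree em b F).2 := by
  have h1 := firstBelow_lt_iff.2 h
  have h2 := (firstBelow_spec _ _).2.2 h1
  have h3 := firstBelow_lt_iff.2 h2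
  exact ⟨h1, h3, (firstBelow_spec _ _).2.2 h3⟩

theorem isCollection_nextTree {b : Instance × List ℕ} {F : List (List ℕ)}
    (h : CollectionGrows tree em b F)
    (hF : (b.1.constraints tree em).IsCollection b.1.G.n b.1.k b.2 F) :
    (b.1.constraints tree em).IsCollection b.1.G.n b.1.k b.2 (F ++ [nextTree tree em b F]) := by
  obtain ⟨h1, h2, h3⟩ := pairNeeded_firstNeeded h
  have hmem : ∀ i < F.length, F.getD i [] ∈ F := fun i hi => by
    rw [List.getD_eq_getElem _ _ hi]
    exact List.getElem_mem hi
  exact hF.append (hmem _ h1) (hmem _ h2) h3.1 h3.2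

open Classical in
/-- The next state in the computation of the collection: one more cell of the next record is
written, and with the last cell the tree is a member of the collection. -/
noncomputable def nextCollection (tree : Prop) (em : ℕ → ℕ)
    (b : (Instance × List ℕ) × List (List ℕ) × ℕ) : (Instance × List ℕ) × List (List ℕ) × ℕ :=
  if b.2.2 < b.1.1.k then (b.1, b.2.1, b.2.2 + 1)
  else (b.1, b.2.1 ++ [nextTree tree em b.1 b.2.1], 0)

theorem nextCollection_fst (b : (Instance × List ℕ) × List (List ℕ) × ℕ) :
    (nextCollection tree em b).1 = b.1 := by
  rw [nextCollection]
  split_ifs <;> rfl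

/-- The number of cells that may still be written. -/
def collectionRoom (b : (Instance × List ℕ) × List (List ℕ) × ℕ) : ℕ :=
  (collectionBound b.1.1 + 1 - b.2.1.length) * (b.1.1.k + 1) + (b.1.1.k + 1 - b.2.2)

theorem collectionCtx_next (hed : ∀ d, em d ≤ d + 1)
    {b : (Instance × List ℕ) × List (List ℕ) × ℕ} {s : MachineState}
    (h : (collectionCtx tree dom em).I b s) (hgrow : CollectionGrows tree em b.1 b.2.1) :
    collectionRoom (nextCollection tree em b) < collectionRoom b ∧
      (collectionCtx tree dom em).I (nextCollection tree em b)
        ⟨Function.update s.reg 3 (s.reg 3 + 1), Function.update s.mem (s.reg 3)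
          (recordCell (nextTree tree em b.1 b.2.1) b.2.2)⟩ := by
  have hlen := collectionCtx_length_le hed h
  obtain ⟨b, F, c⟩ := b
  obtain ⟨hcore, hdone, h3, hc, hF, hrec, hpart⟩ := h
  dsimp only at hcore hdone h3 hc hF hrec hpart hgrow hlen ⊢
  have hn := hF.le_length
  have hcore' := coreCtx_update hcore (le_recordAddress b F.length c) (s.reg 3 + 1)
    (recordCell (nextTree tree em b F) c)
  have hupd : ∀ a, a < recordAddress b F.length c → Function.update s.mem
      (recordAddress b F.length c) (recordCell (nextTree tree em b F) c) a = s.mem a :=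
    fun a ha => Function.update_of_ne (by omega) ..
  rw [h3] at hcore' ⊢
  rw [nextCollection]
  dsimp only
  split_ifs with hck
  · refine ⟨Nat.add_lt_add_left (by dsimp only; omega) _, hcore', hdone, ?_, hck, hF, ?_, ?_⟩
    · exact Function.update_self (β := fun _ => ℕ) 3 _ s.reg
    · exact fun j hj hnj c' hc' =>
        (hupd _ (recordAddress_lt hnj hj hc')).trans (hrec j hj hnj c' hc')
    · intro c' hc'
      rcases Nat.lt_succ_iff_lt_or_eq.1 hc' with hc' | rfl
      · exact (hupd _ (Nat.add_lt_add_left (Nat.add_lt_add_left hc' _) _)).trans (hpart c' hc')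
      · exact Function.update_self ..
  · obtain rfl : c = b.1.k := le_antisymm hc (not_lt.1 hck)
    have hl : (F ++ [nextTree tree em b F]).length = F.length + 1 := by
      rw [List.length_append, List.length_singleton]
    refine ⟨?_, hcore', hdone, ?_, Nat.zero_le _, isCollection_nextTree hgrow hF, ?_, ?_⟩
    · simp only [collectionRoom, hl]
      rw [Nat.sub_add_comm hlen, Nat.succ_mul, Nat.add_sub_add_right]
      omega
    · dsimp only
      rw [hl, recordAddress_of_length b hn]
      exact Function.update_self (β := fun _ => ℕ) 3 _ s.reg
    · intro j hj hnj c' hc'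
      rw [hl] at hj
      dsimp only
      rcases Nat.lt_succ_iff_lt_or_eq.1 hj with hj | rfl
      · rw [hupd _ (recordAddress_lt hnj hj hc'), hrec j hj hnj c' hc',
          Constraints.getD_append_list hj]
      · rw [List.getD_append_right _ _ _ _ le_rfl, Nat.sub_self, List.getD_cons_zero]
        rcases hc'.lt_or_eq with hc' | rfl
        · exact (hupd _ (Nat.add_lt_add_left (Nat.add_lt_add_left hc' _) _)).trans (hpart c' hc')
        · exact Function.update_self ..
    · exact fun c' hc' => absurd hc' (Nat.not_lt_zero c')

/-- The computation of a collection to which no tree has to be added. -/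
theorem phase_collection (hem : Ev baseCtx fun i => em i.d) (hed : ∀ d, em d ≤ d + 1) :
    Phase ((coreCtx tree dom em 3).restrict fun b => ¬ CoreGrows tree dom em b)
      ((collectionCtx tree dom em).restrict fun b => ¬ CollectionGrows tree em b.1 b.2.1)
      Prod.fst fun b => b.1.1 := by
  classical
  have h₁ : Phase ((coreCtx tree dom em 3).restrict fun b => ¬ CoreGrows tree dom em b)
      (collectionCtx tree dom em) Prod.fst fun b => b.1.1 := by
    refine Phase.set (f := fun b => b.1.tableEnd + b.2.length)
      (Ev.reg 3 (show 3 < 4 by decide) fun b s hb => hb.1.2.1) 4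
      (fun b => (b, singleTrees (b.1.constraints tree em) b.1.G.n, 0)) (fun _ => rfl) ?_
    rintro b s s' ⟨⟨h1, h3, hmem, h4⟩, hdone⟩ hm h4' hr
    have hl : (singleTrees (b.1.constraints tree em) b.1.G.n).length = b.1.G.n := by
      rw [singleTrees, List.length_map, List.length_range]
    have hr' : ∀ x < 4, s'.reg x = s.reg x := fun x hx => hr x hx (by omega)
    refine ⟨⟨h1.stable hm fun x hx => hr' x (by omega), h4', hm ▸ hmem, h4⟩, hdone, ?_,
      Nat.zero_le _, singleTrees_isCollection .., fun j hj hnj => ?_, fun c hc => ?_⟩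
    · rw [hr' 3 (by omega), h3]
      simp only [recordAddress, hl, Nat.sub_self, Nat.zero_mul, Nat.add_zero]
    · dsimp only at hj hnj
      omega
    · exact absurd hc (Nat.not_lt_zero c)
  refine h₁.comp (Phase.loop (val := fun b => recordCell (nextTree tree em b.1 b.2.1) b.2.2)
    (μ := collectionRoom) (nextCollection tree em) 3 (show 3 < 5 by decide)
    (fun b b' h => congrArg Instance.size h) (evP_collectionGrows hem hed) ?_ ?_ ?_)
    fun b b' h => congrArg Instance.size h
  · have ht := evList_nextTree (tree := tree) (dom := dom) hem hed
    have hc := ev_cellIndex (tree := tree) (dom := dom) hed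
    have h := Ev.ite (EvP.eq hc (.const 0)) ht.length (ht.getD (hc.sub (.const 1)))
    exact (h.congr fun b _ _ => by rw [recordCell]; congr).ext (Ext.restrict ..)
  · have hk : PolyBdd (collectionCtx tree dom em) fun b => b.1.1.k + 1 :=
      (PolyBdd.k collectionCtx_ext.measure_eq).add (.const 1)
    exact (((polyBdd_collectionBound.add (.const 1)).mul hk).add hk).of_le fun b _ _ =>
      Nat.add_le_add (Nat.mul_le_mul_right _ (Nat.sub_le _ _)) (Nat.sub_le _ _)
  · intro b s h hgrow
    exact ⟨congrArg Prod.fst (nextCollection_fst b), collectionCtx_next hed h hgrow⟩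

/-- The states in which register `0` tells the answer. -/
def answerCtx (tree dom : Prop) (em : ℕ → ℕ) : Ctx Instance where
  m := 1
  I i s := 0 < s.reg 0 ↔ HasTreeSolution i.G tree dom (em i.d) i.d i.k
  N := Instance.size
  stable _ _ _ h _ hr := by rw [hr 0 (by omega)]; exact h

theorem phase_answer (hem : Ev baseCtx fun i => em i.d) (hed : ∀ d, em d ≤ d + 1) :
    Phase ((collectionCtx tree dom em).restrict fun b => ¬ CollectionGrows tree em b.1 b.2.1)
      (answerCtx tree dom em) (fun b => b.1.1) id := by
  classical
  have hB : EvList (collectionCtx tree dom em) fun b => b.1.2 :=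
    coreCtx_evList.ext collectionCtx_ext_core
  have main : EvP (collectionCtx tree dom em) fun b => ∃ j < b.2.1.length,
      (b.2.1.getD j []).length = b.1.1.k ∧ ∀ x < b.1.2.length,
        (b.1.1.constraints tree em).ListDom (b.2.1.getD j []) (b.1.2.getD x 0) :=
    EvP.ex (ev_collection_length hed) (polyBdd_collection_length hed) fun _ _ _ h₁ _ hj _ =>
      (EvP.eq (collection_evList hem hed h₁ hj).length (Ev.k (collectionCtx_ext.trans h₁))).and
        (EvP.all (hB.length.ext h₁) (hB.bounded.ext h₁) fun _ _ _ h₂ _ hx _ =>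
          EvP.listDom ((evConstraints_base hem hed).ext (collectionCtx_ext.trans (h₁.trans h₂)))
            (collection_evList hem hed (h₁.trans h₂) (hj.ext h₂))
            ((hB.ext (h₁.trans h₂)).getD hx))
  refine Phase.set (main.ext (Ext.restrict ..)) 0 (fun b => b.1.1) (fun _ => rfl) ?_
  rintro ⟨⟨i, B⟩, F, c⟩ s s' ⟨⟨⟨-, -, -, hcore, hB0⟩, hdone, -, -, hF, -⟩, hsat⟩ - h0 -
  dsimp only at hcore hB0 hdone hF hsat h0
  have h := Constraints.exists_solution_iff i.pos (Γ := i.constraints tree em) (dom := dom)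
    (fun x y => graphConstraints_symm x y) (fun v hv => hv.1) (fun j hj => (hcore j hj).1) hB0
    (fun hd v hv hneed => hdone ⟨hd, v, hv, hneed⟩) hF
    (fun x hx y hy hj hneed => hsat ⟨x, hx, y, hy, hj, hneed⟩)
  refine Iff.trans ?_ h
  rw [h0]
  split_ifs with h1
  · exact ⟨fun _ => h1, fun _ => Nat.one_pos⟩
  · exact ⟨fun h2 => absurd h2 (lt_irrefl 0), fun h2 => absurd h2 h1⟩

/-! ### The program that decides a problem about trees -/

/-- The whole computation for a positive parameter. -/
theorem phase_solve (hem : Ev baseCtx fun i => em i.d) (hed : ∀ d, em d ≤ d + 1) :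
    Phase (inputCtx fun i => i.G.n * i.G.n) (answerCtx tree dom em) id id :=
  ((phase_tables.comp (phase_core hem hed) fun _ _ h => congrArg Instance.size h).comp
    (phase_collection hem hed) fun _ _ h => congrArg Instance.size h).comp
    (phase_answer hem hed) fun _ _ h => congrArg Instance.size h

theorem holdsInput_initState (i : Instance) :
    HoldsInput i (i.G.n * i.G.n) (initState i.G i.d i.k) := by
  classical
  refine ⟨rfl, rfl, rfl, fun a ha => ?_⟩
  have hn : 0 < i.G.n := Nat.pos_of_mul_pos_left (lt_of_le_of_lt (Nat.zero_le a) ha)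
  rw [cell, if_pos ha]
  have hq : a / i.G.n < i.G.n := Nat.div_lt_of_lt_mul ha
  have hr : a % i.G.n < i.G.n := Nat.mod_lt a hn
  have hiff : (∃ u v : Fin i.G.n, a = u.1 * i.G.n + v.1 ∧ i.G.graph.Adj u v) ↔
      NumAdj i.G (a / i.G.n) (a % i.G.n) := by
    constructor
    · rintro ⟨u, v, rfl, h⟩
      have h1 : (u.1 * i.G.n + v.1) / i.G.n = u := by
        rw [mul_comm, Nat.mul_add_div hn, Nat.div_eq_of_lt v.2, add_zero]
      have h2 : (u.1 * i.G.n + v.1) % i.G.n = v := by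
        rw [mul_comm, Nat.mul_add_mod, Nat.mod_eq_of_lt v.2]
      rw [h1, h2]
      exact numAdj_coe.2 h
    · rintro ⟨h1, h2, h⟩
      exact ⟨⟨_, h1⟩, ⟨_, h2⟩, (Nat.div_add_mod' a i.G.n).symm, h⟩
  by_cases h : NumAdj i.G (a / i.G.n) (a % i.G.n)
  · rw [if_pos h]
    exact if_pos (hiff.2 h)
  · rw [if_neg h]
    exact if_neg fun h' => h (hiff.1 h')

/-- The number of vertices is in register `0`. -/
def sizeCtx : Ctx FinDigraph where
  m := 1
  I G s := s.reg 0 = G.n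
  N _ := 0
  stable _ _ _ h _ hr := (hr 0 (by omega)).trans h

/-- A problem about trees is decided by one program, in time polynomial in the number of vertices
and in `parameterBound`. The order `t` of an excluded crown only enters the running time: the
program does not know it. -/
theorem exists_program {Q : DistanceProblem} (hem : Ev baseCtx fun i => em i.d)
    (hed : ∀ d, em d ≤ d + 1) (hzero : ∀ G d, Q G d 0 ↔ ¬ tree ∧ (dom → G.n = 0))
    (hpos : ∀ G d k, 1 ≤ k → (Q G d k ↔ HasTreeSolution G tree dom (em d) d k)) :
    ∃ P c, ∀ G d k t, ¬ IsDepthMinor (d + 1) (crown t) G.graph →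
      ∃ s T, Exec P (initState G d k) s T ∧ T ≤ (parameterBound t d k * (G.n + 1) + 2) ^ c ∧
        (0 < s.reg 0 ↔ Q G d k) := by
  classical
  obtain ⟨P, c, hP⟩ := phase_solve (tree := tree) (dom := dom) hem hed
  have hz : EvP sizeCtx fun G => ¬ tree ∧ (dom → G.n = 0) :=
    (EvP.of_const _).and ((EvP.of_const _).imp (EvP.eq
      (Ev.reg 0 (show 0 < 1 by decide) fun _ _ h => h) (.const 0)))
  let zeroCtx : Ctx FinDigraph :=
    { m := 1
      I := fun G s => 0 < s.reg 0 ↔ ¬ tree ∧ (dom → G.n = 0)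
      N := fun _ => 0
      stable := fun _ _ _ h _ hr => by rw [hr 0 (by omega)]; exact h }
  obtain ⟨Z, c', hZ⟩ : Phase sizeCtx zeroCtx id id := by
    refine Phase.set hz 0 id (fun _ => rfl) fun G s s' _ _ h0 _ => ?_
    show 0 < s'.reg 0 ↔ _
    rw [h0]
    split_ifs with h1
    · exact ⟨fun _ => h1, fun _ => Nat.one_pos⟩
    · exact ⟨fun h2 => absurd h2 (lt_irrefl 0), fun h2 => absurd h2 h1⟩
  refine ⟨.ifPos 1 P Z, c + c' + 1, fun G d k t hG => ?_⟩
  suffices h : ∃ s T, Exec (.ifPos 1 P Z) (initState G d k) s (T + 1) ∧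
      (T ≤ (parameterBound t d k * (G.n + 1) + 2) ^ c ∨
        T ≤ (parameterBound t d k * (G.n + 1) + 2) ^ c') ∧ (0 < s.reg 0 ↔ Q G d k) by
    obtain ⟨s, T, hrun, hT, hs⟩ := h
    refine ⟨s, T + 1, hrun, ?_, hs⟩
    refine succ_le_pow (Nat.le_add_left 2 _) (hT.elim (fun h => h.trans ?_) fun h => h.trans ?_)
    · exact Nat.pow_le_pow_right (by omega) (by omega)
    · exact Nat.pow_le_pow_right (by omega) (by omega)
  rcases Nat.eq_zero_or_pos k with rfl | hk
  · obtain ⟨G', s, ⟨T, hT, hrun⟩, hs, hG'⟩ := hZ G (initState G d 0) rfl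
    obtain rfl : G' = G := hG'
    refine ⟨s, T, .ifPos_false rfl hrun, Or.inr (hT.trans ?_), hs.trans (hzero _ d).symm⟩
    exact Nat.pow_le_pow_left (Nat.add_le_add_right (Nat.zero_le _) 2) _
  · obtain ⟨i, s, ⟨T, hT, hrun⟩, hs, hi⟩ := hP ⟨G, d, k, t, hk, hG⟩ (initState G d k)
      (holdsInput_initState ⟨G, d, k, t, hk, hG⟩)
    obtain rfl : i = ⟨G, d, k, t, hk, hG⟩ := hi
    exact ⟨s, T, .ifPos_true hk hrun, Or.inl hT, hs.trans (hpos G d k hk).symm⟩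

end Solve

end DiFPT

namespace DiFPT

/-! ### Computable bounds -/

section Computability

open Primrec

theorem primrec_pow : Primrec₂ ((· ^ ·) : ℕ → ℕ → ℕ) := Primrec₂.unpaired'.1 Nat.Primrec.pow

theorem primrec_parameterBound :
    Primrec fun p : ℕ × ℕ × ℕ => parameterBound p.1 p.2.1 p.2.2 := by
  have add {f g : ℕ × ℕ × ℕ → ℕ} (hf : Primrec f) (hg : Primrec g) : Primrec fun p => f p + g p :=
    nat_add.comp hf hg
  have mul {f g : ℕ × ℕ × ℕ → ℕ} (hf : Primrec f) (hg : Primrec g) : Primrec fun p => f p * g p :=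
    nat_mul.comp hf hg
  have pow {f g : ℕ × ℕ × ℕ → ℕ} (hf : Primrec f) (hg : Primrec g) : Primrec fun p => f p ^ g p :=
    primrec_pow.comp hf hg
  have num (a : ℕ) : Primrec fun _ : ℕ × ℕ × ℕ => a := .const a
  have ht : Primrec fun p : ℕ × ℕ × ℕ => p.1 := .fst
  have hd : Primrec fun p : ℕ × ℕ × ℕ => p.2.1 := Primrec.fst.comp .snd
  have hk : Primrec fun p : ℕ × ℕ × ℕ => p.2.2 := Primrec.snd.comp .snd
  have hr := add hd (num 1)
  have hw := mul (num 2) hk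
  have hroom : Primrec fun p : ℕ × ℕ × ℕ => crownRoom p.1 (p.2.1 + 1) :=
    add (add ht (mul (pow ht (num 2)) (mul (num 2) hr))) (num 1)
  have hsparse : Primrec fun p : ℕ × ℕ × ℕ => sparseExp p.1 (p.2.1 + 1) :=
    pow (add (mul (num 2) ht) (num 3)) (add hr (num 1))
  have hhub : Primrec fun p : ℕ × ℕ × ℕ => hubBound p.1 (p.2.1 + 1) (2 * p.2.2) :=
    mul (mul hw (mul (add hr (num 1)) ht)) (mul (mul hw hw) (add hr (num 1)))
  have hladder : Primrec fun p : ℕ × ℕ × ℕ => ladderLength p.1 (p.2.1 + 1) (2 * p.2.2) :=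
    mul (pow (mul (add (mul (mul (num 4) (mul hw hw)) (pow (num 2) hhub)) (num 1)) hroom)
      (pow (add (mul (num 2) hsparse) (num 2)) hw)) (pow (num 2) hhub)
  have hcore : Primrec fun p : ℕ × ℕ × ℕ => coreBound p.1 p.2.1 p.2.2 := add hladder (num 1)
  exact add (add (add hd hk) (pow (num 2) hcore)) (pow (add hk (num 1)) hcore)

/-- A computable function of two arguments is bounded by a computable function of their sum: the sum
of all its values on a finite set that contains the pairs of numbers with this sum. -/
theorem exists_computable_bound {g : ℕ × ℕ → ℕ} (hg : Computable g) :
    ∃ f : ℕ → ℕ, Computable f ∧ ∀ d k, g (d, k) ≤ f (k + d) := by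
  let F : ℕ → ℕ := fun m => Nat.rec 0 (fun p acc => acc + g (Nat.unpair p)) m
  have hF : Computable F := by
    refine Computable.nat_rec (f := fun m => m) (g := fun _ => 0)
      (h := fun _ (p : ℕ × ℕ) => p.2 + g (Nat.unpair p.1)) Computable.id (Computable.const 0) ?_
    refine (Primrec.nat_add.to_comp).comp (Computable.snd.comp Computable.snd) (hg.comp ?_)
    exact Primrec.unpair.to_comp.comp (Computable.fst.comp Computable.snd)
  have hle : ∀ p m, p < m → g (Nat.unpair p) ≤ F m := by
    intro p m hpm
    induction m with
    | zero => exact absurd hpm (Nat.not_lt_zero p)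
    | succ m ih =>
      show _ ≤ F m + g (Nat.unpair m)
      rcases Nat.lt_succ_iff_lt_or_eq.1 hpm with h | rfl
      · exact (ih h).trans (Nat.le_add_right _ _)
      · exact Nat.le_add_left _ _
  refine ⟨fun m => F (Nat.pair m m + 1),
    Computable.comp (g := fun m => Nat.pair m m + 1) hF ?_, fun d k => ?_⟩
  · exact Computable.succ.comp (Primrec₂.natPair.to_comp.comp Computable.id Computable.id)
  · have h1 : Nat.pair d k ≤ Nat.pair (k + d) (k + d) := by
      have h2 : Nat.pair d k ≤ Nat.pair (k + d) k := by
        rcases (Nat.le_add_left d k).lt_or_eq with h | h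
        · exact (Nat.pair_lt_pair_left k h).le
        · rw [← h]
      have h3 : Nat.pair (k + d) k ≤ Nat.pair (k + d) (k + d) := by
        rcases (Nat.le_add_right k d).lt_or_eq with h | h
        · exact (Nat.pair_lt_pair_right (k + d) h).le
        · rw [← h]
      exact h2.trans h3
    have h4 := hle _ _ (Nat.lt_succ_of_le h1)
    rwa [Nat.unpair_pair] at h4

theorem computable_bound {B : ℕ → ℕ → ℕ → ℕ} (hB : Primrec fun p : ℕ × ℕ × ℕ => B p.1 p.2.1 p.2.2)
    {t : ℕ → ℕ} (ht : Computable t) (c : ℕ) :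
    Computable fun p : ℕ × ℕ => (B (t p.1) p.1 p.2 + 2) ^ c := by
  have h1 : Computable fun p : ℕ × ℕ => (t p.1, p.1, p.2) :=
    (ht.comp Computable.fst).pair (Computable.fst.pair Computable.snd)
  have h2 : Computable fun p : ℕ × ℕ => B (t p.1) p.1 p.2 := hB.to_comp.comp h1
  have h3 : Computable fun p : ℕ × ℕ => B (t p.1) p.1 p.2 + 2 :=
    Primrec.nat_add.to_comp.comp h2 (Computable.const 2)
  exact primrec_pow.to_comp.comp h3 (Computable.const c)

theorem bound_le_mul_pow (a n c : ℕ) : (a * (n + 1) + 2) ^ c ≤ (a + 2) ^ c * (n + 1) ^ c := by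
  rw [← mul_pow]
  refine Nat.pow_le_pow_left ?_ c
  rw [add_mul]
  omega

end Computability

/-! ### Fixed-parameter tractability -/

/-- A problem about trees is fixed-parameter tractable on nowhere crownful classes. -/
theorem fpt_of_hasTreeSolution {C : Set FinDigraph} (hC : NowhereCrownful C) {Q : DistanceProblem}
    (tree dom : Prop) (em : ℕ → ℕ) (hem : Ev baseCtx fun i => em i.d) (hed : ∀ d, em d ≤ d + 1)
    (hzero : ∀ G d, Q G d 0 ↔ ¬ tree ∧ (dom → G.n = 0))
    (hpos : ∀ G d k, 1 ≤ k → (Q G d k ↔ HasTreeSolution G tree dom (em d) d k)) :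
    FPTOnAtEachDistance C Q ∧ (EffectivelyNowhereCrownful C → FPTOn C Q) := by
  obtain ⟨P, c, hP⟩ := exists_program hem hed hzero hpos
  have hB := primrec_parameterBound
  generalize parameterBound = B at hP hB
  constructor
  · choose q _ hq using hC
    refine ⟨P, fun d k => (B (q (d + 1)) d k + 2) ^ c, c, fun d => ?_, ?_⟩
    · have h : Computable fun k : ℕ => (d, k) := (Computable.const d).pair Computable.id
      exact Computable.comp (computable_bound (t := fun _ => q (d + 1)) hB
        (Computable.const _) c) h
    · intro G hG d k
      obtain ⟨s, T, hrun, hT, hs⟩ := hP G d k _ (hq (d + 1) G hG)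
      exact ⟨s, T, hrun, hT.trans (bound_le_mul_pow _ G.n c), hs⟩
  · rintro ⟨q, hqc, hq⟩
    obtain ⟨f, hf, hle⟩ := exists_computable_bound
      (computable_bound (t := fun d => q (d + 1)) hB
        (hqc.comp Computable.succ) c)
    refine ⟨P, f, c, hf, fun G hG d k => ?_⟩
    obtain ⟨s, T, hrun, hT, hs⟩ := hP G d k _ ((hq (d + 1)).2 G hG)
    exact ⟨s, T, hrun,
      hT.trans ((bound_le_mul_pow _ G.n c).trans (Nat.mul_le_mul_right _ (hle d k))), hs⟩

section Zero

variable {G : FinDigraph}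

theorem isDominating_empty_iff {d : ℕ} : IsDominating G.graph d ∅ ↔ G.n = 0 := by
  constructor
  · intro h
    by_contra hn
    obtain ⟨u, hu, -⟩ := h ⟨0, Nat.pos_of_ne_zero hn⟩
    exact absurd hu (Finset.notMem_empty u)
  · exact fun h v => absurd v.2 (by omega)

theorem not_isOutBranching_empty {V : Type*} {T : Digraph V} {r : V} :
    ¬ IsOutBranching T ∅ r := fun h => Finset.notMem_empty r h.1

end Zero

end DiFPT

open DiFPT in
theorem mainTheorem2 (C : Set DiFPT.FinDigraph) (hC : DiFPT.NowhereCrownful C) :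
    ∀ Q ∈ ({DiFPT.dominatingSet, DiFPT.independentDominatingSet,
        DiFPT.distIndependentDominatingSet, DiFPT.dominatingOutBranching,
        DiFPT.dominatingSpanningOutBranching, DiFPT.independentSet} : Set DiFPT.DistanceProblem),
      DiFPT.FPTOnAtEachDistance C Q ∧
        (DiFPT.EffectivelyNowhereCrownful C → DiFPT.FPTOn C Q) := by
  have hmax : Ev baseCtx fun i => max i.d 1 :=
    ((Ev.d (Ext.refl _)).add ((Ev.const 1).sub (Ev.d (Ext.refl _)))).congr fun i _ _ => by
      show i.d + (1 - i.d) = max i.d 1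
      omega
  have hmax' : ∀ d, max d 1 ≤ d + 1 := fun d => by omega
  have hzero : ∀ d, 0 ≤ d + 1 := fun d => Nat.zero_le _
  have hone : ∀ d, 1 ≤ d + 1 := fun d => Nat.le_add_left 1 d
  have hempty : ∀ G : FinDigraph, IsIndependent G.graph ∅ := fun G u hu =>
    absurd hu (Finset.notMem_empty u)
  have hempty' : ∀ (G : FinDigraph) d, IsDistIndependent G.graph d ∅ := fun G d =>
    ⟨hempty G, fun u hu => absurd hu (Finset.notMem_empty u)⟩
  rintro Q (rfl | rfl | rfl | rfl | rfl | rfl)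
  · refine fpt_of_hasTreeSolution hC False True (fun _ => 0) (.const 0) hzero (fun G d => ?_)
      fun G d k hk => dominatingSet_iff hk
    simp [dominatingSet, Finset.card_eq_zero, isDominating_empty_iff]
  · refine fpt_of_hasTreeSolution hC False True (fun _ => 1) (.const 1) hone (fun G d => ?_)
      fun G d k hk => independentDominatingSet_iff hk
    simp [independentDominatingSet, Finset.card_eq_zero, isDominating_empty_iff, hempty]
  · refine fpt_of_hasTreeSolution hC False True (fun d => max d 1) hmax hmax' (fun G d => ?_)
      fun G d k hk => distIndependentDominatingSet_iff hk
    simp [distIndependentDominatingSet, Finset.card_eq_zero, isDominating_empty_iff, hempty']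
  · refine fpt_of_hasTreeSolution hC True True (fun _ => 1) (.const 1) hone (fun G d => ?_)
      fun G d k _ => dominatingOutBranching_iff
    simp [dominatingOutBranching, Finset.card_eq_zero, not_isOutBranching_empty]
  · refine fpt_of_hasTreeSolution hC True True (fun _ => 0) (.const 0) hzero (fun G d => ?_)
      fun G d k _ => dominatingSpanningOutBranching_iff
    simp [dominatingSpanningOutBranching, Finset.card_eq_zero, not_isOutBranching_empty]
  · refine fpt_of_hasTreeSolution hC False False (fun d => max d 1) hmax hmax' (fun G d => ?_)
      fun G d k hk => independentSet_iff hk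
    simp [independentSet, Finset.card_eq_zero, hempty']
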